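/- Let $0<s<\frac12$. For $\sigma\in\mathbb R$ and complex $|\kappa|\ge 1$ let $\|f\|_{H^\sigma_\kappa}^2=\int_{\mathbb R}(4|\kappa|^4+\xi^2)^\sigma|\hat f(\xi)|^2\,d\xi$ with $\hat f(\xi)=\frac1{\sqrt{2\pi}}\int e^{-i\xi x}f(x)\,dx$, let $H^\sigma=H^\sigma_1$, and $B_\delta=\{q\in H^s:\|q\|_{H^s}\le\delta\}$. For complex-valued $q$ on $\mathbb R$ put $r=-\bar q$ and $$L(\kappa)=\begin{bmatrix}\partial+i\kappa^2&-\kappa q\\-\kappa r&\partial-i\kappa^2\end{bmatrix},\qquad V=\begin{bmatrix}0&\kappa q\\ \kappa r&0\end{bmatrix},$$ let $R_0(\kappa)$ be the inverse of $L_0(\kappa)=\mathrm{diag}(\partial+i\kappa^2,\partial-i\kappa^2)$ on $L^2$, with integral kernel $G_0$, and let $G(x,y;\kappa)$ be the integral kernel of $L(\kappa)^{-1}$ on $L^2(\mathbb R)^2$, normalized so that $G-G_0$ is continuous. Put $$g_{12}(x;\kappa)=\mathrm{sgn}(i\kappa^2)\,G_{12}(x,x;\kappa),\qquad g_{21}(x;\kappa)=\mathrm{sgn}(i\kappa^2)\,G_{21}(x,x;\kappa).$$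 Let $g_{12}^{[\ell]}(x;\kappa)$, $g_{21}^{[\ell]}(x;\kappa)$ be $\mathrm{sgn}(i\kappa^2)$ times the $(1,2)$, $(2,1)$ entries at $(x,x)$ of the integral kernel of $R_0(VR_0)^\ell$ (these are of degree $\ell$ in $(q,r)$ and vanish for even $\ell$), and $g_{12}^{[\ge3]}=\sum_{\ell\ge3}g_{12}^{[\ell]}$, $g_{21}^{[\ge3]}=\sum_{\ell\ge3}g_{21}^{[\ell]}$. There are $\delta>0$ and $C$, depending only on $s$, such that for every $\kappa\in\mathbb C$ with $i\kappa^2\in\mathbb R$ and $|\kappa|\ge1$ the following hold. (0) For every $q\in B_\delta$ the kernel $G$ exists and is unique, and $g_{12}(x;\kappa)=\sum_{\ell\ge1}g_{12}^{[\ell]}(x;\kappa)$, $g_{21}(x;\kappa)=\sum_{\ell\ge1}g_{21}^{[\ell]}(x;\kappa)$ for all $x$, the series converging absolutely. (1) Each of the maps $q\mapsto g_{12}(\kappa)$ and $q\mapsto g_{21}(\kappa)$ is a real-analytic diffeomorphism of $B_\delta$ (with the $H^{s-1/2}$ structure) into $H^{s+1/2}$: it is the restriction to $B_\delta$ of a real-analytic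 diffeomorphism from an open subset of $H^{s-1/2}$ containing $B_\delta$ onto an open subset of $H^{s+1/2}$. (2) For all $q\in B_\delta$, $$\|g_{12}(\kappa)\|_{H^{s+1/2}_\kappa}+\|g_{21}(\kappa)\|_{H^{s+1/2}_\kappa}\le C|\kappa|\,\|q\|_{H^{s-1/2}_\kappa},$$ $$\|g_{12}^{[\ge3]}(\kappa)\|_{H^{s+1/2}_\kappa}+\|g_{21}^{[\ge3]}(\kappa)\|_{H^{s+1/2}_\kappa}\le C|\kappa|\,\|q\|_{H^{s-1/2}_\kappa}\|q\|_{L^2}^2.$$ (3) If $q\in B_\delta$ is a Schwartz function, then so are $g_{12}(\kappa)$ and $g_{21}(\kappa)$. -/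

import Mathlib

open MeasureTheory
open scoped SchwartzMap ENNReal NNReal ContDiff

noncomputable section

namespace DNLSGreen

/-! ### Sobolev spaces on the line -/

/-- The symbol `(4 k⁴ + ξ²) ^ (σ / 2)`. Mathlib's Fourier transform is `∫ exp (-2 π i x η) f x dx`,
so the frequency `ξ` of the unitary transform with kernel `exp (-i x ξ)` is `ξ = 2 π η`. -/
def symbol (σ k : ℝ) (η : ℝ) : ℝ := (4 * k ^ 4 + (2 * Real.pi * η) ^ 2) ^ (σ / 2)

/-- The Fourier multiplier `(4 k⁴ - ∂²) ^ (σ / 2)` on tempered distributions. -/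
def potential (σ k : ℝ) : 𝓢'(ℝ, ℂ) →L[ℂ] 𝓢'(ℝ, ℂ) :=
  TemperedDistribution.fourierMultiplierCLM ℂ (fun η : ℝ => (symbol σ k η : ℂ))

/-- The extended norm of `H^σ_k`: by Plancherel, `‖T‖² = ∫ (4 k⁴ + ξ²) ^ σ |T̂ ξ|² dξ`, where `T̂` is
the unitary Fourier transform. It is `∞` when `T` is not in `H^σ`. -/
def sobNorm (σ k : ℝ) (T : 𝓢'(ℝ, ℂ)) : ℝ≥0∞ :=
  ⨅ (u : Lp ℂ 2 (volume : Measure ℝ)) (_ : potential σ k T = Lp.toTemperedDistribution u), ‖u‖ₑ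

open Classical in
/-- The `H^σ_k` norm of a function. It is `∞` when the function is not in `L²`; this is used for
indices `σ ≥ 0`, and for `σ < 0` only on functions in `L²`. -/
def fnNorm (σ k : ℝ) (f : ℝ → ℂ) : ℝ≥0∞ :=
  if h : MemLp f 2 (volume : Measure ℝ) then
    sobNorm σ k (Lp.toTemperedDistribution (h.toLp f)) else ∞

theorem symbol_hasTemperateGrowth (σ k : ℝ) (hk : k ≠ 0) :
    (fun η : ℝ => (symbol σ k η : ℂ)).HasTemperateGrowth := by
  have hlin : (fun η : ℝ => (Real.pi / k ^ 2) * η).HasTemperateGrowth := by fun_prop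
  have h := (Function.hasTemperateGrowth_one_add_norm_sq_rpow ℝ (σ / 2)).comp hlin
  have h2 : (fun η : ℝ => ((((4 * k ^ 4) ^ (σ / 2) : ℝ) *
      (((fun x : ℝ => (1 + ‖x‖ ^ 2) ^ (σ / 2)) ∘ fun η : ℝ => (Real.pi / k ^ 2) * η) η) : ℝ) :
        ℂ)).HasTemperateGrowth := by
    have h3 := (Function.HasTemperateGrowth.const ((4 * k ^ 4) ^ (σ / 2) : ℝ) (E := ℝ)).mul h
    exact Function.HasTemperateGrowth.comp Function.Complex.hasTemperateGrowth_ofReal h3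
  convert h2 using 3 with η
  simp only [symbol, Function.comp, Real.norm_eq_abs, sq_abs]
  rw [← Real.mul_rpow (by positivity) (by positivity)]
  congr 1
  field_simp
  ring

theorem potential_neg_potential (σ k : ℝ) (hk : k ≠ 0) (T : 𝓢'(ℝ, ℂ)) :
    potential (-σ) k (potential σ k T) = T := by
  have hpos : ∀ η : ℝ, 0 < 4 * k ^ 4 + (2 * Real.pi * η) ^ 2 := fun η => by positivity
  unfold potential
  rw [TemperedDistribution.fourierMultiplierCLM_fourierMultiplierCLM_apply
    (symbol_hasTemperateGrowth σ k hk) (symbol_hasTemperateGrowth (-σ) k hk)]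
  have h1 : ((fun η : ℝ => (symbol σ k η : ℂ)) * fun η : ℝ => (symbol (-σ) k η : ℂ)) =
      fun _ => (1 : ℂ) := by
    funext η
    simp only [Pi.mul_apply, symbol]
    rw [← Complex.ofReal_mul, ← Real.rpow_add (hpos η)]
    simp [neg_div]
  rw [h1]
  simp

theorem toTemperedDistribution_injective :
    Function.Injective (Lp.toTemperedDistributionCLM ℂ (volume : Measure ℝ) 2).toLinearMap :=
  LinearMap.ker_eq_bot.1 Lp.ker_toTemperedDistributionCLM_eq_bot

/-- `H^σ(ℝ)` as a subspace of the tempered distributions. -/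
def sobolevSubmodule (σ : ℝ) : Submodule ℂ 𝓢'(ℝ, ℂ) :=
  (LinearMap.range (Lp.toTemperedDistributionCLM ℂ (volume : Measure ℝ) 2).toLinearMap).comap
    (potential σ 1).toLinearMap

/-- `H^σ(ℝ) = H^σ_1(ℝ)` as a type, which carries its own norm instead of the topology of tempered
distributions. -/
def Sobolev (σ : ℝ) : Type := sobolevSubmodule σ

namespace Sobolev

variable {σ : ℝ}

instance : AddCommGroup (Sobolev σ) := inferInstanceAs (AddCommGroup (sobolevSubmodule σ))

instance : Module ℂ (Sobolev σ) := inferInstanceAs (Module ℂ (sobolevSubmodule σ))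

/-- The inclusion of `H^σ` in the tempered distributions. -/
def toDist : Sobolev σ →ₗ[ℂ] 𝓢'(ℝ, ℂ) := (sobolevSubmodule σ).subtype

/-- The `L²` function `(4 - ∂²) ^ (σ / 2) f`. -/
def toL2 : Sobolev σ →ₗ[ℂ] Lp ℂ 2 (volume : Measure ℝ) :=
  (LinearEquiv.ofInjective _ toTemperedDistribution_injective).symm.toLinearMap ∘ₗ
    LinearMap.codRestrict _ ((potential σ 1).toLinearMap ∘ₗ toDist) (fun f => f.2)

theorem toTemperedDistribution_toL2 (f : Sobolev σ) :
    Lp.toTemperedDistribution (toL2 f) = potential σ 1 (toDist f) := by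
  have h := (LinearEquiv.ofInjective _ toTemperedDistribution_injective).apply_symm_apply
    (LinearMap.codRestrict (LinearMap.range
      (Lp.toTemperedDistributionCLM ℂ (volume : Measure ℝ) 2).toLinearMap)
      ((potential σ 1).toLinearMap ∘ₗ toDist) (fun f => f.2) f)
  exact congrArg Subtype.val h

theorem toL2_injective : Function.Injective (toL2 (σ := σ)) := by
  intro f g hfg
  have h : potential σ 1 (toDist f) = potential σ 1 (toDist g) := by
    rw [← toTemperedDistribution_toL2, ← toTemperedDistribution_toL2, hfg]
  apply Subtype.ext
  have h' := congrArg (potential (-σ) 1) h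
  rw [potential_neg_potential σ 1 one_ne_zero, potential_neg_potential σ 1 one_ne_zero] at h'
  exact h'

instance : NormedAddCommGroup (Sobolev σ) :=
  NormedAddCommGroup.induced (Sobolev σ) (Lp ℂ 2 (volume : Measure ℝ)) toL2 toL2_injective

instance : NormedSpace ℂ (Sobolev σ) :=
  NormedSpace.induced ℂ (Sobolev σ) (Lp ℂ 2 (volume : Measure ℝ)) toL2

theorem enorm_eq_sobNorm (f : Sobolev σ) : ‖f‖ₑ = sobNorm σ 1 (toDist f) := by
  have h0 : ‖f‖ₑ = ‖toL2 f‖ₑ := rfl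
  rw [h0]
  apply le_antisymm
  · refine le_iInf₂ fun u hu => ?_
    rw [← toTemperedDistribution_toL2] at hu
    rw [toTemperedDistribution_injective hu]
  · exact iInf₂_le (f := fun (u : Lp ℂ 2 (volume : Measure ℝ))
      (_ : potential σ 1 (toDist f) = Lp.toTemperedDistribution u) => ‖u‖ₑ) _ (toTemperedDistribution_toL2 f).symm

end Sobolev

/-- The closed ball `B_δ` of `H^s`, for `s ≥ 0`, as a set of `L²` functions. -/
def sobolevBall (s δ : ℝ) : Set (Lp ℂ 2 (volume : Measure ℝ)) :=
  {q | sobNorm s 1 (Lp.toTemperedDistribution q) ≤ ENNReal.ofReal δ}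

/-! ### The Lax operator and its Green's function -/

/-- The real number `i κ²`; all uses have `i κ²` real. -/
def lam (κ : ℂ) : ℝ := (Complex.I * κ ^ 2).re

/-- The Green's function `G₀(x, y; κ)` of `L₀(κ) = diag(∂ + i κ², ∂ - i κ²)`. -/
def freeGreen (κ : ℂ) (x y : ℝ) : Matrix (Fin 2) (Fin 2) ℂ :=
  if 0 < lam κ then
    (Real.exp (-lam κ * |x - y|) : ℂ) • !![if y < x then 1 else 0, 0; 0, if x < y then -1 else 0]
  else
    (Real.exp (lam κ * |x - y|) : ℂ) • !![if x < y then -1 else 0, 0; 0, if y < x then 1 else 0]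

/-- The potential matrix `L₀(κ) - L(κ)`, whose off-diagonal entries are `κ q` and `κ r`, where
`r` is minus the complex conjugate of `q`. -/
def potMatrix (κ : ℂ) (q : ℝ → ℂ) (x : ℝ) : Matrix (Fin 2) (Fin 2) ℂ :=
  !![0, κ * q x; κ * (-(starRingEnd ℂ) (q x)), 0]

/-- `L(κ) f = h` in the sense of distributions, where `L(κ)` has the rows `(∂ + i κ², -κ q)` and
`(-κ r, ∂ - i κ²)`. For `f`, `h` and `q` in `L²` all the integrals converge, so that this is the
operator `L(κ)` on `L²` with its maximal domain. -/
def LaxEq (κ : ℂ) (q : ℝ → ℂ) (f h : Fin 2 → ℝ → ℂ) : Prop :=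
  ∀ φ : ℝ → ℂ, ContDiff ℝ ∞ φ → HasCompactSupport φ →
    (∫ x, (-(deriv φ x) * f 0 x +
        φ x * (Complex.I * κ ^ 2 * f 0 x - κ * q x * f 1 x)) = ∫ x, φ x * h 0 x) ∧
    (∫ x, (-(deriv φ x) * f 1 x +
        φ x * (-(κ * (-(starRingEnd ℂ) (q x))) * f 0 x - Complex.I * κ ^ 2 * f 1 x)) =
      ∫ x, φ x * h 1 x)

/-- The integral operator on pairs of functions with matrix kernel `G`. -/
def kernelOp (G : ℝ → ℝ → Matrix (Fin 2) (Fin 2) ℂ) (h : Fin 2 → ℝ → ℂ) : Fin 2 → ℝ → ℂ :=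
  fun i x => ∑ j, ∫ y, G x y i j * h j y

/-- `G` is the integral kernel of the inverse `R(κ)` of `L(κ)` on `L²`, normalized (as a function
of two variables, rather than a class of functions) by the continuity of `G - G₀`. -/
structure IsGreen (κ : ℂ) (q : ℝ → ℂ) (G : ℝ → ℝ → Matrix (Fin 2) (Fin 2) ℂ) : Prop where
  continuous_sub : Continuous fun p : ℝ × ℝ => G p.1 p.2 - freeGreen κ p.1 p.2
  integrable : ∀ h : Fin 2 → ℝ → ℂ, (∀ i, MemLp (h i) 2 volume) →
    ∀ᵐ x : ℝ, ∀ i j, Integrable fun y => G x y i j * h j y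
  memLp : ∀ h : Fin 2 → ℝ → ℂ, (∀ i, MemLp (h i) 2 volume) →
    ∀ i, MemLp (kernelOp G h i) 2 volume
  inverse : ∀ f h : Fin 2 → ℝ → ℂ, (∀ i, MemLp (f i) 2 volume) → (∀ i, MemLp (h i) 2 volume) →
    (LaxEq κ q f h ↔ ∀ i, f i =ᵐ[volume] kernelOp G h i)

open Classical in
/-- The Green's function `G(x, y; κ)` of `L(κ)` (zero where there is none). -/
def green (κ : ℂ) (q : ℝ → ℂ) : ℝ → ℝ → Matrix (Fin 2) (Fin 2) ℂ :=
  if h : ∃ G, IsGreen κ q G then h.choose else 0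

/-- The sign of `i κ²`. -/
def sgn (κ : ℂ) : ℂ := (Real.sign (lam κ) : ℂ)

/-- `g₁₂(x; κ) = sgn(i κ²) G₁₂(x, x; κ)`. -/
def g12 (κ : ℂ) (q : ℝ → ℂ) (x : ℝ) : ℂ := sgn κ * green κ q x x 0 1

/-- `g₂₁(x; κ) = sgn(i κ²) G₂₁(x, x; κ)`. -/
def g21 (κ : ℂ) (q : ℝ → ℂ) (x : ℝ) : ℂ := sgn κ * green κ q x x 1 0

/-- The kernel of `R₀ (V R₀) ^ ℓ`, where `V = L₀ - L`: the term of degree `ℓ` in the series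
`R = ∑ R₀ (V R₀) ^ ℓ`. In terms of `Λ = (∂ + i κ²)^(-1/2) κ q (∂ - i κ²)^(-1/2)` and
`Γ = (∂ - i κ²)^(-1/2) κ r (∂ + i κ²)^(-1/2)`, the entry in the first row and second column is, for
`ℓ = 2 m + 1`, the kernel of `(∂ + i κ²)^(-1/2) Λ (Γ Λ)^m (∂ - i κ²)^(-1/2)`, and it is zero for
even `ℓ`; likewise for the other off-diagonal entry. -/
def greenTerm (κ : ℂ) (q : ℝ → ℂ) : ℕ → ℝ → ℝ → Matrix (Fin 2) (Fin 2) ℂ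
  | 0 => freeGreen κ
  | ℓ + 1 => fun x y => Matrix.of fun i j =>
      ∫ z, (freeGreen κ x z * potMatrix κ q z * greenTerm κ q ℓ z y) i j

/-- The term of degree `ℓ` of `g₁₂`. -/
def g12Term (κ : ℂ) (q : ℝ → ℂ) (ℓ : ℕ) (x : ℝ) : ℂ := sgn κ * greenTerm κ q ℓ x x 0 1

/-- The term of degree `ℓ` of `g₂₁`. -/
def g21Term (κ : ℂ) (q : ℝ → ℂ) (ℓ : ℕ) (x : ℝ) : ℂ := sgn κ * greenTerm κ q ℓ x x 1 0

/-- The sum of the terms of `g₁₂` of degree at least `m`. -/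
def g12Tail (κ : ℂ) (q : ℝ → ℂ) (m : ℕ) (x : ℝ) : ℂ := ∑' ℓ, g12Term κ q (m + ℓ) x

/-- The sum of the terms of `g₂₁` of degree at least `m`. -/
def g21Tail (κ : ℂ) (q : ℝ → ℂ) (m : ℕ) (x : ℝ) : ℂ := ∑' ℓ, g21Term κ q (m + ℓ) x

/-- The map `F`, from a set `B` of `L²` functions to functions on the line, is a real-analytic
diffeomorphism of `B`, seen in `H^a`, into `H^b`: it is the restriction to `B` of a real-analytic
diffeomorphism of an open subset of `H^a` that contains `B` onto an open subset of `H^b`. -/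
def IsAnalyticDiffeoInto (a b : ℝ) (B : Set (Lp ℂ 2 (volume : Measure ℝ)))
    (F : Lp ℂ 2 (volume : Measure ℝ) → ℝ → ℂ) : Prop :=
  ∃ Φ : OpenPartialHomeomorph (Sobolev a) (Sobolev b),
    AnalyticOnNhd ℝ Φ Φ.source ∧ AnalyticOnNhd ℝ Φ.symm Φ.target ∧
    ∀ q ∈ B, ∃ p ∈ Φ.source, Sobolev.toDist p = Lp.toTemperedDistribution q ∧
      ∃ h : MemLp (F q) 2 volume,
        Sobolev.toDist (Φ p) = Lp.toTemperedDistribution (h.toLp (F q))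

end DNLSGreen

end

noncomputable section

namespace DNLSGreen

/-! ### A quantitative analytic inverse function theorem -/

section AnalyticInverse

variable {E : Type*} [NormedAddCommGroup E] [NormedSpace ℝ E] [CompleteSpace E]

/-! Write `λ = iκ²` and `k = |κ|`, so that `|λ| = k²`. The off-diagonal entries `g = g₁₂`, `h = g₂₁`
satisfy, together with an auxiliary function `γ`, the closed system `g' = -2λg - κq(1+γ)`, `h' = 2λh
+ κr(1+γ)`, `γ² + 2γ + 4gh = 0`. The proof solves this system directly, with bounds uniform in `κ`,
and then shows that its solution is the Green's function.

Solving the system. On the Fourier side `q` is represented by `u = τ 𝓕q`, and functions in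
`H^(s+1/2)` by `v` with Fourier transform `θ v`. The powers of `k` in `τ` and `θ` are chosen so that
`-κ(∂+2λ)⁻¹` and `κ(∂-2λ)⁻¹` become multipliers of modulus one, hence isometries of `L²`
(`norm_resSymbol`), and so that `‖θ‖` in `L²` does not depend on `k` (`eLpNorm_thetaW`). The
products `H^(s+1/2) · H^(s+1/2)` and `H^(s-1/2) · H^(s+1/2)` then become bilinear maps on `L²` with
norms controlled by `s` alone (`convWeights_algebra`, `convWeights_module`). The quadratic relation,
read as `γ = -2gh - γ²/2`, is solved by a contraction argument for `u` in a ball whose radius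
depends only on `s`; `γ` is analytic in `u` and of size `‖u‖²` (`exists_solution_system`).
Consequently `g` and `h` are an isometry of `u` plus a remainder of cubic size with small Lipschitz
constant. This gives the diffeomorphism property and both estimates.

Identification. For small `‖q‖` in `L²` the Neumann series converges uniformly in `κ`, since `k ∫
exp(-k²|x-z|/2) |q(z)| dz ≤ √2 ‖q‖`, and its sum is the unique Green's function (`SmallPot.isGreen`,
`IsGreen.eq`). When `q` is Schwartz, and `λ > 0`, the quotients `h/(1+γ/2)` and `-g/(1+γ/2)` solve
Riccati equations, so they are ratios of components of solutions of the homogeneous system that stay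
bounded on the right and on the left. Gluing such solutions at `y` with the prescribed jump produces
a bounded solution of the integral equation of a column of the Green's function. Bounded solutions
are unique, so the diagonal values are `g(y)` and `h(y)` (`DiagData.neumannSum_diag`); the case `λ <
0` follows by exchanging the two components. Both sides are continuous in `q` in `L²` at each fixed
point, and Schwartz functions are dense, so the identity holds for all small `q`
(`green_eq_evalFn`). The term of degree one is identified in the same way, which makes the tail
equal to the cubic remainder.

Schwartz data. Variation of constants gives rapid decay of `g` and `h`, the quadratic relation
passes it on to `γ`, and the differential equations pass it on to all derivatives
(`IsDiagSolution.rapidDiff`). -/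

theorem exists_analytic_openPartialHomeomorph_id_add {r : ℝ} {N : E → E}
    (hN : AnalyticOnNhd ℝ N (Metric.ball 0 r)) (h0 : N 0 = 0)
    (hL : LipschitzOnWith (1 / 2) N (Metric.ball 0 r)) :
    ∃ Φ : OpenPartialHomeomorph E E, (∀ x, Φ x = x + N x) ∧ Φ.source = Metric.ball 0 r ∧
      AnalyticOnNhd ℝ Φ Φ.source ∧ AnalyticOnNhd ℝ Φ.symm Φ.target ∧
      Metric.ball 0 (r / 2) ⊆ Φ.target ∧
      ∀ x ∈ Φ.source, ∀ y ∈ Φ.source, ‖x - y‖ ≤ 2 * ‖Φ x - Φ y‖ := by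
  set f : E → E := fun x => x + N x with hf
  -- A perturbation of the identity with Lipschitz constant `1/2` is injective and open, with
  -- quantitative control of the image.
  have happ : ApproximatesLinearOn f ((ContinuousLinearEquiv.refl ℝ E : E ≃L[ℝ] E) : E →L[ℝ] E)
      (Metric.ball 0 r) (1 / 2) := by
    intro x hx y hy
    have := hL.norm_sub_le hx hy
    simpa [hf, add_sub_add_comm] using this
  have hc : Subsingleton E ∨
      (1 / 2 : ℝ≥0) < ‖((ContinuousLinearEquiv.refl ℝ E).symm : E →L[ℝ] E)‖₊⁻¹ := by
    rcases subsingleton_or_nontrivial E with h | h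
    · exact Or.inl h
    · right
      have h1 : ‖((ContinuousLinearEquiv.refl ℝ E).symm : E →L[ℝ] E)‖₊ = 1 := by
        rw [← NNReal.coe_inj]
        exact ContinuousLinearMap.norm_id
      rw [h1, inv_one]
      rw [← NNReal.coe_lt_coe]
      norm_num
  set Φ := happ.toOpenPartialHomeomorph f _ hc Metric.isOpen_ball with hΦ
  have hcoe : ∀ x, Φ x = x + N x := fun x => rfl
  have hsrc : Φ.source = Metric.ball 0 r := rfl
  have hanal : AnalyticOnNhd ℝ Φ Φ.source := fun x hx => analyticAt_id.add (hN x hx)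
  refine ⟨Φ, hcoe, hsrc, hanal, ?_, ?_, ?_⟩
  · intro a ha
    have hx : Φ.symm a ∈ Metric.ball (0 : E) r := Φ.map_target ha
    set x := Φ.symm a
    have hfd : ‖fderiv ℝ N x‖ ≤ 1 / 2 := by
      have := norm_fderiv_le_of_lipschitzOn ℝ (Metric.isOpen_ball.mem_nhds hx) hL
      simpa using this
    -- The derivative `1 + N'` is inverted by a Neumann series, which is what the analytic inverse
    -- function theorem needs at each point.
    have hlt : ‖-fderiv ℝ N x‖ < 1 := by rw [norm_neg]; linarith
    set U := Units.oneSub (-fderiv ℝ N x) hlt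
    refine Φ.analyticAt_symm (i := ContinuousLinearEquiv.ofUnit U) ha (hanal _ hx) ?_
    have hd : fderiv ℝ Φ x = 1 + fderiv ℝ N x := by
      have h1 : HasFDerivAt (fun x => x + N x) (ContinuousLinearMap.id ℝ E + fderiv ℝ N x) x :=
        (hasFDerivAt_id x).add (hN x hx).differentiableAt.hasFDerivAt
      exact h1.fderiv
    rw [hd]
    ext v
    simp [ContinuousLinearEquiv.ofUnit, U]
  · intro y hy
    have hy' : ‖y‖ < r / 2 := by simpa using hy
    rcases subsingleton_or_nontrivial E with h | h
    · have hr : 0 < r := by linarith [norm_nonneg y]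
      exact ⟨0, by simpa using hr, Subsingleton.elim _ _⟩
    · have h1 : ‖((ContinuousLinearEquiv.refl ℝ E).symm : E →L[ℝ] E)‖₊ = 1 := by
        rw [← NNReal.coe_inj]
        exact ContinuousLinearMap.norm_id
      -- The image of the ball of radius `ε` contains the ball of radius `(1 - 1/2) ε`; the choice
      -- `ε = 2 ‖y‖` just reaches `y`.
      have := happ.closedBall_subset_target hc Metric.isOpen_ball (b := 0) (ε := 2 * ‖y‖)
        (by positivity) (by
          intro z hz
          have : ‖z‖ ≤ 2 * ‖y‖ := by simpa using hz
          simp only [Metric.mem_ball, dist_zero_right]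
          linarith)
      apply this
      rw [h1]
      simp only [hf, h0, add_zero, inv_one, NNReal.coe_one, Metric.mem_closedBall, dist_zero_right]
      norm_num
      linarith
  · intro x hx y hy
    have := hL.norm_sub_le hx hy
    rw [hcoe, hcoe]
    have h2 : ‖x - y‖ ≤ ‖x + N x - (y + N y)‖ + ‖N x - N y‖ := by
      calc ‖x - y‖ = ‖(x + N x - (y + N y)) - (N x - N y)‖ := by congr 1; abel
        _ ≤ _ := norm_sub_le _ _
    have h3 : ‖N x - N y‖ ≤ 1 / 2 * ‖x - y‖ := by simpa using this
    linarith

end AnalyticInverse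

/-! ### The algebraic system -/

section System

variable {H : Type*} [NormedAddCommGroup H] [NormedSpace ℝ H]

theorem norm_bilin_sub_le {c : ℝ} {M : H →L[ℝ] H →L[ℝ] H} (hM : ‖M‖ ≤ c) (a b a' b' : H) :
    ‖M a b - M a' b'‖ ≤ c * (‖a - a'‖ * ‖b‖ + ‖a'‖ * ‖b - b'‖) := by
  have h : M a b - M a' b' = M (a - a') b + M a' (b - b') := by simp
  rw [h]
  calc _ ≤ ‖M (a - a') b‖ + ‖M a' (b - b')‖ := norm_add_le _ _
    _ ≤ c * ‖a - a'‖ * ‖b‖ + c * ‖a'‖ * ‖b - b'‖ := by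
      gcongr
      · exact (M.le_opNorm₂ _ _).trans (by gcongr)
      · exact (M.le_opNorm₂ _ _).trans (by gcongr)
    _ = _ := by ring

theorem norm_bilin_le {c : ℝ} {M : H →L[ℝ] H →L[ℝ] H} (hM : ‖M‖ ≤ c) (a b : H) :
    ‖M a b‖ ≤ c * ‖a‖ * ‖b‖ := (M.le_opNorm₂ _ _).trans (by gcongr)

theorem norm_smul_bilin_le (r : ℝ) (M : H →L[ℝ] H →L[ℝ] H) : ‖r • M‖ ≤ |r| * ‖M‖ :=
  ContinuousLinearMap.opNorm_le_bound₂ _ (by positivity) fun a b => by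
    rw [smul_apply, smul_apply, norm_smul, Real.norm_eq_abs, mul_assoc, mul_assoc]
    exact mul_le_mul_of_nonneg_left ((M.le_opNorm₂ a b).trans (by rw [mul_assoc])) (abs_nonneg r)

theorem analyticAt_bilin {E : Type*} [NormedAddCommGroup E] [NormedSpace ℝ E]
    (M : H →L[ℝ] H →L[ℝ] H) {f g : E → H} {x : E} (hf : AnalyticAt ℝ f x) (hg : AnalyticAt ℝ g x) :
    AnalyticAt ℝ (fun y => M (f y) (g y)) x :=
  (M.analyticAt_bilinear (f x, g x)).comp₂ hf hg

variable [CompleteSpace H]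

/-- The equation for `γ` is solved by inverting `(u, γ) ↦ (u, γ - P(u, γ))` on `H × H` near the
origin and evaluating the inverse at `(u, 0)`, so analyticity of `γ` comes from that of the inverse.
The radius involves only `c`, not the operators themselves; this is the source of uniformity in `κ`.
-/
theorem exists_solution_system {c : ℝ} (hc : 0 ≤ c) {S R : H →L[ℝ] H}
    {M₁ M₂ N N' : H →L[ℝ] H →L[ℝ] H} (hS : ‖S‖ ≤ 1) (hR : ‖R‖ ≤ 1) (hM₁ : ‖M₁‖ ≤ c)
    (hM₂ : ‖M₂‖ ≤ c) (hN : ‖N‖ ≤ c) (hN' : ‖N'‖ ≤ c) :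
    ∃ γ : H → H, AnalyticOnNhd ℝ γ (Metric.ball 0 (1 / (56 * (c + 1)))) ∧
      LipschitzOnWith 2 γ (Metric.ball 0 (1 / (56 * (c + 1)))) ∧ γ 0 = 0 ∧
      ∀ u ∈ Metric.ball (0 : H) (1 / (56 * (c + 1))),
        γ u = N (S u + M₁ u (γ u)) (R u + M₂ u (γ u)) + N' (γ u) (γ u) ∧
        ‖γ u‖ ≤ 8 * c * ‖u‖ ^ 2 := by
  -- On the ball of radius `ρ` the map `P` has Lipschitz constant at most `10 c ρ ≤ 10/28 < 1/2`: `8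
  -- c ρ` comes from `N`, whose arguments are bounded by `2ρ` and have Lipschitz constant `2`, and
  -- `2 c ρ` from `N'`. The inverse is defined on the ball of radius `ρ / 2`, hence `56`.
  set ρ : ℝ := 1 / (28 * (c + 1)) with hρ
  have hρ0 : 0 < ρ := by positivity
  have hcρ : c * ρ ≤ 1 / 28 := by
    rw [hρ, mul_one_div, div_le_div_iff₀ (by positivity) (by norm_num)]
    linarith
  have hε : 1 / (56 * (c + 1)) = ρ / 2 := by rw [hρ]; field_simp; norm_num
  rw [hε]
  set P : H × H → H := fun p =>
    N (S p.1 + M₁ p.1 p.2) (R p.1 + M₂ p.1 p.2) + N' p.2 p.2 with hP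
  have hPan : ∀ p, AnalyticAt ℝ P p := by
    intro p
    have h1 : AnalyticAt ℝ (fun p : H × H => p.1) p := analyticAt_fst
    have h2 : AnalyticAt ℝ (fun p : H × H => p.2) p := analyticAt_snd
    have hS' : AnalyticAt ℝ (fun p : H × H => S p.1) p := (S.analyticAt _).comp h1
    have hR' : AnalyticAt ℝ (fun p : H × H => R p.1) p := (R.analyticAt _).comp h1
    exact (analyticAt_bilin N (hS'.add (analyticAt_bilin M₁ h1 h2))
      (hR'.add (analyticAt_bilin M₂ h1 h2))).add (analyticAt_bilin N' h2 h2)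
  have key : ∀ (T : H →L[ℝ] H) (M : H →L[ℝ] H →L[ℝ] H), ‖T‖ ≤ 1 → ‖M‖ ≤ c →
      ∀ p ∈ Metric.ball (0 : H × H) ρ, ∀ p' ∈ Metric.ball (0 : H × H) ρ,
      ‖T p.1 + M p.1 p.2‖ ≤ 2 * ρ ∧
      ‖T p.1 + M p.1 p.2 - (T p'.1 + M p'.1 p'.2)‖ ≤ 2 * ‖p - p'‖ := by
    intro T M hT hM p hp p' hp'
    rw [mem_ball_zero_iff] at hp hp'
    have a1 := (norm_fst_le p).trans hp.le
    have a2 := (norm_snd_le p).trans hp.le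
    have a3 := (norm_fst_le p').trans hp'.le
    have a4 := norm_fst_le (p - p')
    have a5 := norm_snd_le (p - p')
    have b1 : ‖T p.1‖ ≤ ρ := (T.le_opNorm _).trans (by nlinarith [norm_nonneg p.1, norm_nonneg T])
    have b2 : ‖T (p - p').1‖ ≤ ‖p - p'‖ :=
      (T.le_opNorm _).trans (by nlinarith [norm_nonneg (p - p').1, norm_nonneg T])
    constructor
    · have b3 := norm_bilin_le hM p.1 p.2
      have b4 : c * ‖p.1‖ * ‖p.2‖ ≤ c * ρ * ρ := by gcongr
      have b5 : c * ρ * ρ ≤ 1 * ρ := by gcongr; linarith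
      linarith [norm_add_le (T p.1) (M p.1 p.2)]
    · have b3 := norm_bilin_sub_le hM p.1 p.2 p'.1 p'.2
      have e : T p.1 + M p.1 p.2 - (T p'.1 + M p'.1 p'.2) =
          T (p - p').1 + (M p.1 p.2 - M p'.1 p'.2) := by simp; abel
      rw [e]
      have b4 : c * (‖p.1 - p'.1‖ * ‖p.2‖ + ‖p'.1‖ * ‖p.2 - p'.2‖) ≤
          c * (‖p - p'‖ * ρ + ρ * ‖p - p'‖) := by
        gcongr
        · exact a4
        · exact a5
      have b5 : c * (‖p - p'‖ * ρ + ρ * ‖p - p'‖) ≤ 1 * ‖p - p'‖ := by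
        nlinarith [norm_nonneg (p - p')]
      linarith [norm_add_le (T (p - p').1) (M p.1 p.2 - M p'.1 p'.2)]
  have hLip : LipschitzOnWith (1 / 2) (fun p : H × H => ((0 : H), -P p)) (Metric.ball 0 ρ) := by
    apply LipschitzOnWith.of_dist_le_mul
    intro p hp p' hp'
    rw [dist_eq_norm, dist_eq_norm]
    have e : ((0 : H), -P p) - ((0 : H), -P p') = ((0 : H), -(P p - P p')) := by
      ext <;> simp; abel
    rw [e, Prod.norm_mk, norm_zero, norm_neg, max_eq_right (norm_nonneg _)]
    obtain ⟨g1, g2⟩ := key S M₁ hS hM₁ p hp p' hp'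
    obtain ⟨g3, -⟩ := key S M₁ hS hM₁ p' hp' p hp
    obtain ⟨h1, h2⟩ := key R M₂ hR hM₂ p hp p' hp'
    have n1 := norm_bilin_sub_le hN (S p.1 + M₁ p.1 p.2) (R p.1 + M₂ p.1 p.2)
      (S p'.1 + M₁ p'.1 p'.2) (R p'.1 + M₂ p'.1 p'.2)
    have n2 := norm_bilin_sub_le hN' p.2 p.2 p'.2 p'.2
    have n3 : ‖P p - P p'‖ ≤ ‖N (S p.1 + M₁ p.1 p.2) (R p.1 + M₂ p.1 p.2) -
        N (S p'.1 + M₁ p'.1 p'.2) (R p'.1 + M₂ p'.1 p'.2)‖ +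
        ‖N' p.2 p.2 - N' p'.2 p'.2‖ := by
      rw [hP]; simp only; rw [add_sub_add_comm]; exact norm_add_le _ _
    rw [mem_ball_zero_iff] at hp hp'
    have a2 := (norm_snd_le p).trans hp.le
    have a3 := (norm_snd_le p').trans hp'.le
    have a5 : ‖p.2 - p'.2‖ ≤ ‖p - p'‖ := norm_snd_le (p - p')
    have m1 := n1.trans (mul_le_mul_of_nonneg_left (add_le_add
      (mul_le_mul g2 h1 (norm_nonneg _) (by positivity))
      (mul_le_mul g3 h2 (norm_nonneg _) (by positivity))) hc)
    have m2 := n2.trans (mul_le_mul_of_nonneg_left (add_le_add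
      (mul_le_mul a5 a2 (norm_nonneg _) (by positivity))
      (mul_le_mul a3 a5 (norm_nonneg _) (by positivity))) hc)
    have : (((1 / 2 : ℝ≥0)) : ℝ) = 1 / 2 := by norm_num
    rw [this]
    nlinarith [norm_nonneg (p - p')]
  have hP0 : P 0 = 0 := by simp [hP]
  obtain ⟨Ψ, hΨ, hsrc, -, hsymm, hball, hinj⟩ := exists_analytic_openPartialHomeomorph_id_add
    (r := ρ) (N := fun p : H × H => ((0 : H), -P p))
    (fun p _ => analyticAt_const.prod (hPan p).neg) (by simp [hP0]) hLip
  have hmem : ∀ u ∈ Metric.ball (0 : H) (ρ / 2), (u, (0 : H)) ∈ Ψ.target := by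
    intro u hu
    apply hball
    rw [mem_ball_zero_iff] at hu ⊢
    simpa [Prod.norm_mk] using hu
  have hfst : ∀ u ∈ Metric.ball (0 : H) (ρ / 2), (Ψ.symm (u, 0)).1 = u ∧
      (Ψ.symm (u, 0)).2 = P (u, (Ψ.symm (u, 0)).2) := by
    intro u hu
    have h := Ψ.right_inv (hmem u hu)
    rw [hΨ] at h
    have h1 := congrArg Prod.fst h
    have h2 := congrArg Prod.snd h
    simp only [Prod.fst_add, Prod.snd_add, add_zero] at h1 h2
    refine ⟨h1, ?_⟩
    rw [← sub_eq_add_neg, sub_eq_zero] at h2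
    conv_lhs => rw [h2]
    congr 1
    exact Prod.ext h1 rfl
  have hΨ0 : Ψ.symm (0, 0) = 0 := by
    have h0 : (0 : H × H) ∈ Ψ.source := by rw [hsrc]; simpa using hρ0
    have h1 := Ψ.left_inv h0
    rwa [hΨ, hP0, neg_zero, zero_add] at h1
  have hLip2 : LipschitzOnWith 2 (fun u => (Ψ.symm (u, 0)).2) (Metric.ball 0 (ρ / 2)) := by
    apply LipschitzOnWith.of_dist_le_mul
    intro u hu u' hu'
    rw [dist_eq_norm, dist_eq_norm]
    have h := hinj _ (Ψ.map_target (hmem u hu)) _ (Ψ.map_target (hmem u' hu'))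
    rw [Ψ.right_inv (hmem u hu), Ψ.right_inv (hmem u' hu')] at h
    have h1 : ‖((u, (0 : H)) - (u', 0) : H × H)‖ = ‖u - u'‖ := by
      simp [Prod.norm_mk]
    rw [h1] at h
    exact (norm_snd_le (Ψ.symm (u, 0) - Ψ.symm (u', 0))).trans (by simpa using h)
  refine ⟨fun u => (Ψ.symm (u, 0)).2, ?_, hLip2, ?_, ?_⟩
  · intro u hu
    have h1 : AnalyticAt ℝ (fun u : H => (u, (0 : H))) u := analyticAt_id.prod analyticAt_const
    exact analyticAt_snd.comp ((hsymm _ (hmem u hu)).comp (f := fun u : H => (u, (0 : H))) h1)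
  · simp [hΨ0]
  · intro u hu
    obtain ⟨h1, h2⟩ := hfst u hu
    refine ⟨h2, ?_⟩
    -- The Lipschitz bound gives only `‖γ‖ ≤ 2‖u‖`. Inserted into the quadratic equation it yields
    -- the quadratic bound, with constant `(3/2)² + 2² ≤ 8`.
    have h3 := hLip2.norm_sub_le hu (Metric.mem_ball_self (by positivity))
    simp only [hΨ0, Prod.snd_zero, sub_zero] at h3
    set γ := (Ψ.symm (u, 0)).2
    have h3' : ‖γ‖ ≤ 2 * ‖u‖ := by simpa using h3
    rw [mem_ball_zero_iff] at hu
    have key2 : ∀ (T : H →L[ℝ] H) (M : H →L[ℝ] H →L[ℝ] H), ‖T‖ ≤ 1 → ‖M‖ ≤ c →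
        ‖T u + M u γ‖ ≤ 3 / 2 * ‖u‖ := by
      intro T M hT hM
      have b1 : ‖T u‖ ≤ ‖u‖ := (T.le_opNorm _).trans (by nlinarith [norm_nonneg u])
      have b2 := norm_bilin_le hM u γ
      have b3 : c * ‖u‖ * ‖γ‖ ≤ c * ‖u‖ * ρ := by gcongr; linarith
      nlinarith [norm_add_le (T u) (M u γ), norm_nonneg u]
    have e1 : ‖γ‖ ≤ ‖N (S u + M₁ u γ) (R u + M₂ u γ)‖ + ‖N' γ γ‖ := by
      conv_lhs => rw [h2]
      exact norm_add_le _ _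
    have e2 := norm_bilin_le hN (S u + M₁ u γ) (R u + M₂ u γ)
    have e3 := norm_bilin_le hN' γ γ
    have e4 : c * ‖S u + M₁ u γ‖ * ‖R u + M₂ u γ‖ ≤ c * (3 / 2 * ‖u‖) * (3 / 2 * ‖u‖) := by
      gcongr
      · exact key2 S M₁ hS hM₁
      · exact key2 R M₂ hR hM₂
    have e5 : c * ‖γ‖ * ‖γ‖ ≤ c * (2 * ‖u‖) * (2 * ‖u‖) := by gcongr
    nlinarith [mul_nonneg hc (sq_nonneg ‖u‖)]

/-- The map factors as `S` after `u ↦ u + S⁻¹ M(u, γ u)`. Since `S` is an isometry, the perturbation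
has Lipschitz constant at most `4 c ε ≤ 4/56`, whatever `S` is. -/
theorem exists_analytic_openPartialHomeomorph_bilin {c : ℝ} (hc : 0 ≤ c) (S : H ≃ₗᵢ[ℝ] H)
    {M : H →L[ℝ] H →L[ℝ] H} (hM : ‖M‖ ≤ c) {γ : H → H}
    (hγ : AnalyticOnNhd ℝ γ (Metric.ball 0 (1 / (56 * (c + 1)))))
    (hL : LipschitzOnWith 2 γ (Metric.ball 0 (1 / (56 * (c + 1))))) (h0 : γ 0 = 0) :
    ∃ Φ : OpenPartialHomeomorph H H, (∀ u, Φ u = S u + M u (γ u)) ∧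
      Φ.source = Metric.ball 0 (1 / (56 * (c + 1))) ∧
      AnalyticOnNhd ℝ Φ Φ.source ∧ AnalyticOnNhd ℝ Φ.symm Φ.target := by
  set ε : ℝ := 1 / (56 * (c + 1)) with hε
  have hε0 : 0 < ε := by positivity
  have hcε : c * ε ≤ 1 / 56 := by
    rw [hε, mul_one_div, div_le_div_iff₀ (by positivity) (by norm_num)]
    linarith
  have hbd : ∀ u ∈ Metric.ball (0 : H) ε, ‖γ u‖ ≤ 2 * ε := by
    intro u hu
    have h := hL.norm_sub_le hu (Metric.mem_ball_self hε0)
    rw [h0, sub_zero, sub_zero] at h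
    rw [mem_ball_zero_iff] at hu
    have : ((2 : ℝ≥0) : ℝ) = 2 := by norm_num
    rw [this] at h
    linarith
  have hSc : ∀ x, AnalyticAt ℝ S x := fun x => (S : H →L[ℝ] H).analyticAt x
  have hSs : ∀ x, AnalyticAt ℝ S.symm x := fun x => (S.symm : H →L[ℝ] H).analyticAt x
  obtain ⟨Φ, hΦ, hsrc, ha, hs, -, -⟩ := exists_analytic_openPartialHomeomorph_id_add
    (r := ε) (N := fun u => S.symm (M u (γ u)))
    (fun u hu => (hSs _).comp (g := S.symm) (analyticAt_bilin M analyticAt_id (hγ u hu)))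
    (by simp) (by
      apply LipschitzOnWith.of_dist_le_mul
      intro u hu u' hu'
      rw [dist_eq_norm, dist_eq_norm, ← map_sub, LinearIsometryEquiv.norm_map]
      have h1 := norm_bilin_sub_le hM u (γ u) u' (γ u')
      have h2 := hL.norm_sub_le hu hu'
      have h3 := hbd u hu
      rw [mem_ball_zero_iff] at hu'
      have e2 : ((2 : ℝ≥0) : ℝ) = 2 := by norm_num
      have e1 : (((1 / 2 : ℝ≥0)) : ℝ) = 1 / 2 := by norm_num
      rw [e2] at h2
      rw [e1]
      have h4 : ‖u - u'‖ * ‖γ u‖ + ‖u'‖ * ‖γ u - γ u'‖ ≤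
          ‖u - u'‖ * (2 * ε) + ε * (2 * ‖u - u'‖) := by gcongr
      have h5 := h1.trans (mul_le_mul_of_nonneg_left h4 hc)
      nlinarith [norm_nonneg (u - u')])
  refine ⟨Φ.transHomeomorph S.toHomeomorph, ?_, hsrc, ?_, ?_⟩
  · intro u
    simp [hΦ]
  · intro u hu
    exact (hSc _).comp (ha u hu)
  · intro u hu
    have hu' : S.symm u ∈ Φ.target := by simpa using hu
    exact (hs _ hu').comp (hSs u)

end System

end DNLSGreen

end

noncomputable section

namespace DNLSGreen

/-! ### Weighted convolutions on `L²` -/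

theorem sq_lintegral_mul_le {α : Type*} [MeasurableSpace α] {μ : Measure α} {f g : α → ℝ≥0∞}
    (hf : AEMeasurable f μ) (hg : AEMeasurable g μ) :
    (∫⁻ x, f x * g x ∂μ) ^ 2 ≤ (∫⁻ x, f x ^ 2 ∂μ) * ∫⁻ x, g x ^ 2 ∂μ := by
  have h := ENNReal.lintegral_mul_le_Lp_mul_Lq μ Real.HolderConjugate.two_two hf hg
  simp only [Pi.mul_apply, ENNReal.rpow_ofNat] at h
  calc (∫⁻ x, f x * g x ∂μ) ^ 2
      ≤ ((∫⁻ x, f x ^ 2 ∂μ) ^ (1 / 2 : ℝ) * (∫⁻ x, g x ^ 2 ∂μ) ^ (1 / 2 : ℝ)) ^ 2 := by gcongr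
    _ = _ := by
      rw [mul_pow, ← ENNReal.rpow_natCast, ← ENNReal.rpow_natCast, ← ENNReal.rpow_mul,
        ← ENNReal.rpow_mul]
      norm_num

theorem aemeasurable_comp_sub {g : ℝ → ℝ≥0∞} (hg : AEMeasurable g) (x : ℝ) :
    AEMeasurable fun y => g (x - y) :=
  hg.comp_quasiMeasurePreserving (quasiMeasurePreserving_sub_left_of_right_invariant volume x)

theorem aemeasurable_comp_sub_prod {g : ℝ → ℝ≥0∞} (hg : AEMeasurable g) :
    AEMeasurable (fun p : ℝ × ℝ => g (p.1 - p.2)) (volume.prod volume) :=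
  hg.comp_quasiMeasurePreserving (quasiMeasurePreserving_sub_of_right_invariant volume volume)

/-- Young's inequality for `L¹ * L²`. -/
theorem lintegral_sq_lconv_le {f g : ℝ → ℝ≥0∞} (hf : AEMeasurable f) (hg : AEMeasurable g) :
    ∫⁻ x, (∫⁻ y, f y * g (x - y)) ^ 2 ≤ (∫⁻ y, f y) ^ 2 * ∫⁻ y, g y ^ 2 := by
  have h1 : ∀ x, (∫⁻ y, f y * g (x - y)) ^ 2 ≤ (∫⁻ y, f y) * ∫⁻ y, f y * g (x - y) ^ 2 := by
    intro x
    have e : ∀ y, f y = f y ^ (1 / 2 : ℝ) * f y ^ (1 / 2 : ℝ) := by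
      intro y
      rw [← ENNReal.rpow_add_of_nonneg _ _ (by norm_num) (by norm_num)]
      norm_num
    have e2 : ∀ y, (f y ^ (1 / 2 : ℝ)) ^ 2 = f y := by
      intro y
      rw [← ENNReal.rpow_natCast, ← ENNReal.rpow_mul]
      norm_num
    have h := sq_lintegral_mul_le (μ := volume) (f := fun y => f y ^ (1 / 2 : ℝ))
      (g := fun y => f y ^ (1 / 2 : ℝ) * g (x - y)) (hf.pow_const _)
      ((hf.pow_const _).mul (aemeasurable_comp_sub hg x))
    simp only [← mul_assoc, ← e, mul_pow, e2] at h
    exact h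
  calc ∫⁻ x, (∫⁻ y, f y * g (x - y)) ^ 2
      ≤ ∫⁻ x, (∫⁻ y, f y) * ∫⁻ y, f y * g (x - y) ^ 2 := lintegral_mono h1
    _ = (∫⁻ y, f y) * ∫⁻ x, ∫⁻ y, f y * g (x - y) ^ 2 := by
      apply lintegral_const_mul''
      exact (hf.comp_snd.mul ((aemeasurable_comp_sub_prod hg).pow_const 2)).lintegral_prod_right'
    _ = (∫⁻ y, f y) * ∫⁻ y, ∫⁻ x, f y * g (x - y) ^ 2 := by
      rw [lintegral_lintegral_swap]
      exact hf.comp_snd.mul ((aemeasurable_comp_sub_prod hg).pow_const 2)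
    _ = (∫⁻ y, f y) * ∫⁻ y, f y * ∫⁻ x, g x ^ 2 := by
      congr 2
      funext y
      rw [lintegral_const_mul'', lintegral_sub_right_eq_self (fun x => g x ^ 2)]
      exact (hg.comp_quasiMeasurePreserving
        (measurePreserving_sub_right volume y).quasiMeasurePreserving).pow_const 2
    _ = _ := by
      rw [lintegral_mul_const'' _ hf, sq, mul_assoc]

theorem lintegral_lconv_comm {f g : ℝ → ℝ≥0∞} (x : ℝ) :
    ∫⁻ y, f y * g (x - y) = ∫⁻ y, g y * f (x - y) := by
  rw [← lintegral_sub_left_eq_self (fun y => f y * g (x - y)) x]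
  simp [mul_comm]

theorem sq_lconv_le {f g : ℝ → ℝ≥0∞} (hf : AEMeasurable f) (hg : AEMeasurable g) (x : ℝ) :
    (∫⁻ y, f y * g (x - y)) ^ 2 ≤ (∫⁻ y, f y ^ 2) * ∫⁻ y, g y ^ 2 := by
  refine (sq_lintegral_mul_le hf (aemeasurable_comp_sub hg x)).trans ?_
  rw [lintegral_sub_left_eq_self (fun y => g y ^ 2) x]

/-- Weights `a`, `b`, `c` for which the weighted convolution is bounded on `L²`. -/
structure ConvWeights (a b c θ : ℝ → ℝ) (C : ℝ) : Prop where
  continuous_a : Continuous a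
  continuous_b : Continuous b
  continuous_c : Continuous c
  continuous_θ : Continuous θ
  a_nonneg : ∀ x, 0 ≤ a x
  b_nonneg : ∀ x, 0 ≤ b x
  c_nonneg : ∀ x, 0 ≤ c x
  θ_nonneg : ∀ x, 0 ≤ θ x
  C_nonneg : 0 ≤ C
  memLp_θ : MemLp θ 2 volume
  bound : ∀ ξ η, c ξ * a (ξ - η) * b η ≤ C * (θ ξ + θ η + θ (ξ - η))

theorem sq_add_add_le (x y z : ℝ≥0∞) : (x + y + z) ^ 2 ≤ 3 * (x ^ 2 + y ^ 2 + z ^ 2) := by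
  rcases eq_or_ne x ∞ with hx | hx
  · simp [hx, ENNReal.mul_top]
  rcases eq_or_ne y ∞ with hy | hy
  · simp [hy, ENNReal.mul_top]
  rcases eq_or_ne z ∞ with hz | hz
  · simp [hz, ENNReal.mul_top]
  lift x to ℝ≥0 using hx
  lift y to ℝ≥0 using hy
  lift z to ℝ≥0 using hz
  norm_cast
  rw [← NNReal.coe_le_coe]
  push_cast
  nlinarith [sq_nonneg ((x : ℝ) - y), sq_nonneg ((y : ℝ) - z), sq_nonneg ((x : ℝ) - z)]

/-- The weighted convolution `c · ((b v) * (a u))`. -/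
def wconv (a b c : ℝ → ℝ) (u v : ℝ → ℂ) (ξ : ℝ) : ℂ :=
  (c ξ : ℂ) * ∫ η, ((b η : ℂ) * v η) * ((a (ξ - η) : ℂ) * u (ξ - η))

section WConv

variable {a b c θ : ℝ → ℝ} {C : ℝ}

/-- The bound on the weights splits the kernel into three pieces, each carrying one factor `θ` in
`L²`. With `θ` at the output frequency, the convolution of two `L²` functions is bounded and `θ`
restores square integrability. With `θ` at an input frequency, `θ` times that input is in `L¹`, and
Young's inequality applies. The factor `9` is `3` from squaring a sum of three terms, times three
pieces. -/
theorem ConvWeights.lintegral_sq_le (hw : ConvWeights a b c θ C) {u v : ℝ → ℝ≥0∞}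
    (hu : AEMeasurable u) (hv : AEMeasurable v) :
    ∫⁻ ξ, (∫⁻ η, ‖c ξ * a (ξ - η) * b η‖ₑ * (v η * u (ξ - η))) ^ 2 ≤
      9 * ENNReal.ofReal C ^ 2 * (∫⁻ ξ, ‖θ ξ‖ₑ ^ 2) * (∫⁻ η, u η ^ 2) * ∫⁻ η, v η ^ 2 := by
  have hθm : AEMeasurable fun η => ‖θ η‖ₑ := hw.continuous_θ.enorm.measurable.aemeasurable
  set I₁ : ℝ → ℝ≥0∞ := fun ξ => ‖θ ξ‖ₑ * ∫⁻ η, v η * u (ξ - η)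
  set I₂ : ℝ → ℝ≥0∞ := fun ξ => ∫⁻ η, (‖θ η‖ₑ * v η) * u (ξ - η)
  set I₃ : ℝ → ℝ≥0∞ := fun ξ => ∫⁻ η, v η * (‖θ (ξ - η)‖ₑ * u (ξ - η))
  have hpt : ∀ ξ, ∫⁻ η, ‖c ξ * a (ξ - η) * b η‖ₑ * (v η * u (ξ - η)) ≤
      ENNReal.ofReal C * (I₁ ξ + I₂ ξ + I₃ ξ) := by
    intro ξ
    have hu' := aemeasurable_comp_sub hu ξ
    have hθ' := aemeasurable_comp_sub hθm ξ
    have hk : ∀ η, ‖c ξ * a (ξ - η) * b η‖ₑ ≤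
        ENNReal.ofReal C * (‖θ ξ‖ₑ + ‖θ η‖ₑ + ‖θ (ξ - η)‖ₑ) := by
      intro η
      rw [Real.enorm_eq_ofReal (hw.θ_nonneg _), Real.enorm_eq_ofReal (hw.θ_nonneg _),
        Real.enorm_eq_ofReal (hw.θ_nonneg _), Real.enorm_eq_ofReal (by
          have := hw.a_nonneg (ξ - η); have := hw.b_nonneg η; have := hw.c_nonneg ξ; positivity),
        ← ENNReal.ofReal_add (hw.θ_nonneg _) (hw.θ_nonneg _),
        ← ENNReal.ofReal_add (add_nonneg (hw.θ_nonneg _) (hw.θ_nonneg _)) (hw.θ_nonneg _),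
        ← ENNReal.ofReal_mul hw.C_nonneg]
      exact ENNReal.ofReal_le_ofReal (hw.bound ξ η)
    calc _ ≤ ∫⁻ η, ENNReal.ofReal C * (‖θ ξ‖ₑ * (v η * u (ξ - η)) +
          (‖θ η‖ₑ * v η) * u (ξ - η) + v η * (‖θ (ξ - η)‖ₑ * u (ξ - η))) := by
          apply lintegral_mono
          intro η
          refine (mul_le_mul_left (hk η) _).trans (le_of_eq ?_)
          ring
      _ = _ := by
          rw [lintegral_const_mul'', lintegral_add_right', lintegral_add_right',
            lintegral_const_mul'']
          · exact hv.mul hu'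
          · exact (hθm.mul hv).mul hu'
          · exact hv.mul (hθ'.mul hu')
          · exact (((hv.mul hu').const_mul _).add ((hθm.mul hv).mul hu')).add
              (hv.mul (hθ'.mul hu'))
  have h1 : ∫⁻ ξ, I₁ ξ ^ 2 ≤ (∫⁻ ξ, ‖θ ξ‖ₑ ^ 2) * ((∫⁻ η, u η ^ 2) * ∫⁻ η, v η ^ 2) := by
    rw [← lintegral_mul_const'' _ (hθm.pow_const 2)]
    apply lintegral_mono
    intro ξ
    simp only [I₁, mul_pow]
    gcongr
    rw [mul_comm (∫⁻ η, u η ^ 2)]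
    exact sq_lconv_le hv hu ξ
  have h2 : ∫⁻ ξ, I₂ ξ ^ 2 ≤ (∫⁻ ξ, ‖θ ξ‖ₑ ^ 2) * ((∫⁻ η, u η ^ 2) * ∫⁻ η, v η ^ 2) := by
    refine (lintegral_sq_lconv_le (hθm.mul hv) hu).trans ?_
    rw [mul_comm (∫⁻ η, u η ^ 2), ← mul_assoc]
    gcongr
    exact sq_lintegral_mul_le hθm hv
  have h3 : ∫⁻ ξ, I₃ ξ ^ 2 ≤ (∫⁻ ξ, ‖θ ξ‖ₑ ^ 2) * ((∫⁻ η, u η ^ 2) * ∫⁻ η, v η ^ 2) := by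
    -- Reflecting the convolution moves `θ` onto the first factor, so that this piece is estimated
    -- like `I₂` with `u` and `v` exchanged.
    have e : ∀ ξ, I₃ ξ = ∫⁻ η, (‖θ η‖ₑ * u η) * v (ξ - η) := by
      intro ξ
      exact lintegral_lconv_comm (f := v) (g := fun η => ‖θ η‖ₑ * u η) ξ
    simp only [e]
    refine (lintegral_sq_lconv_le (hθm.mul hu) hv).trans ?_
    rw [← mul_assoc]
    gcongr
    exact sq_lintegral_mul_le hθm hu
  calc _ ≤ ∫⁻ ξ, ENNReal.ofReal C ^ 2 * (3 * (I₁ ξ ^ 2 + I₂ ξ ^ 2 + I₃ ξ ^ 2)) := by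
        apply lintegral_mono
        intro ξ
        refine (pow_le_pow_left' (hpt ξ) 2).trans ?_
        rw [mul_pow]
        exact mul_le_mul_right (sq_add_add_le _ _ _) _
    _ ≤ ENNReal.ofReal C ^ 2 * (3 * (∫⁻ ξ, I₁ ξ ^ 2 + I₂ ξ ^ 2 + I₃ ξ ^ 2)) := by
        rw [lintegral_const_mul' _ _ (by finiteness), lintegral_const_mul' _ _ (by finiteness)]
    _ = ENNReal.ofReal C ^ 2 * (3 * ((∫⁻ ξ, I₁ ξ ^ 2) + (∫⁻ ξ, I₂ ξ ^ 2) + ∫⁻ ξ, I₃ ξ ^ 2)) := by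
        have hm1 : AEMeasurable I₁ :=
          hθm.mul (hv.comp_snd.mul (aemeasurable_comp_sub_prod hu)).lintegral_prod_right'
        have hm2 : AEMeasurable I₂ :=
          ((hθm.mul hv).comp_snd.mul (aemeasurable_comp_sub_prod hu)).lintegral_prod_right'
        rw [lintegral_add_left', lintegral_add_left']
        · exact hm1.pow_const 2
        · exact (hm1.pow_const 2).add (hm2.pow_const 2)
    _ ≤ ENNReal.ofReal C ^ 2 * (3 * ((∫⁻ ξ, ‖θ ξ‖ₑ ^ 2) * ((∫⁻ η, u η ^ 2) * ∫⁻ η, v η ^ 2) +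
        (∫⁻ ξ, ‖θ ξ‖ₑ ^ 2) * ((∫⁻ η, u η ^ 2) * ∫⁻ η, v η ^ 2) +
        (∫⁻ ξ, ‖θ ξ‖ₑ ^ 2) * ((∫⁻ η, u η ^ 2) * ∫⁻ η, v η ^ 2))) := by gcongr
    _ = _ := by ring

theorem eLpNorm_two_sq {E : Type*} [NormedAddCommGroup E] {α : Type*} [MeasurableSpace α]
    {μ : Measure α} (f : α → E) : eLpNorm f 2 μ ^ 2 = ∫⁻ x, ‖f x‖ₑ ^ 2 ∂μ := by
  rw [eLpNorm_eq_lintegral_rpow_enorm_toReal (by norm_num) (by norm_num), ← ENNReal.rpow_natCast,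
    ← ENNReal.rpow_mul]
  norm_num

theorem enorm_wconv_integrand (u v : ℝ → ℂ) (ξ η : ℝ) :
    ‖(c ξ : ℂ) * (((b η : ℂ) * v η) * ((a (ξ - η) : ℂ) * u (ξ - η)))‖ₑ =
      ‖c ξ * a (ξ - η) * b η‖ₑ * (‖v η‖ₑ * ‖u (ξ - η)‖ₑ) := by
  have e : ∀ x : ℝ, ‖(x : ℂ)‖ₑ = ‖x‖ₑ := fun x => by
    rw [← ofReal_norm, ← ofReal_norm, Complex.norm_real]
  simp only [enorm_mul, e]
  ring

theorem ConvWeights.aestronglyMeasurable_wconv (hw : ConvWeights a b c θ C) {u v : ℝ → ℂ}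
    (hu : AEStronglyMeasurable u) (hv : AEStronglyMeasurable v) :
    AEStronglyMeasurable (wconv a b c u v) := by
  have h := AEStronglyMeasurable.convolution_integrand (μ := volume) (ν := volume)
    (ContinuousLinearMap.mul ℂ ℂ)
    ((Complex.continuous_ofReal.comp hw.continuous_b).aestronglyMeasurable.mul hv)
    ((Complex.continuous_ofReal.comp hw.continuous_a).aestronglyMeasurable.mul hu)
  exact (Complex.continuous_ofReal.comp hw.continuous_c).aestronglyMeasurable.mul
    h.integral_prod_right'

theorem ConvWeights.eLpNorm_wconv_le (hw : ConvWeights a b c θ C) {u v : ℝ → ℂ}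
    (hu : AEStronglyMeasurable u) (hv : AEStronglyMeasurable v) :
    eLpNorm (wconv a b c u v) 2 volume ≤
      3 * ENNReal.ofReal C * eLpNorm θ 2 volume * eLpNorm u 2 volume * eLpNorm v 2 volume := by
  rw [← ENNReal.pow_le_pow_left_iff (n := 2) (by norm_num)]
  simp only [mul_pow, eLpNorm_two_sq]
  refine le_trans (lintegral_mono fun ξ => ?_) ((hw.lintegral_sq_le hu.enorm hv.enorm).trans
    (le_of_eq (by norm_num)))
  refine pow_le_pow_left' ?_ 2
  rw [wconv, ← integral_const_mul]
  refine (enorm_integral_le_lintegral_enorm _).trans (lintegral_mono fun η => ?_)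
  rw [enorm_wconv_integrand]

/-- The absolute integrals form an `L²` function of `ξ`, so they are finite almost everywhere;
positivity of `c` allows division by the outer weight. Additivity of the Bochner integral, and thus
bilinearity of `wconvL`, rests on this. -/
theorem ConvWeights.ae_integrable (hw : ConvWeights a b c θ C) {u v : ℝ → ℂ}
    (hc : ∀ x, 0 < c x) (hu : MemLp u 2) (hv : MemLp v 2) :
    ∀ᵐ ξ, Integrable fun η => ((b η : ℂ) * v η) * ((a (ξ - η) : ℂ) * u (ξ - η)) := by
  have h := hw.lintegral_sq_le hu.1.enorm hv.1.enorm
  have hfin : ∫⁻ ξ, (∫⁻ η, ‖c ξ * a (ξ - η) * b η‖ₑ * (‖v η‖ₑ * ‖u (ξ - η)‖ₑ)) ^ 2 ≠ (⊤ : ℝ≥0∞) := by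
    refine ne_top_of_le_ne_top ?_ h
    simp only [← eLpNorm_two_sq]
    have := hw.memLp_θ.2.ne
    have := hu.2.ne
    have := hv.2.ne
    finiteness
  have hmeas : AEStronglyMeasurable (fun p : ℝ × ℝ => ((b p.2 : ℂ) * v p.2) *
      ((a (p.1 - p.2) : ℂ) * u (p.1 - p.2))) (volume.prod volume) :=
    AEStronglyMeasurable.convolution_integrand (μ := volume) (ν := volume)
      (ContinuousLinearMap.mul ℂ ℂ)
      ((Complex.continuous_ofReal.comp hw.continuous_b).aestronglyMeasurable.mul hv.1)
      ((Complex.continuous_ofReal.comp hw.continuous_a).aestronglyMeasurable.mul hu.1)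
  have hm2 : AEMeasurable (fun ξ => (∫⁻ η, ‖c ξ * a (ξ - η) * b η‖ₑ *
      (‖v η‖ₑ * ‖u (ξ - η)‖ₑ)) ^ 2) := by
    have := (((Complex.continuous_ofReal.comp hw.continuous_c).aestronglyMeasurable
      (μ := volume)).comp_fst (ν := volume)).mul hmeas
    have := (this.enorm.lintegral_prod_right').pow_const 2
    refine this.congr (Filter.Eventually.of_forall fun ξ => ?_)
    simp only [Function.comp, Pi.mul_apply]
    congr 1
    exact lintegral_congr fun η => enorm_wconv_integrand u v ξ η
  filter_upwards [ae_lt_top' hm2 hfin] with ξ hξ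
  have hcξ : (c ξ : ℂ) ≠ 0 := by exact_mod_cast (hc ξ).ne'
  have h3 : Integrable fun η => (c ξ : ℂ) * (((b η : ℂ) * v η) *
      ((a (ξ - η) : ℂ) * u (ξ - η))) := by
    constructor
    · refine aestronglyMeasurable_const.mul ?_
      exact AEStronglyMeasurable.convolution_integrand_snd (μ := volume)
        (ContinuousLinearMap.mul ℂ ℂ)
        ((Complex.continuous_ofReal.comp hw.continuous_b).aestronglyMeasurable.mul hv.1)
        ((Complex.continuous_ofReal.comp hw.continuous_a).aestronglyMeasurable.mul hu.1) ξ
    · rw [HasFiniteIntegral]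
      simp only [enorm_wconv_integrand]
      by_contra hcon
      rw [not_lt_top_iff] at hcon
      rw [hcon] at hξ
      simp at hξ
  have h4 := h3.const_mul (c ξ : ℂ)⁻¹
  simpa [inv_mul_cancel_left₀ hcξ] using h4

theorem ConvWeights.memLp_wconv (hw : ConvWeights a b c θ C) {u v : ℝ → ℂ}
    (hu : MemLp u 2) (hv : MemLp v 2) : MemLp (wconv a b c u v) 2 := by
  refine ⟨hw.aestronglyMeasurable_wconv hu.1 hv.1, (hw.eLpNorm_wconv_le hu.1 hv.1).trans_lt ?_⟩
  have := hw.memLp_θ.2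
  have := hu.2
  have := hv.2
  finiteness

theorem wconv_congr {u u' v v' : ℝ → ℂ} (hu : u =ᵐ[volume] u') (hv : v =ᵐ[volume] v') :
    wconv a b c u v = wconv a b c u' v' := by
  funext ξ
  simp only [wconv]
  congr 1
  apply integral_congr_ae
  have hu2 := (quasiMeasurePreserving_sub_left_of_right_invariant volume ξ).ae hu
  filter_upwards [hv, hu2] with η h1 h2
  rw [h1, h2]

/-- The weighted convolution as a bounded bilinear map on `L²`. -/
def wconvL (hw : ConvWeights a b c θ C) (hc : ∀ x, 0 < c x) :
    Lp ℂ 2 (volume : Measure ℝ) →L[ℝ] Lp ℂ 2 (volume : Measure ℝ) →L[ℝ]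
      Lp ℂ 2 (volume : Measure ℝ) :=
  LinearMap.mkContinuous₂
    (LinearMap.mk₂ ℝ (fun u v => (hw.memLp_wconv (Lp.memLp u) (Lp.memLp v)).toLp (wconv a b c u v))
      (by
        intro u u' v
        rw [← MemLp.toLp_add, MemLp.toLp_eq_toLp_iff]
        rw [wconv_congr (Lp.coeFn_add u u') (Filter.EventuallyEq.refl _ v)]
        filter_upwards [hw.ae_integrable hc (Lp.memLp u) (Lp.memLp v),
          hw.ae_integrable hc (Lp.memLp u') (Lp.memLp v)] with ξ h1 h2
        simp only [wconv, Pi.add_apply]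
        rw [← mul_add, ← integral_add h1 h2]
        simp only [mul_add])
      (by
        intro r u v
        rw [← MemLp.toLp_const_smul, MemLp.toLp_eq_toLp_iff]
        rw [wconv_congr (Lp.coeFn_smul r u) (Filter.EventuallyEq.refl _ v)]
        refine Filter.Eventually.of_forall fun ξ => ?_
        simp only [wconv, Pi.smul_apply, Complex.real_smul]
        rw [mul_left_comm (r : ℂ), ← integral_const_mul (r : ℂ)]
        congr 2
        funext η
        ring)
      (by
        intro u v v'
        rw [← MemLp.toLp_add, MemLp.toLp_eq_toLp_iff]
        rw [wconv_congr (Filter.EventuallyEq.refl _ u) (Lp.coeFn_add v v')]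
        filter_upwards [hw.ae_integrable hc (Lp.memLp u) (Lp.memLp v),
          hw.ae_integrable hc (Lp.memLp u) (Lp.memLp v')] with ξ h1 h2
        simp only [wconv, Pi.add_apply]
        rw [← mul_add, ← integral_add h1 h2]
        simp only [mul_add, add_mul])
      (by
        intro r u v
        rw [← MemLp.toLp_const_smul, MemLp.toLp_eq_toLp_iff]
        rw [wconv_congr (Filter.EventuallyEq.refl _ u) (Lp.coeFn_smul r v)]
        refine Filter.Eventually.of_forall fun ξ => ?_
        simp only [wconv, Pi.smul_apply, Complex.real_smul]
        rw [mul_left_comm (r : ℂ), ← integral_const_mul (r : ℂ)]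
        congr 2
        funext η
        ring))
    (3 * C * (eLpNorm θ 2 volume).toReal) (by
      intro u v
      rw [LinearMap.mk₂_apply, Lp.norm_toLp, Lp.norm_def, Lp.norm_def]
      have h := hw.eLpNorm_wconv_le (Lp.aestronglyMeasurable u) (Lp.aestronglyMeasurable v)
      have := hw.memLp_θ.2.ne
      have := (Lp.memLp u).2.ne
      have := (Lp.memLp v).2.ne
      refine (ENNReal.toReal_mono (by finiteness) h).trans (le_of_eq ?_)
      simp [ENNReal.toReal_mul, ENNReal.toReal_ofReal hw.C_nonneg])

theorem wconvL_apply (hw : ConvWeights a b c θ C) (hc : ∀ x, 0 < c x)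
    (u v : Lp ℂ 2 (volume : Measure ℝ)) :
    wconvL hw hc u v =ᵐ[volume] wconv a b c u v :=
  MemLp.coeFn_toLp (hw.memLp_wconv (Lp.memLp u) (Lp.memLp v))

theorem norm_wconvL_le (hw : ConvWeights a b c θ C) (hc : ∀ x, 0 < c x) :
    ‖wconvL hw hc‖ ≤ 3 * C * (eLpNorm θ 2 volume).toReal :=
  LinearMap.mkContinuous₂_norm_le _ (by have := hw.C_nonneg; positivity) _

end WConv

end DNLSGreen

end

noncomputable section

namespace DNLSGreen

/-! ### The weights -/

section Weights

variable {k : ℝ}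

theorem symbol_base_pos (hk : 0 < k) (η : ℝ) : 0 < 4 * k ^ 4 + (2 * Real.pi * η) ^ 2 := by
  positivity

theorem symbol_pos (σ : ℝ) (hk : 0 < k) (η : ℝ) : 0 < symbol σ k η :=
  Real.rpow_pos_of_pos (symbol_base_pos hk η) _

theorem symbol_mul_symbol (σ σ' : ℝ) (hk : 0 < k) (η : ℝ) :
    symbol σ k η * symbol σ' k η = symbol (σ + σ') k η := by
  rw [symbol, symbol, symbol, ← Real.rpow_add (symbol_base_pos hk η), add_div]

theorem symbol_neg (σ : ℝ) (hk : 0 < k) (η : ℝ) : symbol (-σ) k η = (symbol σ k η)⁻¹ := by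
  rw [symbol, symbol, neg_div, Real.rpow_neg (symbol_base_pos hk η).le]

theorem symbol_eq_rpow (σ : ℝ) (hk : 0 < k) (η : ℝ) : symbol σ k η = symbol 1 k η ^ σ := by
  rw [symbol, symbol, ← Real.rpow_mul (symbol_base_pos hk η).le]
  congr 1
  ring

theorem sq_symbol_one (hk : 0 < k) (η : ℝ) :
    symbol 1 k η ^ 2 = 4 * k ^ 4 + (2 * Real.pi * η) ^ 2 := by
  rw [symbol, ← Real.rpow_natCast, ← Real.rpow_mul (symbol_base_pos hk η).le]
  norm_num

theorem continuous_symbol (σ : ℝ) (hk : 0 < k) : Continuous (symbol σ k) := by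
  unfold symbol
  exact Continuous.rpow_const (by fun_prop) fun η => Or.inl (symbol_base_pos hk η).ne'

theorem symbol_even (σ : ℝ) (η : ℝ) : symbol σ k (-η) = symbol σ k η := by
  simp [symbol]

theorem symbol_scale (σ : ℝ) (hk : 0 < k) (η : ℝ) :
    symbol σ k η = k ^ (2 * σ) * symbol σ 1 (η / k ^ 2) := by
  have h : 4 * k ^ 4 + (2 * Real.pi * η) ^ 2 =
      k ^ 4 * (4 * 1 ^ 4 + (2 * Real.pi * (η / k ^ 2)) ^ 2) := by field_simp
  rw [symbol, h, Real.mul_rpow (by positivity) (by positivity), symbol, ← Real.rpow_natCast,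
    ← Real.rpow_mul hk.le]
  congr 2
  push_cast
  ring

/-- The value `symbol 1 k ξ` is the Euclidean length of `(2k², 2πξ)`, so after squaring only the
Cauchy-Schwarz bound on the product of the two frequencies is needed. -/
theorem symbol_one_add_le (hk : 0 < k) (ξ η : ℝ) :
    symbol 1 k (ξ + η) ≤ symbol 1 k ξ + symbol 1 k η := by
  have h1 := symbol_pos 1 hk ξ
  have h2 := symbol_pos 1 hk η
  refine le_of_abs_le (abs_le_of_sq_le_sq ?_ (by positivity))
  have e1 := sq_symbol_one hk ξ
  have e2 := sq_symbol_one hk η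
  have e3 : (2 * Real.pi * ξ) * (2 * Real.pi * η) ≤ symbol 1 k ξ * symbol 1 k η := by
    refine le_of_abs_le (abs_le_of_sq_le_sq ?_ (by positivity))
    rw [mul_pow, mul_pow (symbol 1 k ξ), e1, e2]
    have : 0 ≤ k ^ 4 := by positivity
    nlinarith [sq_nonneg (2 * Real.pi * ξ), sq_nonneg (2 * Real.pi * η),
      mul_nonneg this (sq_nonneg (2 * Real.pi * ξ)), mul_nonneg this (sq_nonneg (2 * Real.pi * η)),
      mul_nonneg this this]
  rw [sq_symbol_one hk]
  have : 0 ≤ k ^ 4 := by positivity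
  nlinarith

theorem symbol_one_le_two_mul (hk : 0 < k) {ξ η : ℝ} (h : symbol 1 k η ≤ symbol 1 k (ξ - η)) :
    symbol 1 k ξ ≤ 2 * symbol 1 k (ξ - η) := by
  have := symbol_one_add_le hk (ξ - η) η
  rw [sub_add_cancel] at this
  linarith

/-- The restriction `a ≤ 1` keeps the loss `2 ^ a` below `2`. It is applied with `a = s + 1/2` and
`a = 1/2 - s`. -/
theorem symbol_neg_le_two_mul (hk : 0 < k) {a : ℝ} (ha : 0 ≤ a) (ha' : a ≤ 1) {ξ η : ℝ}
    (h : symbol 1 k ξ ≤ 2 * symbol 1 k η) : symbol (-a) k η ≤ 2 * symbol (-a) k ξ := by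
  have h1 := symbol_pos 1 hk ξ
  have h2 := symbol_pos 1 hk η
  have h3 : symbol a k ξ ≤ 2 * symbol a k η := by
    rw [symbol_eq_rpow a hk, symbol_eq_rpow a hk η]
    calc symbol 1 k ξ ^ a ≤ (2 * symbol 1 k η) ^ a := Real.rpow_le_rpow h1.le h ha
      _ = 2 ^ a * symbol 1 k η ^ a := Real.mul_rpow (by norm_num) h2.le
      _ ≤ 2 ^ (1 : ℝ) * symbol 1 k η ^ a := by
        gcongr
        norm_num
      _ = _ := by norm_num
  rw [symbol_neg a hk, symbol_neg a hk]
  have h4 := symbol_pos a hk ξ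
  have h5 := symbol_pos a hk η
  rw [inv_le_iff_one_le_mul₀ h5]
  rw [mul_assoc, mul_comm, mul_assoc, inv_mul_eq_div, le_div_iff₀ h4]
  linarith

theorem symbol_neg_antitone (hk : 0 < k) {a : ℝ} (ha : 0 ≤ a) {ξ η : ℝ}
    (h : symbol 1 k ξ ≤ symbol 1 k η) : symbol (-a) k η ≤ symbol (-a) k ξ := by
  rw [symbol_eq_rpow _ hk, symbol_eq_rpow _ hk ξ]
  exact Real.rpow_le_rpow_of_nonpos (symbol_pos 1 hk ξ) h (by linarith)

/-- The weight of `H^(s - 1/2)`. -/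
def tauW (s k η : ℝ) : ℝ := k ^ (1 - 2 * s) * symbol (s - 1 / 2) k η

/-- The reciprocal of the weight of `H^(s + 1/2)`. -/
def thetaW (s k η : ℝ) : ℝ := k ^ (2 * s) * symbol (-(s + 1 / 2)) k η

variable {s : ℝ}

theorem tauW_pos (hk : 0 < k) (η : ℝ) : 0 < tauW s k η :=
  mul_pos (Real.rpow_pos_of_pos hk _) (symbol_pos _ hk _)

theorem thetaW_pos (hk : 0 < k) (η : ℝ) : 0 < thetaW s k η :=
  mul_pos (Real.rpow_pos_of_pos hk _) (symbol_pos _ hk _)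

theorem continuous_tauW (hk : 0 < k) : Continuous (tauW s k) :=
  continuous_const.mul (continuous_symbol _ hk)

theorem continuous_thetaW (hk : 0 < k) : Continuous (thetaW s k) :=
  continuous_const.mul (continuous_symbol _ hk)

/-- This product is the reciprocal of the size of the symbol of `(∂ + 2μ)/k` when `|μ| = k²`, which
is why the resolvents become isometries in these weights. -/
theorem tauW_mul_thetaW (hk : 0 < k) (η : ℝ) :
    tauW s k η * thetaW s k η = k * (symbol 1 k η)⁻¹ := by
  rw [tauW, thetaW, mul_mul_mul_comm, symbol_mul_symbol _ _ hk, ← Real.rpow_add hk,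
    ← symbol_neg _ hk]
  rw [show s - 1 / 2 + -(s + 1 / 2) = -1 by ring, show 1 - 2 * s + 2 * s = 1 by ring,
    Real.rpow_one]

/-- The symbol has its maximum at frequency zero, since the exponent is negative, and the power of
`k` in `tauW` compensates its size there. Smallness in `L²` therefore implies smallness of the
representative `u`, uniformly in `k`. -/
theorem tauW_le_one (hs' : s < 1 / 2) (hk : 0 < k) (η : ℝ) : tauW s k η ≤ 1 := by
  have h1 : symbol (s - 1 / 2) k η ≤ k ^ (-(1 - 2 * s)) := by
    have : (k ^ (4 : ℝ)) ^ ((s - 1 / 2) / 2) = k ^ (-(1 - 2 * s)) := by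
      rw [← Real.rpow_mul hk.le]; congr 1; ring
    rw [symbol, ← this]
    apply Real.rpow_le_rpow_of_nonpos (by positivity) _ (by linarith)
    have : k ^ (4 : ℝ) = k ^ 4 := by exact_mod_cast Real.rpow_natCast k 4
    rw [this]
    nlinarith [sq_nonneg (2 * Real.pi * η), pow_pos hk 4]
  calc tauW s k η ≤ k ^ (1 - 2 * s) * k ^ (-(1 - 2 * s)) := by
        unfold tauW
        gcongr
    _ = 1 := by rw [← Real.rpow_add hk]; simp

theorem thetaW_scale (hk : 0 < k) (η : ℝ) :
    thetaW s k η = k⁻¹ * thetaW s 1 (η / k ^ 2) := by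
  rw [thetaW, thetaW, symbol_scale _ hk, Real.one_rpow, one_mul, ← mul_assoc, ← Real.rpow_add hk]
  congr 1
  rw [← Real.rpow_neg_one]
  congr 1
  ring

/-- The square decays like `|η|^(-(1 + 2s))`, which is integrable exactly because `s > 0`. -/
theorem memLp_thetaW_one (hs : 0 < s) : MemLp (thetaW s 1) 2 volume := by
  rw [memLp_two_iff_integrable_sq (continuous_thetaW one_pos).aestronglyMeasurable]
  have h := integrable_rpow_neg_one_add_norm_sq (E := ℝ) (μ := volume) (r := 1 + 2 * s)
    (by simp; linarith)
  refine h.mono' ((continuous_thetaW one_pos).pow 2).aestronglyMeasurable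
    (Filter.Eventually.of_forall fun η => ?_)
  rw [Real.norm_of_nonneg (by positivity), thetaW, Real.one_rpow, one_mul, symbol,
    ← Real.rpow_natCast, ← Real.rpow_mul (by positivity)]
  have : -(s + 1 / 2) / 2 * ((2 : ℕ) : ℝ) = -(1 + 2 * s) / 2 := by push_cast; ring
  rw [this]
  apply Real.rpow_le_rpow_of_nonpos (by positivity) _ (by linarith)
  rw [Real.norm_eq_abs, sq_abs]
  have : 1 ≤ (2 * Real.pi) ^ 2 := by nlinarith [Real.pi_gt_three]
  nlinarith [sq_nonneg η]

/-- In the scaling `η ↦ η / k²` the factor `k⁻²` from squaring `thetaW_scale` cancels the Jacobian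
`k²`. All bilinear bounds are thereby independent of `κ`. -/
theorem eLpNorm_thetaW (hk : 0 < k) : eLpNorm (thetaW s k) 2 volume =
    eLpNorm (thetaW s 1) 2 volume := by
  rw [← ENNReal.pow_right_strictMono (n := 2) (by norm_num) |>.injective.eq_iff]
  rw [eLpNorm_two_sq, eLpNorm_two_sq]
  simp only [thetaW_scale hk, enorm_mul, mul_pow]
  rw [lintegral_const_mul' _ _ (by finiteness)]
  have h : ∫⁻ η, ‖thetaW s 1 (η / k ^ 2)‖ₑ ^ 2 =
      ENNReal.ofReal |k ^ 2| * ∫⁻ η, ‖thetaW s 1 η‖ₑ ^ 2 := by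
    have h0 : (k ^ 2)⁻¹ ≠ 0 := by positivity
    have h1 := Real.map_volume_mul_right h0
    have h2 := lintegral_map (μ := volume) (f := fun η => ‖thetaW s 1 η‖ₑ ^ 2)
      (g := fun η : ℝ => η * (k ^ 2)⁻¹)
      ((continuous_thetaW one_pos).enorm.measurable.pow_const 2) (by fun_prop)
    rw [h1, lintegral_smul_measure, inv_inv] at h2
    simp only [div_eq_mul_inv]
    rw [← h2, smul_eq_mul]
  rw [h, ← mul_assoc]
  have : ‖k⁻¹‖ₑ ^ 2 * ENNReal.ofReal |k ^ 2| = 1 := by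
    rw [abs_of_pos (by positivity), Real.enorm_eq_ofReal (by positivity),
      ← ENNReal.ofReal_pow (by positivity), ← ENNReal.ofReal_mul (by positivity)]
    field_simp
    simp
  rw [this, one_mul]

theorem memLp_thetaW (hs : 0 < s) (hk : 0 < k) : MemLp (thetaW s k) 2 volume :=
  ⟨(continuous_thetaW hk).aestronglyMeasurable, by
    rw [eLpNorm_thetaW hk]; exact (memLp_thetaW_one hs).2⟩

theorem convWeights_algebra (hs : 0 < s) (hs' : s < 1 / 2) (hk : 0 < k) :
    ConvWeights (thetaW s k) (thetaW s k) (fun η => (thetaW s k η)⁻¹) (thetaW s k) 2 where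
  continuous_a := continuous_thetaW hk
  continuous_b := continuous_thetaW hk
  continuous_c := (continuous_thetaW hk).inv₀ fun η => (thetaW_pos hk η).ne'
  continuous_θ := continuous_thetaW hk
  a_nonneg η := (thetaW_pos hk η).le
  b_nonneg η := (thetaW_pos hk η).le
  c_nonneg η := (inv_pos.2 (thetaW_pos hk η)).le
  θ_nonneg η := (thetaW_pos hk η).le
  C_nonneg := by norm_num
  memLp_θ := memLp_thetaW hs hk
  bound ξ η := by
    have p1 := thetaW_pos (s := s) hk ξ
    have p2 := thetaW_pos (s := s) hk η
    have p3 := thetaW_pos (s := s) hk (ξ - η)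
    -- The larger of the two input frequencies has size at least half that of `ξ`, so its `θ` is
    -- absorbed by `θ(ξ)⁻¹`, and the other `θ` remains.
    have key : ∀ ζ, symbol 1 k ξ ≤ 2 * symbol 1 k ζ → thetaW s k ζ ≤ 2 * thetaW s k ξ := by
      intro ζ h
      have := symbol_neg_le_two_mul hk (a := s + 1 / 2) (by linarith) (by linarith) h
      unfold thetaW
      have := Real.rpow_pos_of_pos hk (2 * s)
      nlinarith
    rcases le_total (symbol 1 k η) (symbol 1 k (ξ - η)) with h | h
    · have h1 := key _ (symbol_one_le_two_mul hk h)
      calc (thetaW s k ξ)⁻¹ * thetaW s k (ξ - η) * thetaW s k η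
          ≤ (thetaW s k ξ)⁻¹ * (2 * thetaW s k ξ) * thetaW s k η := by gcongr
        _ = 2 * thetaW s k η := by field_simp
        _ ≤ _ := by linarith
    · have h1 := key η (by
        have := symbol_one_le_two_mul hk (ξ := ξ) (η := ξ - η) (by simpa using h)
        simpa using this)
      calc (thetaW s k ξ)⁻¹ * thetaW s k (ξ - η) * thetaW s k η
          ≤ (thetaW s k ξ)⁻¹ * thetaW s k (ξ - η) * (2 * thetaW s k ξ) := by gcongr
        _ = 2 * thetaW s k (ξ - η) := by field_simp
        _ ≤ _ := by linarith

theorem convWeights_module (hs : 0 < s) (hs' : s < 1 / 2) (hk : 0 < k) :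
    ConvWeights (fun η => (tauW s k η)⁻¹) (thetaW s k) (tauW s k) (thetaW s k) 2 where
  continuous_a := (continuous_tauW hk).inv₀ fun η => (tauW_pos hk η).ne'
  continuous_b := continuous_thetaW hk
  continuous_c := continuous_tauW hk
  continuous_θ := continuous_thetaW hk
  a_nonneg η := (inv_pos.2 (tauW_pos hk η)).le
  b_nonneg η := (thetaW_pos hk η).le
  c_nonneg η := (tauW_pos hk η).le
  θ_nonneg η := (thetaW_pos hk η).le
  C_nonneg := by norm_num
  memLp_θ := memLp_thetaW hs hk
  bound ξ η := by
    have p1 := thetaW_pos (s := s) hk ξ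
    have p2 := thetaW_pos (s := s) hk η
    have p3 := thetaW_pos (s := s) hk (ξ - η)
    have q1 := tauW_pos (s := s) hk ξ
    have q2 := tauW_pos (s := s) hk η
    have q3 := tauW_pos (s := s) hk (ξ - η)
    have key : ∀ ζ ζ', symbol 1 k ζ ≤ 2 * symbol 1 k ζ' → tauW s k ζ' ≤ 2 * tauW s k ζ := by
      intro ζ ζ' h
      have := symbol_neg_le_two_mul hk (a := 1 / 2 - s) (by linarith) (by linarith) h
      rw [show -(1 / 2 - s) = s - 1 / 2 by ring] at this
      unfold tauW
      have := Real.rpow_pos_of_pos hk (1 - 2 * s)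
      nlinarith
    have hadd : symbol 1 k (ξ - η) ≤ symbol 1 k ξ + symbol 1 k η := by
      have := symbol_one_add_le hk ξ (-η)
      rwa [symbol_even, ← sub_eq_add_neg] at this
    -- If `η` is not larger than `ξ`, then `ξ - η` has size at most twice that of `ξ`, the two `τ`
    -- cancel up to a factor `2`, and `θ(η)` remains. If `η` dominates, then `τ(ξ - η)⁻¹` is at most
    -- `2 τ(η)⁻¹`.
    rcases le_total (symbol 1 k η) (symbol 1 k ξ) with h | h
    · have h1 := key (ξ - η) ξ (by linarith)
      calc tauW s k ξ * (tauW s k (ξ - η))⁻¹ * thetaW s k η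
          ≤ (2 * tauW s k (ξ - η)) * (tauW s k (ξ - η))⁻¹ * thetaW s k η := by gcongr
        _ = 2 * thetaW s k η := by field_simp
        _ ≤ _ := by linarith
    · have h1 := key (ξ - η) η (by linarith)
      have h2 : (tauW s k (ξ - η))⁻¹ ≤ 2 * (tauW s k η)⁻¹ := by
        rw [inv_le_iff_one_le_mul₀ q3, mul_assoc, mul_comm, mul_assoc, inv_mul_eq_div,
          le_div_iff₀ q2]
        linarith
      -- The quotient `θ/τ` is a constant times the symbol of order `-2s`, hence decreasing in the
      -- size of the frequency because `s` is positive.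
      have h3 : (tauW s k η)⁻¹ * thetaW s k η ≤ (tauW s k ξ)⁻¹ * thetaW s k ξ := by
        have e : ∀ ζ, (tauW s k ζ)⁻¹ * thetaW s k ζ =
            (k ^ (1 - 2 * s))⁻¹ * k ^ (2 * s) * symbol (-(2 * s)) k ζ := by
          intro ζ
          rw [tauW, thetaW, mul_inv, ← symbol_neg _ hk, mul_mul_mul_comm,
            symbol_mul_symbol _ _ hk]
          congr 2
          ring
        rw [e, e]
        have := symbol_neg_antitone hk (a := 2 * s) (by linarith) h
        gcongr
      calc tauW s k ξ * (tauW s k (ξ - η))⁻¹ * thetaW s k η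
          ≤ tauW s k ξ * (2 * (tauW s k η)⁻¹) * thetaW s k η := by gcongr
        _ = 2 * tauW s k ξ * ((tauW s k η)⁻¹ * thetaW s k η) := by ring
        _ ≤ 2 * tauW s k ξ * ((tauW s k ξ)⁻¹ * thetaW s k ξ) := by gcongr
        _ = 2 * thetaW s k ξ := by field_simp
        _ ≤ _ := by linarith

end Weights

/-! ### Multiplication operators on `L²` -/

section Multipliers

theorem memLp_mul_bounded {m : ℝ → ℂ} {C : ℝ} (hm : Continuous m) (hC : ∀ x, ‖m x‖ ≤ C)
    {u : ℝ → ℂ} (hu : MemLp u 2) : MemLp (fun x => m x * u x) 2 volume :=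
  MemLp.of_le_mul hu (hm.aestronglyMeasurable.mul hu.1)
    (Filter.Eventually.of_forall fun x => by
      rw [norm_mul]; exact mul_le_mul_of_nonneg_right (hC x) (norm_nonneg _))

/-- Multiplication by a bounded continuous function on `L²`. -/
def mulOp (m : ℝ → ℂ) (C : ℝ) (hm : Continuous m) (hC : ∀ x, ‖m x‖ ≤ C) :
    Lp ℂ 2 (volume : Measure ℝ) →L[ℝ] Lp ℂ 2 (volume : Measure ℝ) :=
  LinearMap.mkContinuous
    { toFun := fun u => (memLp_mul_bounded hm hC (Lp.memLp u)).toLp _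
      map_add' := by
        intro u v
        rw [← MemLp.toLp_add, MemLp.toLp_eq_toLp_iff]
        filter_upwards [Lp.coeFn_add u v] with x hx
        rw [hx]
        simp [mul_add]
      map_smul' := by
        intro r u
        rw [RingHom.id_apply, ← MemLp.toLp_const_smul, MemLp.toLp_eq_toLp_iff]
        filter_upwards [Lp.coeFn_smul r u] with x hx
        rw [hx]
        simp only [Pi.smul_apply, Complex.real_smul]
        ring }
    C (by
      intro u
      refine Lp.norm_le_mul_norm_of_ae_le_mul ?_
      filter_upwards [MemLp.coeFn_toLp (memLp_mul_bounded hm hC (Lp.memLp u))] with x hx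
      simp only [LinearMap.coe_mk, AddHom.coe_mk]
      rw [hx, norm_mul]
      exact mul_le_mul_of_nonneg_right (hC x) (norm_nonneg _))

theorem mulOp_apply (m : ℝ → ℂ) (C : ℝ) (hm : Continuous m) (hC : ∀ x, ‖m x‖ ≤ C)
    (u : Lp ℂ 2 (volume : Measure ℝ)) : mulOp m C hm hC u =ᵐ[volume] fun x => m x * u x :=
  MemLp.coeFn_toLp (memLp_mul_bounded hm hC (Lp.memLp u))

theorem mulOp_mulOp_eq {m m' : ℝ → ℂ} {C C' : ℝ} {hm : Continuous m} {hC : ∀ x, ‖m x‖ ≤ C}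
    {hm' : Continuous m'} {hC' : ∀ x, ‖m' x‖ ≤ C'} (h : ∀ x, m x * m' x = 1)
    (u : Lp ℂ 2 (volume : Measure ℝ)) : mulOp m C hm hC (mulOp m' C' hm' hC' u) = u := by
  apply Lp.ext
  filter_upwards [mulOp_apply m C hm hC (mulOp m' C' hm' hC' u), mulOp_apply m' C' hm' hC' u]
    with x h1 h2
  rw [h1, h2, ← mul_assoc, h, one_mul]

/-- Multiplication by a continuous function bounded from above and below. -/
def mulEquiv (m m' : ℝ → ℂ) (C C' : ℝ) (hm : Continuous m) (hC : ∀ x, ‖m x‖ ≤ C)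
    (hm' : Continuous m') (hC' : ∀ x, ‖m' x‖ ≤ C') (h : ∀ x, m x * m' x = 1) :
    Lp ℂ 2 (volume : Measure ℝ) ≃L[ℝ] Lp ℂ 2 (volume : Measure ℝ) :=
  ContinuousLinearEquiv.equivOfInverse (mulOp m C hm hC) (mulOp m' C' hm' hC')
    (mulOp_mulOp_eq fun x => by rw [mul_comm]; exact h x) (mulOp_mulOp_eq h)

theorem mulEquiv_apply (m m' : ℝ → ℂ) (C C' : ℝ) (hm : Continuous m) (hC : ∀ x, ‖m x‖ ≤ C)
    (hm' : Continuous m') (hC' : ∀ x, ‖m' x‖ ≤ C') (h : ∀ x, m x * m' x = 1)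
    (u : Lp ℂ 2 (volume : Measure ℝ)) :
    mulEquiv m m' C C' hm hC hm' hC' h u =ᵐ[volume] fun x => m x * u x :=
  mulOp_apply m C hm hC u

/-- Multiplication by a unimodular continuous function. -/
def unimodularMul (m : ℝ → ℂ) (hm : Continuous m) (h : ∀ x, ‖m x‖ = 1) :
    Lp ℂ 2 (volume : Measure ℝ) ≃ₗᵢ[ℝ] Lp ℂ 2 (volume : Measure ℝ) where
  toLinearEquiv := (mulEquiv m (fun x => (m x)⁻¹) 1 1 hm (fun x => (h x).le)
    (hm.inv₀ fun x => by rw [← norm_ne_zero_iff, h]; norm_num) (fun x => by simp [h])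
    (fun x => mul_inv_cancel₀ (by rw [← norm_ne_zero_iff, h]; norm_num))).toLinearEquiv
  norm_map' u := by
    change ‖mulOp m 1 hm (fun x => (h x).le) u‖ = ‖u‖
    rw [Lp.norm_def, Lp.norm_def]
    congr 1
    apply eLpNorm_congr_norm_ae
    filter_upwards [mulOp_apply m 1 hm (fun x => (h x).le) u] with x hx
    rw [hx, norm_mul, h, one_mul]

theorem unimodularMul_apply (m : ℝ → ℂ) (hm : Continuous m) (h : ∀ x, ‖m x‖ = 1)
    (u : Lp ℂ 2 (volume : Measure ℝ)) : unimodularMul m hm h u =ᵐ[volume] fun x => m x * u x :=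
  mulOp_apply m 1 hm (fun x => (h x).le) u

theorem memLp_reflect {u : ℝ → ℂ} (hu : MemLp u 2) :
    MemLp (fun x => -(starRingEnd ℂ) (u (-x))) 2 volume := by
  have h1 : MemLp (fun x => u (-x)) 2 volume :=
    hu.comp_measurePreserving (Measure.measurePreserving_neg volume)
  exact (h1.star).neg

/-- The action of `q ↦ -conj q` on the Fourier side. -/
def negConjReflect : Lp ℂ 2 (volume : Measure ℝ) ≃ₗᵢ[ℝ] Lp ℂ 2 (volume : Measure ℝ) :=
  have happ : ∀ u : Lp ℂ 2 (volume : Measure ℝ), (memLp_reflect (Lp.memLp u)).toLp _ =ᵐ[volume]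
      fun x => -(starRingEnd ℂ) (u (-x)) := fun u => MemLp.coeFn_toLp _
  have hneg := (Measure.measurePreserving_neg (volume : Measure ℝ)).quasiMeasurePreserving
  have hinv : ∀ u : Lp ℂ 2 (volume : Measure ℝ), (memLp_reflect (Lp.memLp
      ((memLp_reflect (Lp.memLp u)).toLp _))).toLp _ = u := by
    intro u
    apply Lp.ext
    filter_upwards [happ ((memLp_reflect (Lp.memLp u)).toLp _), hneg.ae (happ u)] with x h1 h2
    rw [h1, h2]
    simp
  { toFun := fun u => (memLp_reflect (Lp.memLp u)).toLp _
    invFun := fun u => (memLp_reflect (Lp.memLp u)).toLp _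
    left_inv := hinv
    right_inv := hinv
    map_add' := by
      intro u v
      rw [← MemLp.toLp_add, MemLp.toLp_eq_toLp_iff]
      filter_upwards [hneg.ae (Lp.coeFn_add u v)] with x hx
      rw [hx]
      simp [add_comm]
    map_smul' := by
      intro r u
      rw [RingHom.id_apply, ← MemLp.toLp_const_smul, MemLp.toLp_eq_toLp_iff]
      filter_upwards [hneg.ae (Lp.coeFn_smul r u)] with x hx
      rw [hx]
      simp
    norm_map' := by
      intro u
      simp only [LinearEquiv.coe_mk, LinearMap.coe_mk, AddHom.coe_mk]
      rw [Lp.norm_toLp, Lp.norm_def]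
      congr 1
      have e : eLpNorm (fun x => -(starRingEnd ℂ) (u (-x))) 2 volume =
          eLpNorm (fun x => u (-x)) 2 volume := by
        apply eLpNorm_congr_norm_ae
        filter_upwards with x
        simp
      rw [e]
      exact eLpNorm_comp_measurePreserving (Lp.aestronglyMeasurable u)
        (Measure.measurePreserving_neg volume) }

theorem negConjReflect_apply (u : Lp ℂ 2 (volume : Measure ℝ)) :
    negConjReflect u =ᵐ[volume] fun x => -(starRingEnd ℂ) (u (-x)) :=
  MemLp.coeFn_toLp (memLp_reflect (Lp.memLp u))

end Multipliers

end DNLSGreen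

end

noncomputable section

namespace DNLSGreen

/-! ### Sobolev norms on the Fourier side -/

section FourierSide

open FourierTransform

/-- Compactly supported smooth functions are Schwartz, and pairing with them already determines a
locally integrable function. -/
theorem toTemperedDistribution_smulLeft_eq_iff {g : ℝ → ℂ} (hg : g.HasTemperateGrowth)
    (f u : Lp ℂ 2 (volume : Measure ℝ)) :
    TemperedDistribution.smulLeftCLM ℂ g (Lp.toTemperedDistribution f) =
      Lp.toTemperedDistribution u ↔ u =ᵐ[volume] fun x => g x * f x := by
  have hcont : Continuous g := hg.1.continuous
  have happ : ∀ φ : 𝓢(ℝ, ℂ), TemperedDistribution.smulLeftCLM ℂ g (Lp.toTemperedDistribution f) φ =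
      ∫ x, φ x * (g x * f x) := by
    intro φ
    rw [TemperedDistribution.smulLeftCLM_apply_apply, Lp.toTemperedDistribution_apply]
    congr 1
    funext x
    rw [SchwartzMap.smulLeftCLM_apply_apply hg]
    simp only [smul_eq_mul]
    ring
  constructor
  · intro h
    apply ae_eq_of_integral_contDiff_smul_eq
    · exact (Lp.memLp u).locallyIntegrable (by norm_num)
    · have := ((Lp.memLp f).locallyIntegrable (by norm_num)).locallyIntegrableOn Set.univ
      rw [← locallyIntegrableOn_univ]
      exact this.continuousOn_mul hcont.continuousOn isOpen_univ.isLocallyClosed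
    · intro φ hφ hφc
      have hg₁ : HasCompactSupport (Complex.ofRealCLM ∘ φ) := hφc.comp_left rfl
      have hg₂ : ContDiff ℝ ∞ (Complex.ofRealCLM ∘ φ) := by fun_prop
      have h1 := happ (hg₁.toSchwartzMap hg₂)
      rw [h, Lp.toTemperedDistribution_apply] at h1
      simpa using h1
  · intro h
    ext φ
    rw [happ, Lp.toTemperedDistribution_apply]
    apply integral_congr_ae
    filter_upwards [h] with x hx
    rw [hx, smul_eq_mul]

/-- This turns statements about tempered distributions into pointwise identities between Plancherel
transforms. -/
theorem potential_eq_iff (σ : ℝ) {k : ℝ} (hk : k ≠ 0) (f u : Lp ℂ 2 (volume : Measure ℝ)) :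
    potential σ k (Lp.toTemperedDistribution f) = Lp.toTemperedDistribution u ↔
      (𝓕 u : Lp ℂ 2 (volume : Measure ℝ)) =ᵐ[volume]
        fun η => (symbol σ k η : ℂ) * (𝓕 f : Lp ℂ 2 (volume : Measure ℝ)) η := by
  rw [← toTemperedDistribution_smulLeft_eq_iff (symbol_hasTemperateGrowth σ k hk),
    ← Lp.fourier_toTemperedDistribution_eq, ← Lp.fourier_toTemperedDistribution_eq, potential,
    TemperedDistribution.fourierMultiplierCLM_apply]
  constructor
  · intro h
    rw [← h, fourier_fourierInv_eq]
  · intro h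
    rw [h, fourierInv_fourier_eq]

/-- The infimum runs over a single element, namely the inverse Fourier transform of `w`. -/
theorem sobNorm_eq (σ : ℝ) {k : ℝ} (hk : k ≠ 0) {f w : Lp ℂ 2 (volume : Measure ℝ)}
    (h : w =ᵐ[volume] fun η => (symbol σ k η : ℂ) * (𝓕 f : Lp ℂ 2 (volume : Measure ℝ)) η) :
    sobNorm σ k (Lp.toTemperedDistribution f) = ‖w‖ₑ := by
  have hn : ∀ u : Lp ℂ 2 (volume : Measure ℝ), ‖(𝓕 u : Lp ℂ 2 (volume : Measure ℝ))‖ₑ = ‖u‖ₑ := by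
    intro u
    rw [← ofReal_norm, Lp.norm_fourier_eq, ofReal_norm]
  apply le_antisymm
  · refine (iInf₂_le (𝓕⁻ w) ?_).trans (le_of_eq ?_)
    · rw [potential_eq_iff σ hk, fourier_fourierInv_eq]
      exact h
    · rw [← hn, fourier_fourierInv_eq]
  · refine le_iInf₂ fun u hu => ?_
    rw [potential_eq_iff σ hk] at hu
    rw [← hn u, Lp.ext (hu.trans h.symm)]

/-- For `s ≥ 0` the symbol at `k = 1` is at least `1`. The ball `B_δ` enters the argument only
through this `L²` bound. -/
theorem norm_le_of_mem_sobolevBall {s δ : ℝ} (hs : 0 ≤ s) (hδ : 0 ≤ δ)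
    {q : Lp ℂ 2 (volume : Measure ℝ)} (hq : q ∈ sobolevBall s δ) : ‖q‖ ≤ δ := by
  have h1 : ‖q‖ₑ ≤ sobNorm s 1 (Lp.toTemperedDistribution q) := by
    refine le_iInf₂ fun u hu => ?_
    rw [potential_eq_iff s one_ne_zero] at hu
    rw [← ofReal_norm, ← ofReal_norm]
    apply ENNReal.ofReal_le_ofReal
    rw [← Lp.norm_fourier_eq q, ← Lp.norm_fourier_eq u]
    apply Lp.norm_le_norm_of_ae_le
    filter_upwards [hu] with η hη
    rw [hη, norm_mul, Complex.norm_real, Real.norm_of_nonneg (symbol_pos s one_pos η).le]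
    apply le_mul_of_one_le_left (norm_nonneg _)
    apply Real.one_le_rpow _ (by linarith)
    nlinarith [sq_nonneg (2 * Real.pi * η)]
  have h2 := h1.trans hq
  rw [← ofReal_norm] at h2
  exact (ENNReal.ofReal_le_ofReal_iff hδ).1 h2

variable {σ : ℝ}

theorem Sobolev.toL2_surjective : Function.Surjective (Sobolev.toL2 (σ := σ)) := by
  intro v
  have h := potential_neg_potential (-σ) 1 one_ne_zero (Lp.toTemperedDistribution v)
  rw [neg_neg] at h
  let f : Sobolev σ := ⟨potential (-σ) 1 (Lp.toTemperedDistribution v), ⟨v, h.symm⟩⟩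
  refine ⟨f, toTemperedDistribution_injective ?_⟩
  exact (Sobolev.toTemperedDistribution_toL2 f).trans h

variable (σ) in
/-- `H^σ` is isometric to `L²`. -/
def sobolevEquivL2 : Sobolev σ ≃ₗᵢ[ℝ] Lp ℂ 2 (volume : Measure ℝ) where
  toLinearEquiv := (LinearEquiv.ofBijective Sobolev.toL2
    ⟨Sobolev.toL2_injective, Sobolev.toL2_surjective⟩).restrictScalars ℝ
  norm_map' _ := rfl

/-- The Fourier transform on `L²` as a real-linear isometry. -/
def fourierReal : Lp ℂ 2 (volume : Measure ℝ) ≃ₗᵢ[ℝ] Lp ℂ 2 (volume : Measure ℝ) where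
  toLinearEquiv := (Lp.fourierTransformₗᵢ ℝ ℂ).toLinearEquiv.restrictScalars ℝ
  norm_map' := (Lp.fourierTransformₗᵢ ℝ ℂ).norm_map

/-- The ratio of the two bases lies between `1` and `k⁴`. The constants depend on `k`, which is
harmless: they only serve to carry analyticity over to the norm of `H^σ_1`. -/
theorem symbol_mul_symbol_one_le {k : ℝ} (hk : 1 ≤ k) (η : ℝ) :
    symbol σ k η * (symbol σ 1 η)⁻¹ ≤ (k ^ 4) ^ (|σ| / 2) ∧
    symbol σ 1 η * (symbol σ k η)⁻¹ ≤ (k ^ 4) ^ (|σ| / 2) := by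
  have hk0 : 0 < k := by linarith
  have hx := symbol_base_pos hk0 η
  have h1 := symbol_base_pos one_pos η
  have hk4 : 1 ≤ k ^ 4 := one_le_pow₀ hk
  have e : ∀ ρ, symbol ρ k η * (symbol ρ 1 η)⁻¹ =
      ((4 * k ^ 4 + (2 * Real.pi * η) ^ 2) / (4 * 1 ^ 4 + (2 * Real.pi * η) ^ 2)) ^ (ρ / 2) := by
    intro ρ
    rw [Real.div_rpow hx.le h1.le, div_eq_mul_inv]
    rfl
  set R := (4 * k ^ 4 + (2 * Real.pi * η) ^ 2) / (4 * 1 ^ 4 + (2 * Real.pi * η) ^ 2)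
  have hR1 : 1 ≤ R := by
    rw [one_le_div h1]
    nlinarith
  have hR2 : R ≤ k ^ 4 := by
    rw [div_le_iff₀ h1]
    nlinarith [sq_nonneg (2 * Real.pi * η)]
  have key : ∀ ρ, |ρ| = |σ| → R ^ (ρ / 2) ≤ (k ^ 4) ^ (|σ| / 2) := by
    intro ρ hρ
    calc R ^ (ρ / 2) ≤ R ^ (|σ| / 2) :=
          Real.rpow_le_rpow_of_exponent_le hR1 (by rw [← hρ]; linarith [le_abs_self ρ])
      _ ≤ _ := Real.rpow_le_rpow (by linarith) hR2 (by positivity)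
  refine ⟨(e σ).trans_le (key σ rfl), ?_⟩
  have h2 := e (-σ)
  rw [symbol_neg _ hk0, symbol_neg _ one_pos, inv_inv, mul_comm] at h2
  exact h2.trans_le (key (-σ) (abs_neg σ))

variable (σ) in
/-- The representation of `H^σ` on the Fourier side with the weight `d (4 k⁴ + ξ²) ^ (σ / 2)`. -/
def sobolevEquiv {k d : ℝ} (hk : 1 ≤ k) (hd : 0 < d) :
    Sobolev σ ≃L[ℝ] Lp ℂ 2 (volume : Measure ℝ) :=
  ((sobolevEquivL2 σ).trans fourierReal).toContinuousLinearEquiv.trans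
    (mulEquiv (fun η => ((d * (symbol σ k η * (symbol σ 1 η)⁻¹) : ℝ) : ℂ))
      (fun η => ((d⁻¹ * (symbol σ 1 η * (symbol σ k η)⁻¹) : ℝ) : ℂ))
      (d * (k ^ 4) ^ (|σ| / 2)) (d⁻¹ * (k ^ 4) ^ (|σ| / 2))
      (Complex.continuous_ofReal.comp (continuous_const.mul
        ((continuous_symbol σ (by linarith)).mul ((continuous_symbol σ one_pos).inv₀ fun η =>
          (symbol_pos σ one_pos η).ne'))))
      (fun η => by
        rw [Complex.norm_real, Real.norm_of_nonneg]
        · exact mul_le_mul_of_nonneg_left (symbol_mul_symbol_one_le hk η).1 hd.le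
        · have := symbol_pos σ (k := k) (by linarith) η
          have := symbol_pos σ one_pos η
          positivity)
      (Complex.continuous_ofReal.comp (continuous_const.mul
        ((continuous_symbol σ one_pos).mul ((continuous_symbol σ (by linarith)).inv₀ fun η =>
          (symbol_pos σ (by linarith) η).ne'))))
      (fun η => by
        rw [Complex.norm_real, Real.norm_of_nonneg]
        · exact mul_le_mul_of_nonneg_left (symbol_mul_symbol_one_le hk η).2 (inv_pos.2 hd).le
        · have := symbol_pos σ (k := k) (by linarith) η
          have := symbol_pos σ one_pos η
          positivity)
      (fun η => by
        have := symbol_pos σ (k := k) (by linarith) η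
        have := symbol_pos σ one_pos η
        rw [← Complex.ofReal_mul]
        norm_cast
        field_simp))

theorem sobolevEquiv_apply {k d : ℝ} (hk : 1 ≤ k) (hd : 0 < d) (p : Sobolev σ) :
    sobolevEquiv σ hk hd p =ᵐ[volume] fun η =>
      ((d * (symbol σ k η * (symbol σ 1 η)⁻¹) : ℝ) : ℂ) *
        (𝓕 (Sobolev.toL2 p) : Lp ℂ 2 (volume : Measure ℝ)) η := by
  rw [sobolevEquiv, ContinuousLinearEquiv.trans_apply]
  exact mulEquiv_apply _ _ _ _ _ _ _ _ _ _

theorem toDist_eq_of_sobolevEquiv {k d : ℝ} (hk : 1 ≤ k) (hd : 0 < d) {p : Sobolev σ}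
    {f : Lp ℂ 2 (volume : Measure ℝ)}
    (h : sobolevEquiv σ hk hd p =ᵐ[volume] fun η => ((d * symbol σ k η : ℝ) : ℂ) *
      (𝓕 f : Lp ℂ 2 (volume : Measure ℝ)) η) :
    Sobolev.toDist p = Lp.toTemperedDistribution f := by
  have h1 : potential σ 1 (Lp.toTemperedDistribution f) =
      Lp.toTemperedDistribution (Sobolev.toL2 p) := by
    rw [potential_eq_iff σ one_ne_zero]
    filter_upwards [h, sobolevEquiv_apply hk hd p] with η h2 h3
    have p1 := symbol_pos σ one_pos η
    have p2 := symbol_pos σ (k := k) (by linarith) η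
    rw [h2] at h3
    have h5 : ((d * symbol σ k η : ℝ) : ℂ) ≠ 0 := by
      norm_cast
      positivity
    apply mul_left_cancel₀ h5
    rw [mul_left_comm, h3, ← mul_assoc, ← Complex.ofReal_mul]
    congr 2
    field_simp
  rw [Sobolev.toTemperedDistribution_toL2] at h1
  have h2 := congrArg (potential (-σ) 1) h1
  rw [potential_neg_potential σ 1 one_ne_zero, potential_neg_potential σ 1 one_ne_zero] at h2
  exact h2.symm

/-- The inverse Fourier transforms on `L¹` and on `L²` agree. -/
theorem fourierInv_toLp_ae {g : ℝ → ℂ} (h1 : Integrable g) (h2 : MemLp g 2) :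
    (𝓕⁻ (h2.toLp g) : Lp ℂ 2 (volume : Measure ℝ)) =ᵐ[volume] 𝓕⁻ g := by
  have hcont : Continuous (𝓕⁻ g) := by
    rw [Real.fourierInv_eq_fourier_comp_neg]
    exact VectorFourier.fourierIntegral_continuous Real.continuous_fourierChar
      (by fun_prop) h1.comp_neg
  apply ae_eq_of_integral_contDiff_smul_eq
  · exact (Lp.memLp _).locallyIntegrable (by norm_num)
  · exact hcont.locallyIntegrable
  · intro φ hφ hφc
    have hg₁ : HasCompactSupport (Complex.ofRealCLM ∘ φ) := hφc.comp_left rfl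
    have hg₂ : ContDiff ℝ ∞ (Complex.ofRealCLM ∘ φ) := by fun_prop
    set ψ : 𝓢(ℝ, ℂ) := hg₁.toSchwartzMap hg₂
    have e1 : ∫ x, φ x • (𝓕⁻ (h2.toLp g) : Lp ℂ 2 (volume : Measure ℝ)) x =
        Lp.toTemperedDistribution (𝓕⁻ (h2.toLp g)) ψ := by
      rw [Lp.toTemperedDistribution_apply]
      simp [ψ]
    have e2 : ∫ x, φ x • 𝓕⁻ g x = ∫ x, ψ x • 𝓕⁻ g x := by
      simp [ψ]
    rw [e1, e2, ← Lp.fourierInv_toTemperedDistribution_eq, TemperedDistribution.fourierInv_apply,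
      Lp.toTemperedDistribution_apply]
    have e3 : ∫ x, (𝓕⁻ ψ) x • (h2.toLp g) x = ∫ x, (𝓕⁻ ψ) x • g x := by
      apply integral_congr_ae
      filter_upwards [h2.coeFn_toLp] with x hx
      rw [hx]
    rw [e3, SchwartzMap.fourierInv_coe]
    have := VectorFourier.integral_fourierIntegral_smul_eq_flip (μ := (volume : Measure ℝ))
      (ν := (volume : Measure ℝ)) (L := -innerₗ ℝ) (f := ψ) (g := g) Real.continuous_fourierChar
      (by
        simp only [LinearMap.neg_apply, innerₗ_apply_apply]
        fun_prop) ψ.integrable h1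
    rw [show (-innerₗ ℝ : ℝ →ₗ[ℝ] ℝ →ₗ[ℝ] ℝ).flip = -innerₗ ℝ by
      ext; simp] at this
    exact this

theorem memLp_fourierInv {g : ℝ → ℂ} (h1 : Integrable g) (h2 : MemLp g 2) :
    MemLp (𝓕⁻ g) 2 volume :=
  (memLp_congr_ae (fourierInv_toLp_ae h1 h2)).1 (Lp.memLp _)

theorem fourier_toLp_fourierInv {g : ℝ → ℂ} (h1 : Integrable g) (h2 : MemLp g 2)
    (h : MemLp (𝓕⁻ g) 2 volume) :
    (𝓕 (h.toLp (𝓕⁻ g)) : Lp ℂ 2 (volume : Measure ℝ)) = h2.toLp g := by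
  have : h.toLp (𝓕⁻ g) = 𝓕⁻ (h2.toLp g) := by
    apply Lp.ext
    exact h.coeFn_toLp.trans (fourierInv_toLp_ae h1 h2).symm
  rw [this, fourier_fourierInv_eq]

end FourierSide

end DNLSGreen

end

noncomputable section

namespace DNLSGreen

open FourierTransform

/-! ### Functions in `H^(s + 1/2)` -/

section Evaluation

variable {s k : ℝ}

theorem thetaW_le (hs : 0 < s) (hk : 0 < k) (η : ℝ) : thetaW s k η ≤ thetaW s k 0 := by
  unfold thetaW
  have h : symbol 1 k 0 ≤ symbol 1 k η := by
    unfold symbol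
    apply Real.rpow_le_rpow (by positivity) _ (by norm_num)
    nlinarith [sq_nonneg (2 * Real.pi * η)]
  have := symbol_neg_antitone hk (a := s + 1 / 2) (by linarith) h
  have := Real.rpow_pos_of_pos hk (2 * s)
  gcongr

theorem continuous_ofReal_thetaW (hk : 0 < k) : Continuous fun η => (thetaW s k η : ℂ) :=
  Complex.continuous_ofReal.comp (continuous_thetaW hk)

theorem memLp_ofReal_thetaW (hs : 0 < s) (hk : 0 < k) :
    MemLp (fun η => (thetaW s k η : ℂ)) 2 volume := (memLp_thetaW hs hk).ofReal

theorem memLp_thetaW_mul (hs : 0 < s) (hk : 0 < k) {v : ℝ → ℂ} (hv : MemLp v 2) :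
    MemLp (fun η => (thetaW s k η : ℂ) * v η) 2 volume :=
  memLp_mul_bounded (C := thetaW s k 0) (continuous_ofReal_thetaW hk) (fun η => by
    rw [Complex.norm_real, Real.norm_of_nonneg (thetaW_pos hk η).le]
    exact thetaW_le hs hk η) hv

theorem integrable_thetaW_mul (hs : 0 < s) (hk : 0 < k) {v : ℝ → ℂ} (hv : MemLp v 2) :
    Integrable fun η => (thetaW s k η : ℂ) * v η :=
  (memLp_ofReal_thetaW hs hk).integrable_mul hv

/-- The function on the line represented by `v`, with Fourier transform `θ v`. -/
def evalFn (s k : ℝ) (v : ℝ → ℂ) : ℝ → ℂ := 𝓕⁻ fun η => (thetaW s k η : ℂ) * v η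

theorem evalFn_congr {v v' : ℝ → ℂ} (h : v =ᵐ[volume] v') : evalFn s k v = evalFn s k v' := by
  funext x
  apply Real.fourierInv_congr_ae
  filter_upwards [h] with η hη
  rw [hη]

/-- The `L²` norm of `θ`. -/
def thetaNorm (s : ℝ) : ℝ := (eLpNorm (thetaW s 1) 2 volume).toReal

theorem thetaNorm_nonneg (s : ℝ) : 0 ≤ thetaNorm s := ENNReal.toReal_nonneg

/-- Cauchy-Schwarz gives the embedding of `H^(s+1/2)` into bounded functions, with a constant
independent of `k` by scaling. -/
theorem norm_evalFn_le (hs : 0 < s) (hk : 0 < k) (v : Lp ℂ 2 (volume : Measure ℝ)) (x : ℝ) :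
    ‖evalFn s k v x‖ ≤ thetaNorm s * ‖v‖ := by
  rw [evalFn, Real.fourierInv_eq_fourier_neg]
  refine (VectorFourier.norm_fourierIntegral_le_integral_norm _ _ _ _ _).trans ?_
  have hint := integrable_thetaW_mul hs hk (Lp.memLp v)
  rw [integral_norm_eq_lintegral_enorm hint.1, thetaNorm, Lp.norm_def, ← ENNReal.toReal_mul]
  have h1 := (memLp_thetaW_one hs).2.ne
  have h2 := (Lp.memLp v).2.ne
  refine ENNReal.toReal_mono (by finiteness) ?_
  rw [← ENNReal.pow_le_pow_left_iff (n := 2) (by norm_num), mul_pow, ← eLpNorm_thetaW hk,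
    eLpNorm_two_sq, eLpNorm_two_sq]
  refine le_trans (le_of_eq ?_) (sq_lintegral_mul_le
    (continuous_thetaW hk).enorm.measurable.aemeasurable (Lp.aestronglyMeasurable v).enorm)
  congr 1
  apply lintegral_congr
  intro η
  rw [enorm_mul, ← ofReal_norm, Complex.norm_real, ofReal_norm]

theorem fourierInv_add_fn {f g : ℝ → ℂ} (hf : Integrable f) (hg : Integrable g) :
    𝓕⁻ (fun η => f η + g η) = fun x => 𝓕⁻ f x + 𝓕⁻ g x := by
  funext x
  simp only [Real.fourierInv_eq_fourier_neg]
  exact congrFun (VectorFourier.fourierIntegral_add (L := innerₗ ℝ) Real.continuous_fourierChar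
    (by simp only [innerₗ_apply_apply]; fun_prop) hf hg) (-x)

theorem fourierInv_const_mul_fn (c : ℂ) (f : ℝ → ℂ) :
    𝓕⁻ (fun η => c * f η) = fun x => c * 𝓕⁻ f x := by
  funext x
  simp only [Real.fourierInv_eq_fourier_neg]
  exact congrFun (VectorFourier.fourierIntegral_const_smul _ _ _ f c) (-x)

/-- Evaluation at a point. -/
def evalCLM (hs : 0 < s) (hk : 0 < k) (x : ℝ) : Lp ℂ 2 (volume : Measure ℝ) →L[ℝ] ℂ :=
  LinearMap.mkContinuous
    { toFun := fun v => evalFn s k v x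
      map_add' := by
        intro u v
        rw [evalFn_congr (Lp.coeFn_add u v)]
        have := fourierInv_add_fn (integrable_thetaW_mul hs hk (Lp.memLp u))
          (integrable_thetaW_mul hs hk (Lp.memLp v))
        simp only [← mul_add] at this
        exact congrFun this x
      map_smul' := by
        intro r v
        rw [evalFn_congr (Lp.coeFn_smul r v)]
        have := fourierInv_const_mul_fn (r : ℂ) fun η => (thetaW s k η : ℂ) * v η
        simp only [mul_left_comm (r : ℂ)] at this
        simpa using! congrFun this x }
    (thetaNorm s) fun v => norm_evalFn_le hs hk v x

theorem evalCLM_apply (hs : 0 < s) (hk : 0 < k) (x : ℝ) (v : Lp ℂ 2 (volume : Measure ℝ)) :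
    evalCLM hs hk x v = evalFn s k v x := rfl

theorem continuous_fourierInv_fn {g : ℝ → ℂ} (h : Integrable g) : Continuous (𝓕⁻ g) := by
  rw [Real.fourierInv_eq_fourier_comp_neg]
  exact VectorFourier.fourierIntegral_continuous Real.continuous_fourierChar
    (by fun_prop) h.comp_neg

theorem continuous_evalFn (hs : 0 < s) (hk : 0 < k) (v : Lp ℂ 2 (volume : Measure ℝ)) :
    Continuous (evalFn s k v) :=
  continuous_fourierInv_fn (integrable_thetaW_mul hs hk (Lp.memLp v))

theorem memLp_evalFn (hs : 0 < s) (hk : 0 < k) (v : Lp ℂ 2 (volume : Measure ℝ)) :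
    MemLp (evalFn s k v) 2 volume :=
  memLp_fourierInv (integrable_thetaW_mul hs hk (Lp.memLp v)) (memLp_thetaW_mul hs hk (Lp.memLp v))

theorem fourier_toLp_evalFn (hs : 0 < s) (hk : 0 < k) (v : Lp ℂ 2 (volume : Measure ℝ))
    (h : MemLp (evalFn s k v) 2 volume) :
    (𝓕 (h.toLp (evalFn s k v)) : Lp ℂ 2 (volume : Measure ℝ)) =ᵐ[volume]
      fun η => (thetaW s k η : ℂ) * v η := by
  have := fourier_toLp_fourierInv (integrable_thetaW_mul hs hk (Lp.memLp v))
    (memLp_thetaW_mul hs hk (Lp.memLp v)) h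
  change (𝓕 (h.toLp (𝓕⁻ _)) : Lp ℂ 2 (volume : Measure ℝ)) =ᵐ[volume] _
  rw [this]
  exact MemLp.coeFn_toLp _

open scoped Convolution in
theorem fourierInv_convolution {f g : ℝ → ℂ} (hf : Integrable f) (hg : Integrable g) :
    𝓕⁻ (fun ξ => ∫ η, f η * g (ξ - η)) = fun x => 𝓕⁻ f x * 𝓕⁻ g x := by
  funext x
  simp only [Real.fourierInv_eq_fourier_neg]
  exact Real.fourier_mul_convolution_eq hf hg (-x)

theorem integrable_convolution_fn {f g : ℝ → ℂ} (hf : Integrable f) (hg : Integrable g) :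
    Integrable (fun ξ => ∫ η, f η * g (ξ - η)) :=
  hf.integrable_convolution (ContinuousLinearMap.mul ℂ ℂ) hg

/-- The product `H^(s + 1/2) × H^(s + 1/2) → H^(s + 1/2)` on the Fourier side. -/
def algMul (hs : 0 < s) (hs' : s < 1 / 2) (hk : 0 < k) :
    Lp ℂ 2 (volume : Measure ℝ) →L[ℝ] Lp ℂ 2 (volume : Measure ℝ) →L[ℝ]
      Lp ℂ 2 (volume : Measure ℝ) :=
  wconvL (convWeights_algebra hs hs' hk) fun η => inv_pos.2 (thetaW_pos hk η)

/-- The product `H^(s - 1/2) × H^(s + 1/2) → H^(s - 1/2)` on the Fourier side. -/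
def modMul (hs : 0 < s) (hs' : s < 1 / 2) (hk : 0 < k) :
    Lp ℂ 2 (volume : Measure ℝ) →L[ℝ] Lp ℂ 2 (volume : Measure ℝ) →L[ℝ]
      Lp ℂ 2 (volume : Measure ℝ) :=
  wconvL (convWeights_module hs hs' hk) fun η => tauW_pos hk η

theorem norm_algMul_le (hs : 0 < s) (hs' : s < 1 / 2) (hk : 0 < k) :
    ‖algMul hs hs' hk‖ ≤ 6 * thetaNorm s := by
  refine (norm_wconvL_le _ _).trans (le_of_eq ?_)
  rw [eLpNorm_thetaW hk, thetaNorm]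
  norm_num

theorem norm_modMul_le (hs : 0 < s) (hs' : s < 1 / 2) (hk : 0 < k) :
    ‖modMul hs hs' hk‖ ≤ 6 * thetaNorm s := by
  refine (norm_wconvL_le _ _).trans (le_of_eq ?_)
  rw [eLpNorm_thetaW hk, thetaNorm]
  norm_num

/-- The inner weights are `θ` and the outer weight is `θ⁻¹`, so `θ` times the weighted convolution
is the plain convolution of the two Fourier transforms. -/
theorem evalFn_algMul (hs : 0 < s) (hs' : s < 1 / 2) (hk : 0 < k)
    (u v : Lp ℂ 2 (volume : Measure ℝ)) (x : ℝ) :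
    evalFn s k (algMul hs hs' hk u v) x = evalFn s k u x * evalFn s k v x := by
  have h := wconvL_apply (convWeights_algebra hs hs' hk) (fun η => inv_pos.2 (thetaW_pos hk η)) u v
  rw [algMul, evalFn_congr h, evalFn]
  have e : (fun η => (thetaW s k η : ℂ) * wconv (thetaW s k) (thetaW s k)
      (fun η => (thetaW s k η)⁻¹) u v η) =
      fun ξ => ∫ η, ((thetaW s k η : ℂ) * v η) * ((thetaW s k (ξ - η) : ℂ) * u (ξ - η)) := by
    funext ξ
    have : (thetaW s k ξ : ℂ) ≠ 0 := by exact_mod_cast (thetaW_pos hk ξ).ne'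
    rw [wconv, Complex.ofReal_inv, mul_inv_cancel_left₀ this]
  rw [e, fourierInv_convolution (integrable_thetaW_mul hs hk (Lp.memLp v))
    (g := fun η => (thetaW s k η : ℂ) * u η) (integrable_thetaW_mul hs hk (Lp.memLp u)), mul_comm]
  rfl

/-- If `u` represents `q = 𝓕⁻ F` with `F` integrable, then `u + u · γ` represents `q (1 + γ)`. -/
theorem add_modMul_eq (hs : 0 < s) (hs' : s < 1 / 2) (hk : 0 < k)
    {u : Lp ℂ 2 (volume : Measure ℝ)} (γ : Lp ℂ 2 (volume : Measure ℝ)) {F : ℝ → ℂ}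
    (hF : Integrable F) (hu : u =ᵐ[volume] fun η => (tauW s k η : ℂ) * F η) :
    ∃ F' : ℝ → ℂ, Integrable F' ∧
      (u + modMul hs hs' hk u γ : Lp ℂ 2 (volume : Measure ℝ)) =ᵐ[volume]
        (fun η => (tauW s k η : ℂ) * F' η) ∧
      ∀ x, 𝓕⁻ F' x = 𝓕⁻ F x * (1 + evalFn s k γ x) := by
  have hγ := integrable_thetaW_mul hs hk (Lp.memLp γ)
  have hconv := integrable_convolution_fn hγ hF
  refine ⟨fun ξ => F ξ + ∫ η, ((thetaW s k η : ℂ) * γ η) * F (ξ - η), hF.add hconv, ?_, ?_⟩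
  · have h := wconvL_apply (convWeights_module hs hs' hk) (fun η => tauW_pos hk η) u γ
    rw [wconv_congr hu (Filter.EventuallyEq.refl _ _)] at h
    filter_upwards [Lp.coeFn_add u (modMul hs hs' hk u γ), hu, h] with ξ h1 h2 h3
    rw [h1, Pi.add_apply, h2, modMul, h3, wconv, mul_add]
    congr 2
    apply integral_congr_ae
    refine Filter.Eventually.of_forall fun η => ?_
    have : (tauW s k (ξ - η) : ℂ) ≠ 0 := by exact_mod_cast (tauW_pos hk _).ne'
    simp only [Complex.ofReal_inv]
    rw [inv_mul_cancel_left₀ this]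
  · intro x
    rw [fourierInv_add_fn hF hconv, fourierInv_convolution hγ hF]
    simp only [evalFn]
    ring

/-- The symbol of `c (∂ + 2 μ)⁻¹` with respect to the weights of `H^(s - 1/2)` and
`H^(s + 1/2)`. -/
def resSymbol (c : ℂ) (μ k η : ℝ) : ℂ :=
  c * symbol 1 k η / (k * (2 * Real.pi * η * Complex.I + 2 * μ))

/-- The hypothesis `|μ| = k²` turns `(2μ)²` into `4k⁴`, the constant in the Sobolev symbol. -/
theorem resSymbol_denom_norm {μ : ℝ} (hk : 0 < k) (hμ : |μ| = k ^ 2) (η : ℝ) :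
    ‖(2 * Real.pi * η * Complex.I + 2 * μ : ℂ)‖ = symbol 1 k η := by
  have h1 : μ ^ 2 = k ^ 4 := by rw [← sq_abs, hμ]; ring
  rw [← abs_of_pos (symbol_pos 1 hk η), ← sq_eq_sq₀ (norm_nonneg _) (abs_nonneg _), sq_abs,
    sq_symbol_one hk, ← Complex.normSq_eq_norm_sq, Complex.normSq_apply]
  simp
  nlinarith

theorem resSymbol_denom_ne {μ : ℝ} (hk : 0 < k) (hμ : |μ| = k ^ 2) (η : ℝ) :
    (2 * Real.pi * η * Complex.I + 2 * μ : ℂ) ≠ 0 := by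
  rw [← norm_ne_zero_iff, resSymbol_denom_norm hk hμ]
  exact (symbol_pos 1 hk η).ne'

theorem norm_resSymbol {c : ℂ} {μ : ℝ} (hk : 0 < k) (hc : ‖c‖ = k) (hμ : |μ| = k ^ 2) (η : ℝ) :
    ‖resSymbol c μ k η‖ = 1 := by
  have := symbol_pos 1 hk η
  rw [resSymbol, norm_div, norm_mul, norm_mul, resSymbol_denom_norm hk hμ, hc, Complex.norm_real,
    Complex.norm_real, Real.norm_of_nonneg this.le, Real.norm_of_nonneg hk.le]
  field_simp

theorem continuous_resSymbol {c : ℂ} {μ : ℝ} (hk : 0 < k) (hμ : |μ| = k ^ 2) :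
    Continuous (resSymbol c μ k) := by
  unfold resSymbol
  refine Continuous.div₀ ?_ (by fun_prop) fun η => ?_
  · exact continuous_const.mul (Complex.continuous_ofReal.comp (continuous_symbol 1 hk))
  · exact mul_ne_zero (by exact_mod_cast hk.ne') (resSymbol_denom_ne hk hμ η)

/-- The operator `c (∂ + 2 μ)⁻¹ : H^(s - 1/2) → H^(s + 1/2)` on the Fourier side. -/
def resOp {c : ℂ} {μ : ℝ} (hk : 0 < k) (hc : ‖c‖ = k) (hμ : |μ| = k ^ 2) :
    Lp ℂ 2 (volume : Measure ℝ) ≃ₗᵢ[ℝ] Lp ℂ 2 (volume : Measure ℝ) :=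
  unimodularMul (resSymbol c μ k) (continuous_resSymbol hk hμ) (norm_resSymbol hk hc hμ)

theorem hasDerivAt_fourierInv_fn {f : ℝ → ℂ} (hf : Integrable f)
    (hf' : Integrable fun η : ℝ => (η : ℂ) * f η) (x : ℝ) :
    HasDerivAt (𝓕⁻ f) (𝓕⁻ (fun η => (2 * Real.pi * η * Complex.I) * f η) x) x := by
  have h := Real.hasDerivAt_fourier hf (by simpa [Complex.real_smul] using hf') (-x)
  have h2 := h.scomp x (hasDerivAt_neg x)
  have e : 𝓕⁻ f = (𝓕 f) ∘ Neg.neg := by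
    funext y
    simp [Real.fourierInv_eq_fourier_neg]
  rw [e]
  refine h2.congr_deriv ?_
  have e2 : (fun η : ℝ => (2 * Real.pi * η * Complex.I) * f η) =
      fun η : ℝ => (-1 : ℂ) * ((-2 * Real.pi * Complex.I * η) • f η) := by
    funext η
    simp only [smul_eq_mul]
    ring
  rw [e2, fourierInv_const_mul_fn]
  simp only [Real.fourierInv_eq_fourier_neg]
  simp

/-- The Fourier transform of the function is `c F / (iξ + 2μ)`. It stays integrable after
multiplication by the frequency, because the denominator grows linearly, so the inversion integral
may be differentiated and the equation holds in the classical sense. -/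
theorem hasDerivAt_evalFn_resOp {c : ℂ} {μ : ℝ} (hk : 0 < k) (hc : ‖c‖ = k)
    (hμ : |μ| = k ^ 2) {w : Lp ℂ 2 (volume : Measure ℝ)} {F : ℝ → ℂ} (hF : Integrable F)
    (hw : w =ᵐ[volume] fun η => (tauW s k η : ℂ) * F η) (x : ℝ) :
    HasDerivAt (evalFn s k (resOp hk hc hμ w))
      (-2 * μ * evalFn s k (resOp hk hc hμ w) x + c * 𝓕⁻ F x) x := by
  set D : ℝ → ℂ := fun η => 2 * Real.pi * η * Complex.I + 2 * μ
  have hD : ∀ η, D η ≠ 0 := resSymbol_denom_ne hk hμ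
  have hDn : ∀ η, ‖D η‖ = symbol 1 k η := resSymbol_denom_norm hk hμ
  have hDc : Continuous D := by fun_prop
  set f : ℝ → ℂ := fun η => c * (D η)⁻¹ * F η with hf
  have hev : evalFn s k (resOp hk hc hμ w) = 𝓕⁻ f := by
    funext y
    apply Real.fourierInv_congr_ae
    filter_upwards [unimodularMul_apply (resSymbol c μ k) (continuous_resSymbol hk hμ)
      (norm_resSymbol hk hc hμ) w, hw] with η h1 h2
    rw [resOp, h1, h2]
    have h3 : (tauW s k η : ℂ) * (thetaW s k η : ℂ) = k * (symbol 1 k η : ℂ)⁻¹ := by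
      exact_mod_cast congrArg Complex.ofReal (tauW_mul_thetaW (s := s) hk η)
    have h4 : (symbol 1 k η : ℂ) ≠ 0 := by exact_mod_cast (symbol_pos 1 hk η).ne'
    have h5 : (k : ℂ) ≠ 0 := by exact_mod_cast hk.ne'
    have h6 := hD η
    calc (thetaW s k η : ℂ) * (resSymbol c μ k η * ((tauW s k η : ℂ) * F η))
        = ((tauW s k η : ℂ) * thetaW s k η) * resSymbol c μ k η * F η := by ring
      _ = f η := by
        rw [h3, resSymbol, hf]
        change _ * (_ / (_ * D η)) * _ = _
        field_simp
  have hbd1 : ∀ η, ‖c * (D η)⁻¹‖ ≤ k * (2 * k ^ 2)⁻¹ := by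
    intro η
    rw [norm_mul, hc, norm_inv, hDn]
    have h1 : 2 * k ^ 2 ≤ symbol 1 k η := by
      refine le_of_abs_le (abs_le_of_sq_le_sq ?_ (symbol_pos 1 hk η).le)
      rw [sq_symbol_one hk]
      nlinarith [sq_nonneg (2 * Real.pi * η)]
    gcongr
  have hbd2 : ∀ η : ℝ, ‖(η : ℂ) * (c * (D η)⁻¹)‖ ≤ k := by
    intro η
    have hp := symbol_pos 1 hk η
    rw [norm_mul, norm_mul, hc, norm_inv, hDn, Complex.norm_real]
    have h1 : ‖η‖ ≤ symbol 1 k η := by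
      rw [Real.norm_eq_abs]
      refine abs_le_of_sq_le_sq ?_ hp.le
      rw [sq_symbol_one hk]
      have : 1 ≤ (2 * Real.pi) ^ 2 := by nlinarith [Real.pi_gt_three]
      nlinarith [sq_nonneg η, pow_pos hk 4]
    calc ‖η‖ * (k * (symbol 1 k η)⁻¹) ≤ symbol 1 k η * (k * (symbol 1 k η)⁻¹) := by gcongr
      _ = k := by field_simp
  have hfi : Integrable f := by
    refine hF.bdd_mul (c := k * (2 * k ^ 2)⁻¹) ?_ (Filter.Eventually.of_forall hbd1)
    exact (continuous_const.mul (hDc.inv₀ hD)).aestronglyMeasurable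
  have hfi' : Integrable fun η : ℝ => (η : ℂ) * f η := by
    have : Integrable fun η : ℝ => ((η : ℂ) * (c * (D η)⁻¹)) * F η := by
      refine hF.bdd_mul (c := k) ?_ (Filter.Eventually.of_forall hbd2)
      exact (Complex.continuous_ofReal.mul
        (continuous_const.mul (hDc.inv₀ hD))).aestronglyMeasurable
    simpa [hf, mul_assoc] using this
  have hd := hasDerivAt_fourierInv_fn hfi hfi' x
  rw [hev]
  convert hd using 1
  -- Writing `iξ = (iξ + 2μ) - 2μ` separates the source `c F` from the damping term.
  have e : (fun η : ℝ => (2 * Real.pi * η * Complex.I) * f η) =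
      fun η => (-2 * μ : ℂ) * f η + c * F η := by
    funext η
    have h6 := hD η
    have h7 : 2 * Real.pi * η * Complex.I = D η - 2 * μ := by simp [D]
    rw [h7, hf]
    field_simp
    ring
  rw [e, fourierInv_add_fn (hfi.const_mul _) (hF.const_mul _), fourierInv_const_mul_fn,
    fourierInv_const_mul_fn]

theorem fourierInv_negConjReflect (F : ℝ → ℂ) (x : ℝ) :
    𝓕⁻ (fun η => -(starRingEnd ℂ) (F (-η))) x = -(starRingEnd ℂ) (𝓕⁻ F x) := by
  rw [Real.fourierInv_eq', Real.fourierInv_eq', ← integral_conj, ← integral_neg,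
    ← integral_neg_eq_self]
  congr 1
  funext η
  simp only [neg_neg, smul_eq_mul, map_mul, ← Complex.exp_conj, mul_neg]
  congr 3
  simp [map_ofNat]

theorem negConjReflect_eq {u : Lp ℂ 2 (volume : Measure ℝ)} {F : ℝ → ℂ}
    (hu : u =ᵐ[volume] fun η => (tauW s k η : ℂ) * F η) :
    negConjReflect u =ᵐ[volume] fun η => (tauW s k η : ℂ) * -(starRingEnd ℂ) (F (-η)) := by
  have hneg := (Measure.measurePreserving_neg (volume : Measure ℝ)).quasiMeasurePreserving
  filter_upwards [negConjReflect_apply u, hneg.ae hu] with η h1 h2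
  rw [h1, h2]
  simp [tauW, symbol_even]

end Evaluation

end DNLSGreen

end

noncomputable section

namespace DNLSGreen

open FourierTransform

/-! ### The solution of the system for `g₁₂`, `g₂₁` and `γ` -/

section Solution

/-- The bound for the bilinear operators. -/
def bilinBound (s : ℝ) : ℝ := 12 * thetaNorm s

theorem bilinBound_nonneg (s : ℝ) : 0 ≤ bilinBound s :=
  mul_nonneg (by norm_num) (thetaNorm_nonneg s)

/-- The radius of the ball on which the system is solved. -/
def solRadius (s : ℝ) : ℝ := 1 / (56 * (bilinBound s + 1))

theorem solRadius_pos (s : ℝ) : 0 < solRadius s := by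
  have := bilinBound_nonneg s
  unfold solRadius
  positivity

/-- A pair of functions with `γ` such that `g' = -2 λ g - κ q (1 + γ)`,
`h' = 2 λ h + κ r (1 + γ)` and `γ² + 2 γ + 4 g h = 0`, where `r = -conj q`. -/
structure IsDiagSolution (l : ℝ) (κ : ℂ) (q g h γ : ℝ → ℂ) : Prop where
  hasDerivAt_fst : ∀ x, HasDerivAt g (-2 * l * g x - κ * q x * (1 + γ x)) x
  hasDerivAt_snd : ∀ x, HasDerivAt h (2 * l * h x + κ * (-(starRingEnd ℂ) (q x)) * (1 + γ x)) x
  quadratic : ∀ x, γ x ^ 2 + 2 * γ x + 4 * (g x * h x) = 0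
  continuous : Continuous γ
  norm_le : ∀ x, ‖γ x‖ ≤ 2 / 3
  bounded : ∃ C, ∀ x, ‖g x‖ ≤ C ∧ ‖h x‖ ≤ C

variable {s : ℝ} (hs : 0 < s) (hs' : s < 1 / 2) {κ : ℂ} {k l : ℝ} (hk : 0 < k)
  (hκ : ‖κ‖ = k) (hl : |l| = k ^ 2)

/-- `q ↦ -κ (∂ + 2 λ)⁻¹ q`. -/
def fstOp : Lp ℂ 2 (volume : Measure ℝ) ≃ₗᵢ[ℝ] Lp ℂ 2 (volume : Measure ℝ) :=
  resOp (c := -κ) (μ := l) hk (by rw [norm_neg, hκ]) hl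

/-- `r ↦ κ (∂ - 2 λ)⁻¹ r`. -/
def sndOp : Lp ℂ 2 (volume : Measure ℝ) ≃ₗᵢ[ℝ] Lp ℂ 2 (volume : Measure ℝ) :=
  resOp (c := κ) (μ := -l) hk hκ (by rw [abs_neg, hl])

/-- `(q, γ) ↦ -κ (∂ + 2 λ)⁻¹ (q γ)`. -/
def fstBilin : Lp ℂ 2 (volume : Measure ℝ) →L[ℝ] Lp ℂ 2 (volume : Measure ℝ) →L[ℝ]
    Lp ℂ 2 (volume : Measure ℝ) :=
  (ContinuousLinearMap.compL ℝ _ _ _ (fstOp hk hκ hl : Lp ℂ 2 (volume : Measure ℝ) →L[ℝ] _)).comp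
    (modMul hs hs' hk)

/-- `(q, γ) ↦ κ (∂ - 2 λ)⁻¹ (r γ)`. -/
def sndBilin : Lp ℂ 2 (volume : Measure ℝ) →L[ℝ] Lp ℂ 2 (volume : Measure ℝ) →L[ℝ]
    Lp ℂ 2 (volume : Measure ℝ) :=
  (ContinuousLinearMap.compL ℝ _ _ _ (sndOp hk hκ hl : Lp ℂ 2 (volume : Measure ℝ) →L[ℝ] _)).comp
    ((modMul hs hs' hk).comp (negConjReflect : Lp ℂ 2 (volume : Measure ℝ) →L[ℝ] _))

theorem fstBilin_apply (u γ : Lp ℂ 2 (volume : Measure ℝ)) :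
    fstBilin hs hs' hk hκ hl u γ = fstOp hk hκ hl (modMul hs hs' hk u γ) := rfl

theorem sndBilin_apply (u γ : Lp ℂ 2 (volume : Measure ℝ)) :
    sndBilin hs hs' hk hκ hl u γ =
      sndOp hk hκ hl (modMul hs hs' hk (negConjReflect u) γ) := rfl

theorem norm_fstBilin_le : ‖fstBilin hs hs' hk hκ hl‖ ≤ bilinBound s := by
  have hT := thetaNorm_nonneg s
  refine ContinuousLinearMap.opNorm_le_bound₂ _ (bilinBound_nonneg s) fun u γ => ?_
  rw [fstBilin_apply, LinearIsometryEquiv.norm_map]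
  refine norm_bilin_le ((norm_modMul_le hs hs' hk).trans ?_) u γ
  unfold bilinBound
  linarith

theorem norm_sndBilin_le : ‖sndBilin hs hs' hk hκ hl‖ ≤ bilinBound s := by
  have hT := thetaNorm_nonneg s
  refine ContinuousLinearMap.opNorm_le_bound₂ _ (bilinBound_nonneg s) fun u γ => ?_
  rw [sndBilin_apply, LinearIsometryEquiv.norm_map]
  have hB : ‖modMul hs hs' hk‖ ≤ bilinBound s := by
    refine (norm_modMul_le hs hs' hk).trans ?_
    unfold bilinBound
    linarith
  exact (norm_bilin_le hB _ γ).trans (by rw [LinearIsometryEquiv.norm_map])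

theorem norm_linearIsometryEquiv_le_one
    (T : Lp ℂ 2 (volume : Measure ℝ) ≃ₗᵢ[ℝ] Lp ℂ 2 (volume : Measure ℝ)) :
    ‖(T : Lp ℂ 2 (volume : Measure ℝ) →L[ℝ] Lp ℂ 2 (volume : Measure ℝ))‖ ≤ 1 :=
  ContinuousLinearMap.opNorm_le_bound _ zero_le_one fun u => by simp

/-- The quadratic relation is used as the fixed-point equation `γ = -2gh - γ²/2`, with `g` and `h`
affine in `γ` for given `u`. Both coordinate maps share the same `γ`. -/
theorem exists_green_maps :
    ∃ γ : Lp ℂ 2 (volume : Measure ℝ) → Lp ℂ 2 (volume : Measure ℝ),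
      ContinuousOn γ (Metric.ball 0 (solRadius s)) ∧
      (∃ Φ : OpenPartialHomeomorph (Lp ℂ 2 (volume : Measure ℝ)) (Lp ℂ 2 (volume : Measure ℝ)),
        (∀ u, Φ u = fstOp hk hκ hl u + fstBilin hs hs' hk hκ hl u (γ u)) ∧
        Φ.source = Metric.ball 0 (solRadius s) ∧
        AnalyticOnNhd ℝ Φ Φ.source ∧ AnalyticOnNhd ℝ Φ.symm Φ.target) ∧
      (∃ Φ : OpenPartialHomeomorph (Lp ℂ 2 (volume : Measure ℝ)) (Lp ℂ 2 (volume : Measure ℝ)),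
        (∀ u, Φ u = sndOp hk hκ hl (negConjReflect u) + sndBilin hs hs' hk hκ hl u (γ u)) ∧
        Φ.source = Metric.ball 0 (solRadius s) ∧
        AnalyticOnNhd ℝ Φ Φ.source ∧ AnalyticOnNhd ℝ Φ.symm Φ.target) ∧
      ∀ u ∈ Metric.ball (0 : Lp ℂ 2 (volume : Measure ℝ)) (solRadius s),
        ‖γ u‖ ≤ 8 * bilinBound s * ‖u‖ ^ 2 ∧ (∀ x, ‖evalFn s k (γ u) x‖ ≤ 2 / 3) ∧
        ∀ x, evalFn s k (γ u) x ^ 2 + 2 * evalFn s k (γ u) x +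
          4 * (evalFn s k (fstOp hk hκ hl u + fstBilin hs hs' hk hκ hl u (γ u) :
              Lp ℂ 2 (volume : Measure ℝ)) x *
            evalFn s k (sndOp hk hκ hl (negConjReflect u) + sndBilin hs hs' hk hκ hl u (γ u) :
              Lp ℂ 2 (volume : Measure ℝ)) x) = 0 := by
  have hT := thetaNorm_nonneg s
  have hA := norm_algMul_le hs hs' hk
  obtain ⟨γ, hγa, hγL, hγ0, hγ⟩ := exists_solution_system (bilinBound_nonneg s)
    (S := (fstOp hk hκ hl : Lp ℂ 2 (volume : Measure ℝ) →L[ℝ] _))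
    (R := (negConjReflect.trans (sndOp hk hκ hl) : Lp ℂ 2 (volume : Measure ℝ) →L[ℝ] _))
    -- The factor `2` here is the reason why `bilinBound` is `12 * thetaNorm s`, twice the bound for
    -- `algMul`.
    (N := (-2 : ℝ) • algMul hs hs' hk) (N' := (-(1 / 2) : ℝ) • algMul hs hs' hk)
    (norm_linearIsometryEquiv_le_one _) (norm_linearIsometryEquiv_le_one _)
    (norm_fstBilin_le hs hs' hk hκ hl) (norm_sndBilin_le hs hs' hk hκ hl)
    (by
      refine (norm_smul_bilin_le _ _).trans ?_
      unfold bilinBound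
      norm_num
      linarith)
    (by
      refine (norm_smul_bilin_le _ _).trans ?_
      unfold bilinBound
      norm_num
      linarith)
  refine ⟨γ, hγa.continuousOn, ?_, ?_, ?_⟩
  · exact exists_analytic_openPartialHomeomorph_bilin (bilinBound_nonneg s) (fstOp hk hκ hl)
      (norm_fstBilin_le hs hs' hk hκ hl) hγa hγL hγ0
  · exact exists_analytic_openPartialHomeomorph_bilin (bilinBound_nonneg s)
      (negConjReflect.trans (sndOp hk hκ hl))
      (norm_sndBilin_le hs hs' hk hκ hl) hγa hγL hγ0
  · intro u hu
    obtain ⟨h1, h2⟩ := hγ u hu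
    refine ⟨h2, fun x => ?_, fun x => ?_⟩
    · refine (norm_evalFn_le hs hk (γ u) x).trans ?_
      have hu' : ‖u‖ ≤ solRadius s := (mem_ball_zero_iff.1 hu).le
      have hc := bilinBound_nonneg s
      have e1 : bilinBound s * solRadius s ≤ 1 := by
        rw [solRadius, mul_one_div, div_le_one (by positivity)]
        linarith
      have e2 : bilinBound s * ‖u‖ ≤ 1 := (mul_le_mul_of_nonneg_left hu' hc).trans e1
      -- The bound `2/3` comes from `8/12` and `bilinBound s * ‖u‖ ≤ 1`. It keeps both `1 + γ` and
      -- `1 + γ/2` away from zero.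
      have e3 : thetaNorm s = bilinBound s / 12 := by unfold bilinBound; ring
      have e4 : 0 ≤ bilinBound s * ‖u‖ := by positivity
      calc thetaNorm s * ‖γ u‖ ≤ thetaNorm s * (8 * bilinBound s * ‖u‖ ^ 2) := by gcongr
        _ = 2 / 3 * (bilinBound s * ‖u‖) ^ 2 := by rw [e3]; ring
        _ ≤ 2 / 3 := by nlinarith
    · have hm : ∀ a b : Lp ℂ 2 (volume : Measure ℝ), evalCLM hs hk x (algMul hs hs' hk a b) =
          evalCLM hs hk x a * evalCLM hs hk x b := fun a b => evalFn_algMul hs hs' hk a b x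
      have h4 := congrArg (evalCLM hs hk x) h1
      rw [map_add, smul_apply, smul_apply,
        smul_apply, smul_apply, map_smul, map_smul,
        hm, hm] at h4
      simp only [Complex.real_smul] at h4
      change evalCLM hs hk x (γ u) ^ 2 + 2 * evalCLM hs hk x (γ u) +
        4 * (evalCLM hs hk x _ * evalCLM hs hk x _) = 0
      change evalCLM hs hk x (γ u) = ((-2 : ℝ) : ℂ) * (evalCLM hs hk x
        (fstOp hk hκ hl u + fstBilin hs hs' hk hκ hl u (γ u)) * evalCLM hs hk x
        (sndOp hk hκ hl (negConjReflect u) + sndBilin hs hs' hk hκ hl u (γ u))) + _ at h4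
      push_cast at h4
      linear_combination 2 * h4

/-- By linearity `g` is the resolvent applied to the representative of `q(1 + γ)`. Integrability of
`F` makes that product a genuine function, so that the differential equations hold pointwise. -/
theorem isDiagSolution_evalFn {u γ : Lp ℂ 2 (volume : Measure ℝ)} {F : ℝ → ℂ}
    (hF : Integrable F) (hu : u =ᵐ[volume] fun η => (tauW s k η : ℂ) * F η)
    (hγ : ∀ x, ‖evalFn s k γ x‖ ≤ 2 / 3)
    (hq : ∀ x, evalFn s k γ x ^ 2 + 2 * evalFn s k γ x +
          4 * (evalFn s k (fstOp hk hκ hl u + fstBilin hs hs' hk hκ hl u γ :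
              Lp ℂ 2 (volume : Measure ℝ)) x *
            evalFn s k (sndOp hk hκ hl (negConjReflect u) + sndBilin hs hs' hk hκ hl u γ :
              Lp ℂ 2 (volume : Measure ℝ)) x) = 0) :
    IsDiagSolution l κ (𝓕⁻ F)
      (evalFn s k (fstOp hk hκ hl u + fstBilin hs hs' hk hκ hl u γ :
        Lp ℂ 2 (volume : Measure ℝ)))
      (evalFn s k (sndOp hk hκ hl (negConjReflect u) + sndBilin hs hs' hk hκ hl u γ :
        Lp ℂ 2 (volume : Measure ℝ)))
      (evalFn s k γ) where
  hasDerivAt_fst x := by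
    obtain ⟨F', h1, h2, h3⟩ := add_modMul_eq hs hs' hk γ hF hu
    rw [fstBilin_apply, ← map_add]
    have h := hasDerivAt_evalFn_resOp (c := -κ) (μ := l) hk (by rw [norm_neg, hκ]) hl h1 h2 x
    refine h.congr_deriv ?_
    rw [h3]
    simp only [fstOp]
    ring
  hasDerivAt_snd x := by
    have hF2 : Integrable fun η => -(starRingEnd ℂ) (F (-η)) := by
      have : Integrable fun η => star (F (-η)) :=
        (Complex.conjLIE.toContinuousLinearEquiv : ℂ →L[ℝ] ℂ).integrable_comp hF.comp_neg
      exact this.neg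
    obtain ⟨F', h1, h2, h3⟩ := add_modMul_eq hs hs' hk γ hF2 (negConjReflect_eq hu)
    rw [sndBilin_apply, ← map_add]
    have h := hasDerivAt_evalFn_resOp (c := κ) (μ := -l) hk hκ (by rw [abs_neg, hl]) h1 h2 x
    refine h.congr_deriv ?_
    rw [h3, fourierInv_negConjReflect]
    simp only [sndOp]
    push_cast
    ring
  quadratic := hq
  continuous := continuous_evalFn hs hk γ
  norm_le := hγ
  bounded := ⟨_, fun x => ⟨(norm_evalFn_le hs hk _ x).trans (le_max_left _ _),
    (norm_evalFn_le hs hk _ x).trans (le_max_right _ _)⟩⟩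

theorem hasDerivAt_evalFn_fstOp {u : Lp ℂ 2 (volume : Measure ℝ)} {F : ℝ → ℂ}
    (hF : Integrable F) (hu : u =ᵐ[volume] fun η => (tauW s k η : ℂ) * F η) (x : ℝ) :
    HasDerivAt (evalFn s k (fstOp hk hκ hl u))
      (-2 * l * evalFn s k (fstOp hk hκ hl u) x - κ * 𝓕⁻ F x) x := by
  refine (hasDerivAt_evalFn_resOp (c := -κ) (μ := l) hk (by rw [norm_neg, hκ]) hl hF
    hu x).congr_deriv ?_
  simp only [fstOp]
  ring

theorem hasDerivAt_evalFn_sndOp {u : Lp ℂ 2 (volume : Measure ℝ)} {F : ℝ → ℂ}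
    (hF : Integrable F) (hu : u =ᵐ[volume] fun η => (tauW s k η : ℂ) * F η) (x : ℝ) :
    HasDerivAt (evalFn s k (sndOp hk hκ hl (negConjReflect u)))
      (2 * l * evalFn s k (sndOp hk hκ hl (negConjReflect u)) x +
        κ * (-(starRingEnd ℂ) (𝓕⁻ F x))) x := by
  have hF2 : Integrable fun η => -(starRingEnd ℂ) (F (-η)) := by
    have : Integrable fun η => star (F (-η)) :=
      (Complex.conjLIE.toContinuousLinearEquiv : ℂ →L[ℝ] ℂ).integrable_comp hF.comp_neg
    exact this.neg
  refine (hasDerivAt_evalFn_resOp (c := κ) (μ := -l) hk hκ (by rw [abs_neg, hl]) hF2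
    (negConjReflect_eq hu) x).congr_deriv ?_
  rw [fourierInv_negConjReflect]
  simp only [sndOp]
  push_cast
  ring

end Solution

end DNLSGreen

end

noncomputable section

namespace DNLSGreen

open Filter Topology

/-! ### The Neumann series of the Green's function -/

/-- The integral kernel of `(∂ + μ)⁻¹`. -/
def resKer (μ x y : ℝ) : ℂ :=
  ((if 0 < μ then if y < x then Real.exp (-μ * (x - y)) else 0
    else if x < y then -Real.exp (-μ * (x - y)) else 0 : ℝ) : ℂ)

theorem norm_resKer_le (μ x y : ℝ) : ‖resKer μ x y‖ ≤ Real.exp (-|μ| * |x - y|) := by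
  unfold resKer
  rw [Complex.norm_real]
  split_ifs with h1 h2 h2
  · rw [abs_of_pos h1, abs_of_pos (sub_pos.2 h2), Real.norm_eq_abs, Real.abs_exp]
  · simpa using (Real.exp_pos _).le
  · rw [abs_of_nonpos (not_lt.1 h1), abs_of_neg (sub_neg.2 h2), norm_neg, Real.norm_eq_abs,
      Real.abs_exp]
    apply le_of_eq
    congr 1
    ring
  · simpa using (Real.exp_pos _).le

theorem measurable_resKer (μ : ℝ) : Measurable fun p : ℝ × ℝ => resKer μ p.1 p.2 := by
  unfold resKer
  refine Complex.measurable_ofReal.comp ?_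
  by_cases h : 0 < μ
  · simp only [h, if_true]
    exact Measurable.ite (measurableSet_lt measurable_snd measurable_fst) (by fun_prop)
      measurable_const
  · simp only [h, if_false]
    exact Measurable.ite (measurableSet_lt measurable_fst measurable_snd) (by fun_prop)
      measurable_const

theorem measurable_resKer_left (μ y : ℝ) : Measurable fun x => resKer μ x y :=
  (measurable_resKer μ).comp (measurable_id.prodMk measurable_const)

theorem measurable_resKer_right (μ x : ℝ) : Measurable fun y => resKer μ x y :=
  (measurable_resKer μ).comp (measurable_const.prodMk measurable_id)

theorem continuousAt_resKer {μ x y : ℝ} (h : x ≠ y) :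
    ContinuousAt (fun p : ℝ × ℝ => resKer μ p.1 p.2) (x, y) := by
  unfold resKer
  refine Complex.continuous_ofReal.continuousAt.comp ?_
  rcases h.lt_or_gt with h | h
  · have hev : ∀ᶠ p : ℝ × ℝ in 𝓝 (x, y), p.1 < p.2 :=
      (isOpen_lt continuous_fst continuous_snd).mem_nhds h
    by_cases hμ : 0 < μ
    · simp only [hμ, if_true]
      refine continuousAt_const (y := (0 : ℝ)) |>.congr ?_
      filter_upwards [hev] with p hp
      rw [if_neg hp.le.not_gt]
    · simp only [hμ, if_false]
      refine ContinuousAt.congr (f := fun p : ℝ × ℝ => -Real.exp (-μ * (p.1 - p.2)))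
        (by fun_prop) ?_
      filter_upwards [hev] with p hp
      rw [if_pos hp]
  · have hev : ∀ᶠ p : ℝ × ℝ in 𝓝 (x, y), p.2 < p.1 :=
      (isOpen_lt continuous_snd continuous_fst).mem_nhds h
    by_cases hμ : 0 < μ
    · simp only [hμ, if_true]
      refine ContinuousAt.congr (f := fun p : ℝ × ℝ => Real.exp (-μ * (p.1 - p.2)))
        (by fun_prop) ?_
      filter_upwards [hev] with p hp
      rw [if_pos hp]
    · simp only [hμ, if_false]
      refine continuousAt_const (y := (0 : ℝ)) |>.congr ?_
      filter_upwards [hev] with p hp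
      rw [if_neg hp.le.not_gt]

/-- The matrix kernel of `R₀ (V R₀) ^ n`, where `R₀` is diagonal with entries `(∂ + μ i)⁻¹` and `V`
is off-diagonal. -/
def neumannTerm (μ : Fin 2 → ℝ) (V : Fin 2 → ℝ → ℂ) : ℕ → ℝ → ℝ → Fin 2 → Fin 2 → ℂ
  | 0 => fun x y i j => if i = j then resKer (μ i) x y else 0
  | n + 1 => fun x y i j =>
      ∫ z, resKer (μ i) x z * V i z * neumannTerm μ V n z y (i + 1) j

theorem neumannTerm_zero (μ : Fin 2 → ℝ) (V : Fin 2 → ℝ → ℂ) (x y : ℝ) (i j : Fin 2) :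
    neumannTerm μ V 0 x y i j = if i = j then resKer (μ i) x y else 0 := rfl

/-- Bounds that make the Neumann series converge. -/
structure NeumannData (Λ β : ℝ) (μ : Fin 2 → ℝ) (V : Fin 2 → ℝ → ℂ) (w : ℝ → ℝ) : Prop where
  pos : 0 < Λ
  abs_eq : ∀ i, |μ i| = Λ
  measurable : ∀ i, Measurable (V i)
  norm_le : ∀ i z, ‖V i z‖ ≤ w z
  integrable : ∀ x, Integrable fun z => Real.exp (-(Λ / 2) * |x - z|) * w z
  integral_le : ∀ x, ∫ z, Real.exp (-(Λ / 2) * |x - z|) * w z ≤ β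

namespace NeumannData

variable {Λ β : ℝ} {μ : Fin 2 → ℝ} {V : Fin 2 → ℝ → ℂ} {w : ℝ → ℝ}

theorem w_nonneg (h : NeumannData Λ β μ V w) (z : ℝ) : 0 ≤ w z :=
  (norm_nonneg _).trans (h.norm_le 0 z)

theorem beta_nonneg (h : NeumannData Λ β μ V w) : 0 ≤ β :=
  (integral_nonneg fun z => mul_nonneg (Real.exp_pos _).le (h.w_nonneg z)).trans (h.integral_le 0)

/-- The exponential is split in two halves: one is integrated against the weight, and the other
carries the decay in `|x - y|` through the iteration. -/
theorem norm_mul_le (h : NeumannData Λ β μ V w) (i : Fin 2) (x z : ℝ) :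
    ‖resKer (μ i) x z * V i z‖ ≤
      Real.exp (-(Λ / 2) * |x - z|) * (Real.exp (-(Λ / 2) * |x - z|) * w z) := by
  rw [norm_mul, ← mul_assoc, ← Real.exp_add]
  refine mul_le_mul ((norm_resKer_le _ _ _).trans (le_of_eq ?_)) (h.norm_le i z) (norm_nonneg _)
    (Real.exp_pos _).le
  rw [h.abs_eq i]
  congr 1
  ring

theorem exp_mul_exp_le (h : NeumannData Λ β μ V w) (x y z : ℝ) :
    Real.exp (-(Λ / 2) * |x - z|) * Real.exp (-(Λ / 2) * |z - y|) ≤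
      Real.exp (-(Λ / 2) * |x - y|) := by
  rw [← Real.exp_add]
  refine Real.exp_le_exp.2 ?_
  have h1 := abs_sub_le x z y
  have h2 := h.pos
  nlinarith

theorem exp_le_one (h : NeumannData Λ β μ V w) (x y : ℝ) :
    Real.exp (-(Λ / 2) * |x - y|) ≤ 1 := by
  rw [Real.exp_le_one_iff]
  have h1 := abs_nonneg (x - y)
  have h2 := h.pos
  nlinarith

theorem norm_mul_le' (h : NeumannData Λ β μ V w) (i : Fin 2) (x z : ℝ) :
    ‖resKer (μ i) x z * V i z‖ ≤ Real.exp (-(Λ / 2) * |x - z|) * w z := by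
  refine (h.norm_mul_le i x z).trans ?_
  exact mul_le_of_le_one_left (mul_nonneg (Real.exp_pos _).le (h.w_nonneg z)) (h.exp_le_one x z)

theorem measurable_mul (h : NeumannData Λ β μ V w) (i : Fin 2) (x : ℝ) :
    Measurable fun z => resKer (μ i) x z * V i z :=
  (measurable_resKer_right _ x).mul (h.measurable i)

/-- The integral `∫ K(x, z) V(z) f(z) dz` is bounded by `β sup |f|`. -/
theorem integrable_mul (h : NeumannData Λ β μ V w) (i : Fin 2) (x : ℝ) {f : ℝ → ℂ} {M : ℝ}
    (hf : AEStronglyMeasurable f) (hM : ∀ z, ‖f z‖ ≤ M) :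
    Integrable fun z => resKer (μ i) x z * V i z * f z := by
  refine ((h.integrable x).mul_const M).mono'
    ((h.measurable_mul i x).aestronglyMeasurable.mul hf) (ae_of_all _ fun z => ?_)
  rw [norm_mul]
  exact mul_le_mul (h.norm_mul_le' i x z) (hM z) (norm_nonneg _)
    (mul_nonneg (Real.exp_pos _).le (h.w_nonneg z))

theorem norm_integral_le (h : NeumannData Λ β μ V w) (i : Fin 2) (x : ℝ) {f : ℝ → ℂ} {M : ℝ}
    (hM : ∀ z, ‖f z‖ ≤ M) : ‖∫ z, resKer (μ i) x z * V i z * f z‖ ≤ β * M := by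
  have hM0 : 0 ≤ M := (norm_nonneg _).trans (hM 0)
  refine (norm_integral_le_of_norm_le ((h.integrable x).mul_const M)
    (ae_of_all _ fun z => ?_)).trans ?_
  · rw [norm_mul]
    exact mul_le_mul (h.norm_mul_le' i x z) (hM z) (norm_nonneg _)
      (mul_nonneg (Real.exp_pos _).le (h.w_nonneg z))
  · rw [integral_mul_const]
    exact mul_le_mul_of_nonneg_right (h.integral_le x) hM0

theorem norm_integral_exp_le (h : NeumannData Λ β μ V w) (i : Fin 2) (x y : ℝ) {f : ℝ → ℂ} {M : ℝ}
    (hM : ∀ z, ‖f z‖ ≤ M * Real.exp (-(Λ / 2) * |z - y|)) :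
    ‖∫ z, resKer (μ i) x z * V i z * f z‖ ≤ β * M * Real.exp (-(Λ / 2) * |x - y|) := by
  have hM0 : 0 ≤ M := by
    have h1 := (norm_nonneg _).trans (hM 0)
    exact nonneg_of_mul_nonneg_left h1 (Real.exp_pos _)
  refine (norm_integral_le_of_norm_le
    ((h.integrable x).mul_const (M * Real.exp (-(Λ / 2) * |x - y|)))
    (ae_of_all _ fun z => ?_)).trans ?_
  · rw [norm_mul]
    have hw := h.w_nonneg z
    calc ‖resKer (μ i) x z * V i z‖ * ‖f z‖
        ≤ Real.exp (-(Λ / 2) * |x - z|) * (Real.exp (-(Λ / 2) * |x - z|) * w z) *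
          (M * Real.exp (-(Λ / 2) * |z - y|)) :=
          mul_le_mul (h.norm_mul_le i x z) (hM z) (norm_nonneg _) (by positivity)
      _ = Real.exp (-(Λ / 2) * |x - z|) * w z * M *
          (Real.exp (-(Λ / 2) * |x - z|) * Real.exp (-(Λ / 2) * |z - y|)) := by ring
      _ ≤ Real.exp (-(Λ / 2) * |x - z|) * w z * M * Real.exp (-(Λ / 2) * |x - y|) := by
          gcongr
          exact h.exp_mul_exp_le x y z
      _ = _ := by ring
  · rw [integral_mul_const, mul_assoc]
    exact mul_le_mul_of_nonneg_right (h.integral_le x) (by positivity)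

theorem norm_neumannTerm_le (h : NeumannData Λ β μ V w) (n : ℕ) (x y : ℝ) (i j : Fin 2) :
    ‖neumannTerm μ V n x y i j‖ ≤ β ^ n * Real.exp (-(Λ / 2) * |x - y|) := by
  induction n generalizing x i with
  | zero =>
    rw [pow_zero, one_mul, neumannTerm_zero]
    split_ifs with hij
    · refine (norm_resKer_le _ _ _).trans (Real.exp_le_exp.2 ?_)
      rw [h.abs_eq]
      have h1 := abs_nonneg (x - y)
      have h2 := h.pos
      nlinarith
    · simpa using (Real.exp_pos _).le
  | succ n ih =>
    rw [pow_succ', neumannTerm]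
    exact h.norm_integral_exp_le i x y fun z => ih z (i + 1)

theorem norm_neumannTerm_le' (h : NeumannData Λ β μ V w) (n : ℕ) (x y : ℝ) (i j : Fin 2) :
    ‖neumannTerm μ V n x y i j‖ ≤ β ^ n :=
  (h.norm_neumannTerm_le n x y i j).trans
    (mul_le_of_le_one_right (pow_nonneg h.beta_nonneg n) (h.exp_le_one x y))

/-- The free kernel jumps only on the diagonal. For fixed endpoints the integrand of the next term
is therefore continuous in them for almost every `z`, and dominated convergence makes every later
term jointly continuous. The three properties have to be carried through the induction together. -/
theorem neumannTerm_aux (h : NeumannData Λ β μ V w) (n : ℕ) :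
    (∀ y i j, Measurable fun x => neumannTerm μ V n x y i j) ∧
    (∀ z y i j, z ≠ y → ContinuousAt (fun y' => neumannTerm μ V n z y' i j) y) ∧
    ∀ i j, Continuous fun p : ℝ × ℝ => neumannTerm μ V (n + 1) p.1 p.2 i j := by
  have key : ∀ n, (∀ y i j, Measurable fun x => neumannTerm μ V n x y i j) →
      (∀ z y i j, z ≠ y → ContinuousAt (fun y' => neumannTerm μ V n z y' i j) y) →
      ∀ i j, Continuous fun p : ℝ × ℝ => neumannTerm μ V (n + 1) p.1 p.2 i j := by
    intro n h1 h2 i j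
    rw [continuous_iff_continuousAt]
    rintro ⟨x0, y0⟩
    simp only [neumannTerm]
    refine continuousAt_of_dominated
      -- Moving the first argument by less than `1` from `x0` costs a factor of at most `exp(Λ/2)`.
      (bound := fun z => Real.exp (Λ / 2) * (Real.exp (-(Λ / 2) * |x0 - z|) * w z) * β ^ n) ?_ ?_
      (((h.integrable x0).const_mul _).mul_const _) ?_
    · exact Eventually.of_forall fun p =>
        ((h.measurable_mul i p.1).mul (h1 p.2 (i + 1) j)).aestronglyMeasurable
    · have hev : ∀ᶠ p : ℝ × ℝ in 𝓝 (x0, y0), |x0 - p.1| < 1 := by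
        have : ContinuousAt (fun p : ℝ × ℝ => |x0 - p.1|) (x0, y0) := by fun_prop
        exact this.eventually_lt continuousAt_const (by simp)
      filter_upwards [hev] with p hp
      refine ae_of_all _ fun z => ?_
      rw [norm_mul]
      refine mul_le_mul ((h.norm_mul_le' i p.1 z).trans ?_) (h.norm_neumannTerm_le' n z p.2 _ _)
        (norm_nonneg _) (mul_nonneg (Real.exp_pos _).le
          (mul_nonneg (Real.exp_pos _).le (h.w_nonneg z)))
      rw [← mul_assoc, ← Real.exp_add]
      refine mul_le_mul_of_nonneg_right (Real.exp_le_exp.2 ?_) (h.w_nonneg z)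
      have h3 := abs_sub_le x0 p.1 z
      have h4 := h.pos
      nlinarith
    · have hx : ∀ᵐ z : ℝ, z ≠ x0 := by simp [ae_iff]
      have hy : ∀ᵐ z : ℝ, z ≠ y0 := by simp [ae_iff]
      filter_upwards [hx, hy] with z hzx hzy
      refine ContinuousAt.mul (ContinuousAt.mul ?_ continuousAt_const) ?_
      · exact ContinuousAt.comp (g := fun p : ℝ × ℝ => resKer (μ i) p.1 p.2)
          (f := fun p : ℝ × ℝ => (p.1, z)) (continuousAt_resKer hzx.symm) (by fun_prop)
      · exact ContinuousAt.comp (g := fun y' => neumannTerm μ V n z y' (i + 1) j)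
          (f := fun p : ℝ × ℝ => p.2) (h2 z y0 _ _ hzy) (by fun_prop)
  induction n with
  | zero =>
    have h1 : ∀ y i j, Measurable fun x => neumannTerm μ V 0 x y i j := by
      intro y i j
      simp only [neumannTerm]
      split_ifs
      · exact measurable_resKer_left _ y
      · exact measurable_const
    have h2 : ∀ z y i j, z ≠ y → ContinuousAt (fun y' => neumannTerm μ V 0 z y' i j) y := by
      intro z y i j hzy
      simp only [neumannTerm]
      split_ifs
      · exact ContinuousAt.comp (g := fun p : ℝ × ℝ => resKer (μ i) p.1 p.2)
          (f := fun y' => (z, y')) (continuousAt_resKer hzy) (by fun_prop)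
      · exact continuousAt_const
    exact ⟨h1, h2, key 0 h1 h2⟩
  | succ n ih =>
    have h1 : ∀ y i j, Measurable fun x => neumannTerm μ V (n + 1) x y i j := fun y i j =>
      ((ih.2.2 i j).comp (by fun_prop : Continuous fun x : ℝ => (x, y))).measurable
    have h2 : ∀ z y i j, z ≠ y → ContinuousAt (fun y' => neumannTerm μ V (n + 1) z y' i j) y :=
      fun z y i j _ =>
        ((ih.2.2 i j).comp (by fun_prop : Continuous fun y' : ℝ => (z, y'))).continuousAt
    exact ⟨h1, h2, key (n + 1) h1 h2⟩

theorem measurable_neumannTerm (h : NeumannData Λ β μ V w) (n : ℕ) (y : ℝ) (i j : Fin 2) :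
    Measurable fun x => neumannTerm μ V n x y i j := (h.neumannTerm_aux n).1 y i j

theorem continuous_neumannTerm_succ (h : NeumannData Λ β μ V w) (n : ℕ) (i j : Fin 2) :
    Continuous fun p : ℝ × ℝ => neumannTerm μ V (n + 1) p.1 p.2 i j :=
  (h.neumannTerm_aux n).2.2 i j

end NeumannData

/-- Each factor of the off-diagonal potential exchanges the two components, so the parity of `n`
decides which entries survive. -/
theorem neumannTerm_eq_zero {μ : Fin 2 → ℝ} {V : Fin 2 → ℝ → ℂ} (n : ℕ) (x y : ℝ) {i j : Fin 2}
    (he : Even n → i ≠ j) (ho : ¬ Even n → i = j) : neumannTerm μ V n x y i j = 0 := by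
  induction n generalizing x i with
  | zero => rw [neumannTerm_zero, if_neg (he Even.zero)]
  | succ n ih =>
    rw [neumannTerm]
    have h1 : ∀ a : Fin 2, a + 1 ≠ a := by decide
    have h2 : ∀ a b : Fin 2, a ≠ b → a + 1 = b := by decide
    have : ∀ z, neumannTerm μ V n z y (i + 1) j = 0 := fun z => ih z
      (fun hn => by
        rw [← ho (by simpa [Nat.even_add_one] using hn)]
        exact h1 i)
      (fun hn => h2 i j (he (by simpa [Nat.even_add_one] using hn)))
    simp [this]

theorem neumannTerm_congr {μ : Fin 2 → ℝ} {V V' : Fin 2 → ℝ → ℂ}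
    (hV : ∀ i, V i =ᵐ[volume] V' i) (n : ℕ) : neumannTerm μ V n = neumannTerm μ V' n := by
  induction n with
  | zero => rfl
  | succ n ih =>
    funext x y i j
    rw [neumannTerm, neumannTerm, ih]
    refine integral_congr_ae ?_
    filter_upwards [hV i] with z hz
    rw [hz]

/-- The sum of the Neumann series. -/
def neumannSum (μ : Fin 2 → ℝ) (V : Fin 2 → ℝ → ℂ) (x y : ℝ) (i j : Fin 2) : ℂ :=
  ∑' n, neumannTerm μ V n x y i j

/-! ### Convergence of the Neumann series, uniqueness of bounded solutions, dependence on the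
potential. -/

namespace NeumannData

variable {Λ β : ℝ} {μ : Fin 2 → ℝ} {V : Fin 2 → ℝ → ℂ} {w : ℝ → ℝ}

theorem summable_norm_neumannTerm (h : NeumannData Λ β μ V w) (hβ : β ≤ 1 / 2) (x y : ℝ)
    (i j : Fin 2) : Summable fun n => ‖neumannTerm μ V n x y i j‖ :=
  Summable.of_nonneg_of_le (fun _ => norm_nonneg _) (fun n => h.norm_neumannTerm_le' n x y i j)
    (summable_geometric_of_lt_one h.beta_nonneg (by linarith))

theorem hasSum_neumannTerm (h : NeumannData Λ β μ V w) (hβ : β ≤ 1 / 2) (x y : ℝ)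
    (i j : Fin 2) : HasSum (fun n => neumannTerm μ V n x y i j) (neumannSum μ V x y i j) :=
  (h.summable_norm_neumannTerm hβ x y i j).of_norm.hasSum

theorem hasSum_neumannTerm_succ (h : NeumannData Λ β μ V w) (hβ : β ≤ 1 / 2) (x y : ℝ)
    (i j : Fin 2) : HasSum (fun n => neumannTerm μ V (n + 1) x y i j)
      (neumannSum μ V x y i j - neumannTerm μ V 0 x y i j) := by
  simpa using (hasSum_nat_add_iff' (f := fun n => neumannTerm μ V n x y i j) 1).2
    (h.hasSum_neumannTerm hβ x y i j)

theorem norm_neumannSum_le (h : NeumannData Λ β μ V w) (hβ : β ≤ 1 / 2) (x y : ℝ)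
    (i j : Fin 2) : ‖neumannSum μ V x y i j‖ ≤ 2 * Real.exp (-(Λ / 2) * |x - y|) := by
  have hg := (hasSum_geometric_of_lt_one h.beta_nonneg (by linarith : β < 1)).mul_right
    (Real.exp (-(Λ / 2) * |x - y|))
  refine (tsum_of_norm_bounded hg fun n => h.norm_neumannTerm_le n x y i j).trans ?_
  refine mul_le_mul_of_nonneg_right ?_ (Real.exp_pos _).le
  rw [inv_le_comm₀ (by linarith) two_pos]
  linarith

theorem norm_neumannSum_le_two (h : NeumannData Λ β μ V w) (hβ : β ≤ 1 / 2) (x y : ℝ)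
    (i j : Fin 2) : ‖neumannSum μ V x y i j‖ ≤ 2 := by
  refine (h.norm_neumannSum_le hβ x y i j).trans ?_
  have := h.exp_le_one x y
  linarith

theorem continuous_neumannSum_sub (h : NeumannData Λ β μ V w) (hβ : β ≤ 1 / 2) (i j : Fin 2) :
    Continuous fun p : ℝ × ℝ => neumannSum μ V p.1 p.2 i j - neumannTerm μ V 0 p.1 p.2 i j := by
  have e : (fun p : ℝ × ℝ => neumannSum μ V p.1 p.2 i j - neumannTerm μ V 0 p.1 p.2 i j) =
      fun p => ∑' n, neumannTerm μ V (n + 1) p.1 p.2 i j :=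
    funext fun p => (h.hasSum_neumannTerm_succ hβ p.1 p.2 i j).tsum_eq.symm
  rw [e]
  refine continuous_tsum (fun n => h.continuous_neumannTerm_succ n i j)
    ((summable_geometric_of_lt_one h.beta_nonneg (by linarith)).comp_injective
      (add_left_injective 1)) fun n p => h.norm_neumannTerm_le' (n + 1) p.1 p.2 i j

theorem measurable_neumannSum (h : NeumannData Λ β μ V w) (hβ : β ≤ 1 / 2) (i j : Fin 2) :
    Measurable fun p : ℝ × ℝ => neumannSum μ V p.1 p.2 i j := by
  have h1 := (h.continuous_neumannSum_sub hβ i j).measurable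
  have h2 : Measurable fun p : ℝ × ℝ => neumannTerm μ V 0 p.1 p.2 i j := by
    simp only [neumannTerm]
    split_ifs
    · exact measurable_resKer _
    · exact measurable_const
  convert h1.add h2 using 1
  funext p
  simp

/-- This is the resolvent identity `G = R₀ + R₀ V G`, obtained by summing the recursion under the
integral; the geometric series in `β` dominates. -/
theorem neumannSum_eq (h : NeumannData Λ β μ V w) (hβ : β ≤ 1 / 2) (x y : ℝ) (i j : Fin 2) :
    neumannSum μ V x y i j = (if i = j then resKer (μ i) x y else 0) +
      ∫ z, resKer (μ i) x z * V i z * neumannSum μ V z y (i + 1) j := by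
  have h1 := h.hasSum_neumannTerm_succ hβ x y i j
  have h2 : HasSum (fun n => neumannTerm μ V (n + 1) x y i j)
      (∫ z, resKer (μ i) x z * V i z * neumannSum μ V z y (i + 1) j) := by
    simp only [neumannTerm]
    refine hasSum_integral_of_dominated_convergence
      (fun n z => Real.exp (-(Λ / 2) * |x - z|) * w z * β ^ n) ?_ ?_ ?_ ?_ ?_
    · exact fun n => ((h.measurable_mul i x).mul
        (h.measurable_neumannTerm n y (i + 1) j)).aestronglyMeasurable
    · refine fun n => ae_of_all _ fun z => ?_
      rw [norm_mul]
      exact mul_le_mul (h.norm_mul_le' i x z) (h.norm_neumannTerm_le' n z y _ _) (norm_nonneg _)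
        (mul_nonneg (Real.exp_pos _).le (h.w_nonneg z))
    · exact ae_of_all _ fun z =>
        (summable_geometric_of_lt_one h.beta_nonneg (by linarith)).mul_left _
    · simp only [tsum_mul_left]
      exact (h.integrable x).mul_const _
    · exact ae_of_all _ fun z => (h.hasSum_neumannTerm hβ z y _ _).mul_left _
  have h3 := h1.unique h2
  rw [← h3, neumannTerm_zero]
  ring

/-- Bounded solutions of the integral equation of a column are unique. -/
theorem eq_of_integral_eq (h : NeumannData Λ β μ V w) (hβ : β ≤ 1 / 2) {d f f' : Fin 2 → ℝ → ℂ}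
    {M : ℝ} (hf : ∀ i, Measurable (f i)) (hf' : ∀ i, Measurable (f' i))
    (hM : ∀ i x, ‖f i x‖ ≤ M) (hM' : ∀ i x, ‖f' i x‖ ≤ M)
    (he : ∀ i x, f i x = d i x + ∫ z, resKer (μ i) x z * V i z * f (i + 1) z)
    (he' : ∀ i x, f' i x = d i x + ∫ z, resKer (μ i) x z * V i z * f' (i + 1) z) : f = f' := by
  have hM0 : 0 ≤ M := (norm_nonneg _).trans (hM 0 0)
  -- The difference satisfies the homogeneous equation, and each application of it gains a factor
  -- `1/2`.
  have key : ∀ (n : ℕ) i x, ‖f i x - f' i x‖ ≤ (1 / 2) ^ n * (2 * M) := by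
    intro n
    induction n with
    | zero =>
      intro i x
      have := (norm_sub_le (f i x) (f' i x)).trans (add_le_add (hM i x) (hM' i x))
      linarith
    | succ n ih =>
      intro i x
      have e : f i x - f' i x =
          ∫ z, resKer (μ i) x z * V i z * (f (i + 1) z - f' (i + 1) z) := by
        rw [he i x, he' i x, add_sub_add_left_eq_sub, ← integral_sub
          (h.integrable_mul i x (hf _).aestronglyMeasurable (hM _))
          (h.integrable_mul i x (hf' _).aestronglyMeasurable (hM' _))]
        simp only [mul_sub]
      rw [e, pow_succ', mul_assoc]
      refine (h.norm_integral_le i x (ih (i + 1))).trans ?_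
      gcongr
  funext i x
  have h0 : Tendsto (fun n : ℕ => (1 / 2 : ℝ) ^ n * (2 * M)) atTop (𝓝 0) := by
    simpa using (tendsto_pow_atTop_nhds_zero_of_lt_one (by norm_num : (0 : ℝ) ≤ 1 / 2)
      (by norm_num)).mul_const (2 * M)
  have := ge_of_tendsto' h0 fun n => key n i x
  exact sub_eq_zero.1 (norm_le_zero_iff.1 this)

/-- The Neumann series is Lipschitz in the potential. -/
theorem norm_neumannSum_sub_le (h : NeumannData Λ β μ V w) (hβ : β ≤ 1 / 2)
    {V' : Fin 2 → ℝ → ℂ} {w' : ℝ → ℝ} (h' : NeumannData Λ β μ V' w')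
    {η : ℝ} {wd : ℝ → ℝ} (hd : NeumannData Λ η μ (fun i z => V i z - V' i z) wd)
    (x y : ℝ) (i j : Fin 2) :
    ‖neumannSum μ V x y i j - neumannSum μ V' x y i j‖ ≤ 4 * η := by
  have hm : ∀ i, Measurable fun z => neumannSum μ V z y i j := fun i =>
    (h.measurable_neumannSum hβ i j).comp (measurable_id.prodMk measurable_const)
  have hm' : ∀ i, Measurable fun z => neumannSum μ V' z y i j := fun i =>
    (h'.measurable_neumannSum hβ i j).comp (measurable_id.prodMk measurable_const)
  have hη := hd.beta_nonneg
  -- The difference `D` obeys `D = R₀(V - V')G' + R₀ V D`. As `G'` is bounded by `2` and the second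
  -- operator by `1/2`, the bound `4η` reproduces itself, and the initial bound `4` is halved at
  -- every step.
  have key : ∀ (n : ℕ) i x, ‖neumannSum μ V x y i j - neumannSum μ V' x y i j‖ ≤
      (1 / 2) ^ n * 4 + 4 * η := by
    intro n
    induction n with
    | zero =>
      intro i x
      have := (norm_sub_le (neumannSum μ V x y i j) (neumannSum μ V' x y i j)).trans
        (add_le_add (h.norm_neumannSum_le_two hβ x y i j) (h'.norm_neumannSum_le_two hβ x y i j))
      linarith
    | succ n ih =>
      intro i x
      have e : neumannSum μ V x y i j - neumannSum μ V' x y i j =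
          (∫ z, resKer (μ i) x z * (V i z - V' i z) * neumannSum μ V' z y (i + 1) j) +
          ∫ z, resKer (μ i) x z * V i z *
            (neumannSum μ V z y (i + 1) j - neumannSum μ V' z y (i + 1) j) := by
        have i1 := h.integrable_mul i x (hm (i + 1)).aestronglyMeasurable
          fun z => h.norm_neumannSum_le_two hβ z y (i + 1) j
        have i2 := h.integrable_mul i x (hm' (i + 1)).aestronglyMeasurable
          fun z => h'.norm_neumannSum_le_two hβ z y (i + 1) j
        have i3 := h'.integrable_mul i x (hm' (i + 1)).aestronglyMeasurable
          fun z => h'.norm_neumannSum_le_two hβ z y (i + 1) j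
        rw [h.neumannSum_eq hβ x y i j, h'.neumannSum_eq hβ x y i j, add_sub_add_left_eq_sub]
        simp only [mul_sub, sub_mul]
        rw [integral_sub i2 i3, integral_sub i1 i2]
        ring
      rw [e]
      refine (norm_add_le _ _).trans ((add_le_add
        (hd.norm_integral_le i x fun z => h'.norm_neumannSum_le_two hβ z y (i + 1) j)
        (h.norm_integral_le i x (ih (i + 1)))).trans ?_)
      rw [pow_succ']
      have : β * ((1 / 2) ^ n * 4 + 4 * η) ≤ 1 / 2 * ((1 / 2) ^ n * 4 + 4 * η) := by gcongr
      linarith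
  have h0 : Tendsto (fun n : ℕ => (1 / 2 : ℝ) ^ n * 4 + 4 * η) atTop (𝓝 (4 * η)) := by
    simpa using ((tendsto_pow_atTop_nhds_zero_of_lt_one (by norm_num : (0 : ℝ) ≤ 1 / 2)
      (by norm_num)).mul_const 4).add_const (4 * η)
  exact ge_of_tendsto' h0 fun n => key n i x

theorem norm_neumannTerm_one_sub_le (h : NeumannData Λ β μ V w)
    {V' : Fin 2 → ℝ → ℂ} {w' : ℝ → ℝ} (h' : NeumannData Λ β μ V' w')
    {η : ℝ} {wd : ℝ → ℝ} (hd : NeumannData Λ η μ (fun i z => V i z - V' i z) wd)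
    (x y : ℝ) (i j : Fin 2) :
    ‖neumannTerm μ V 1 x y i j - neumannTerm μ V' 1 x y i j‖ ≤ η := by
  have e : neumannTerm μ V 1 x y i j - neumannTerm μ V' 1 x y i j =
      neumannTerm μ (fun i z => V i z - V' i z) 1 x y i j := by
    simp only [neumannTerm]
    have hm : AEStronglyMeasurable
        (fun z => if i + 1 = j then resKer (μ (i + 1)) z y else 0) (volume : Measure ℝ) := by
      split_ifs
      · exact (measurable_resKer_left _ y).aestronglyMeasurable
      · exact aestronglyMeasurable_const
    have hb : ∀ z, ‖if i + 1 = j then resKer (μ (i + 1)) z y else 0‖ ≤ 1 := fun z => by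
      simpa [neumannTerm] using h.norm_neumannTerm_le' 0 z y (i + 1) j
    rw [← integral_sub (h.integrable_mul i x hm hb) (h'.integrable_mul i x hm hb)]
    simp only [mul_sub, sub_mul]
  rw [e]
  simpa using hd.norm_neumannTerm_le' 1 x y i j

end NeumannData

end DNLSGreen

end

noncomputable section

namespace DNLSGreen

open Filter Topology

/-! ### Exponential weights -/

theorem integral_exp_neg_abs {c : ℝ} (hc : 0 < c) : ∫ z : ℝ, Real.exp (-c * |z|) = 2 / c := by
  rw [integral_comp_abs (f := fun z => Real.exp (-c * z)),
    integral_exp_mul_Ioi (by linarith : -c < 0)]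
  simp
  ring

theorem integrable_exp_neg_abs {c : ℝ} (hc : 0 < c) :
    Integrable fun z : ℝ => Real.exp (-c * |z|) := by
  refine Integrable.of_integral_ne_zero ?_
  rw [integral_exp_neg_abs hc]
  positivity

theorem integrable_exp_neg_abs_sub {c : ℝ} (hc : 0 < c) (x : ℝ) :
    Integrable fun z : ℝ => Real.exp (-c * |x - z|) :=
  (integrable_exp_neg_abs hc).comp_sub_left x

theorem integral_exp_neg_abs_sub {c : ℝ} (hc : 0 < c) (x : ℝ) :
    ∫ z : ℝ, Real.exp (-c * |x - z|) = 2 / c := by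
  rw [← integral_exp_neg_abs hc]
  exact integral_sub_left_eq_self (fun z => Real.exp (-c * |z|)) volume x

theorem memLp_exp_neg_abs_sub {c : ℝ} (hc : 0 < c) (x : ℝ) :
    MemLp (fun z : ℝ => Real.exp (-c * |x - z|)) 2 := by
  refine (memLp_two_iff_integrable_sq (by fun_prop)).2 ?_
  refine (integrable_exp_neg_abs_sub (by linarith : 0 < 2 * c) x).congr (ae_of_all _ fun z => ?_)
  simp only
  rw [← Real.exp_nat_mul]
  congr 1
  push_cast
  ring

theorem integrable_exp_mul_norm {c : ℝ} (hc : 0 < c) {h : ℝ → ℂ} (hh : MemLp h 2) (x : ℝ) :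
    Integrable fun z => Real.exp (-c * |x - z|) * ‖h z‖ :=
  (memLp_exp_neg_abs_sub hc x).integrable_mul hh.norm

theorem toReal_eLpNorm_two {E : Type*} [NormedAddCommGroup E] {f : ℝ → E} (hf : MemLp f 2) :
    (eLpNorm f 2 volume).toReal = (∫ z, ‖f z‖ ^ (2 : ℝ)) ^ (1 / (2 : ℝ)) := by
  rw [hf.eLpNorm_eq_integral_rpow_norm (by norm_num) (by norm_num), ENNReal.toReal_ofReal
    (by positivity)]
  simp

theorem norm_integral_mul_le_two {f g : ℝ → ℂ} (hf : MemLp f 2) (hg : MemLp g 2) :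
    ‖∫ z, f z * g z‖ ≤ (eLpNorm f 2 volume).toReal * (eLpNorm g 2 volume).toReal := by
  refine (norm_integral_le_integral_norm _).trans ?_
  rw [toReal_eLpNorm_two hf, toReal_eLpNorm_two hg]
  simp only [norm_mul]
  exact integral_mul_norm_le_Lp_mul_Lq (μ := volume) Real.HolderConjugate.two_two
    (by simpa using hf) (by simpa using hg)

theorem integral_exp_mul_norm_le {c : ℝ} (hc : 0 < c) {h : ℝ → ℂ} (hh : MemLp h 2) (x : ℝ) :
    ∫ z, Real.exp (-c * |x - z|) * ‖h z‖ ≤ Real.sqrt (1 / c) * (eLpNorm h 2 volume).toReal := by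
  have h1 := integral_mul_norm_le_Lp_mul_Lq (μ := volume) Real.HolderConjugate.two_two
    (f := fun z : ℝ => Real.exp (-c * |x - z|)) (g := fun z => ‖h z‖)
    (by simpa using memLp_exp_neg_abs_sub hc x) (by simpa using hh.norm)
  have e1 : ∫ z : ℝ, ‖Real.exp (-c * |x - z|)‖ ^ (2 : ℝ) = 1 / c := by
    have h2 := integral_exp_neg_abs_sub (by linarith : 0 < 2 * c) x
    have h3 : (2 : ℝ) / (2 * c) = 1 / c := by field_simp
    rw [← h3, ← h2]
    congr 1
    funext z
    rw [Real.norm_eq_abs, Real.abs_exp, ← Real.exp_mul]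
    congr 1
    ring
  have e2 := toReal_eLpNorm_two hh.norm
  rw [eLpNorm_norm] at e2
  rw [e1, ← Real.sqrt_eq_rpow, ← e2] at h1
  refine le_trans (le_of_eq ?_) h1
  simp [Real.abs_exp]

/-! ### The equation `f' + μ f = F` -/

theorem integrable_mul_prod {a : ℝ → ℂ} (ha : Integrable a) {g : ℝ × ℝ → ℂ}
    (hg : AEStronglyMeasurable g (volume.prod volume)) {C : ℝ}
    (h1 : ∀ x, Integrable fun z => g (x, z)) (h2 : ∀ x, ∫ z, ‖g (x, z)‖ ≤ C) :
    Integrable (fun p : ℝ × ℝ => a p.1 * g p) (volume.prod volume) := by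
  have hm : AEStronglyMeasurable (fun p : ℝ × ℝ => a p.1 * g p) (volume.prod volume) :=
    ha.aestronglyMeasurable.comp_fst.mul hg
  refine (integrable_prod_iff hm).2 ⟨ae_of_all _ fun x => (h1 x).const_mul (a x), ?_⟩
  refine (ha.norm.mul_const C).mono' hm.norm.integral_prod_right' (ae_of_all _ fun x => ?_)
  simp only [norm_mul, integral_const_mul, norm_norm]
  rw [Real.norm_of_nonneg (integral_nonneg fun _ => norm_nonneg _)]
  exact mul_le_mul_of_nonneg_left (h2 x) (norm_nonneg _)

theorem contDiff_cexp_ofReal_mul (c z : ℝ) :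
    ContDiff ℝ ∞ fun x : ℝ => ((Real.exp (c * (x - z)) : ℝ) : ℂ) := by
  have h : ContDiff ℝ ∞ fun x : ℝ => Real.exp (c * (x - z)) := by fun_prop
  exact Complex.ofRealCLM.contDiff.comp h

theorem hasDerivAt_ofReal_exp (c z x : ℝ) :
    HasDerivAt (fun x : ℝ => ((Real.exp (c * (x - z)) : ℝ) : ℂ))
      ((c : ℂ) * (Real.exp (c * (x - z)) : ℝ)) x := by
  have h : HasDerivAt (fun x : ℝ => Real.exp (c * (x - z))) (Real.exp (c * (x - z)) * (c * 1)) x :=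
    (((hasDerivAt_id x).sub_const z).const_mul c).exp
  refine h.ofReal_comp.congr_deriv ?_
  push_cast
  ring

/-- The kernel is a fundamental solution of `∂ + μ`: after multiplication by the integrating factor,
the integral over the half-line supporting the kernel is that of an exact derivative. -/
theorem integral_resKer_mul_test {μ : ℝ} {φ : ℝ → ℂ} (hφ : ContDiff ℝ ∞ φ)
    (hc : HasCompactSupport φ) (z : ℝ) :
    ∫ x, (-(deriv φ x) + μ * φ x) * resKer μ x z = φ z := by
  set F : ℝ → ℂ := fun x => ((Real.exp (-μ * (x - z)) : ℝ) : ℂ) * φ x with hF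
  have hFd : ContDiff ℝ 1 F :=
    ((contDiff_cexp_ofReal_mul (-μ) z).mul hφ).of_le (by exact_mod_cast le_top)
  have hFc : HasCompactSupport F := hc.mul_left
  have hder : ∀ x, deriv F x =
      -((-(deriv φ x) + μ * φ x) * ((Real.exp (-μ * (x - z)) : ℝ) : ℂ)) := by
    intro x
    have h1 : HasDerivAt φ (deriv φ x) x :=
      (hφ.differentiable (by simp)).differentiableAt.hasDerivAt
    refine ((hasDerivAt_ofReal_exp (-μ) z x).mul h1).deriv.trans ?_
    push_cast
    ring
  have hFz : F z = φ z := by simp [hF]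
  by_cases hμ : 0 < μ
  · have e : (fun x => (-(deriv φ x) + μ * φ x) * resKer μ x z) =
        Set.indicator (Set.Ioi z) fun x => -deriv F x := by
      funext x
      simp only [resKer, hμ, if_true, Set.indicator, Set.mem_Ioi]
      split_ifs
      · rw [hder, neg_neg]
      · simp
    rw [e, integral_indicator measurableSet_Ioi, integral_neg, hFc.integral_Ioi_deriv_eq hFd, hFz,
      neg_neg]
  · have e : (fun x => (-(deriv φ x) + μ * φ x) * resKer μ x z) =
        Set.indicator (Set.Iio z) fun x => deriv F x := by
      funext x
      simp only [resKer, hμ, if_false, Set.indicator, Set.mem_Iio]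
      split_ifs
      · rw [hder]
        push_cast
        ring
      · simp
    rw [e, integral_indicator measurableSet_Iio, ← integral_Iic_eq_integral_Iio,
      hFc.integral_Iic_deriv_eq hFd, hFz]

/-- Functions `F` for which the convolution with an exponential is bounded. -/
structure ExpBounded (Λ C : ℝ) (F : ℝ → ℂ) : Prop where
  measurable : AEStronglyMeasurable F
  integrable : ∀ x, Integrable fun z => Real.exp (-Λ * |x - z|) * ‖F z‖
  integral_le : ∀ x, ∫ z, Real.exp (-Λ * |x - z|) * ‖F z‖ ≤ C

namespace ExpBounded

variable {μ C : ℝ} {F : ℝ → ℂ}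

theorem norm_resKer_mul_le (μ x z : ℝ) (F : ℝ → ℂ) :
    ‖resKer μ x z * F z‖ ≤ Real.exp (-|μ| * |x - z|) * ‖F z‖ := by
  rw [norm_mul]
  exact mul_le_mul_of_nonneg_right (norm_resKer_le μ x z) (norm_nonneg _)

theorem integrable_resKer (h : ExpBounded |μ| C F) (x : ℝ) :
    Integrable fun z => resKer μ x z * F z :=
  (h.integrable x).mono' ((measurable_resKer_right μ x).aestronglyMeasurable.mul h.measurable)
    (ae_of_all _ fun z => norm_resKer_mul_le μ x z F)

theorem integral_norm_resKer_le (h : ExpBounded |μ| C F) (x : ℝ) :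
    ∫ z, ‖resKer μ x z * F z‖ ≤ C :=
  (integral_mono_of_nonneg (ae_of_all _ fun _ => norm_nonneg _) (h.integrable x)
    (ae_of_all _ fun z => norm_resKer_mul_le μ x z F)).trans (h.integral_le x)

theorem aestronglyMeasurable_prod (h : ExpBounded |μ| C F) :
    AEStronglyMeasurable (fun p : ℝ × ℝ => resKer μ p.1 p.2 * F p.2) (volume.prod volume) :=
  (measurable_resKer μ).aestronglyMeasurable.mul h.measurable.comp_snd

theorem aestronglyMeasurable_integral (h : ExpBounded |μ| C F) :
    AEStronglyMeasurable fun x => ∫ z, resKer μ x z * F z :=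
  h.aestronglyMeasurable_prod.integral_prod_right'

theorem norm_integral_le (h : ExpBounded |μ| C F) (x : ℝ) :
    ‖∫ z, resKer μ x z * F z‖ ≤ C :=
  (norm_integral_le_integral_norm _).trans (h.integral_norm_resKer_le x)

theorem add {C' : ℝ} {F' : ℝ → ℂ} {Λ : ℝ} (h : ExpBounded Λ C F) (h' : ExpBounded Λ C' F') :
    ExpBounded Λ (C + C') fun z => F z + F' z where
  measurable := h.measurable.add h'.measurable
  integrable x := by
    refine ((h.integrable x).add (h'.integrable x)).mono' ?_ (ae_of_all _ fun z => ?_)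
    · exact (by fun_prop : Continuous fun z => Real.exp (-Λ * |x - z|)).aestronglyMeasurable.mul
        (h.measurable.add h'.measurable).norm
    · rw [norm_mul, Real.norm_eq_abs, Real.abs_exp, norm_norm, Pi.add_apply, ← mul_add]
      exact mul_le_mul_of_nonneg_left (norm_add_le _ _) (Real.exp_pos _).le
  integral_le x := by
    refine le_trans ?_ (add_le_add (h.integral_le x) (h'.integral_le x))
    rw [← integral_add (h.integrable x) (h'.integrable x)]
    refine integral_mono_of_nonneg (ae_of_all _ fun z => by positivity)
      ((h.integrable x).add (h'.integrable x)) (ae_of_all _ fun z => ?_)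
    simp only
    rw [← mul_add]
    exact mul_le_mul_of_nonneg_left (norm_add_le _ _) (Real.exp_pos _).le

theorem of_memLp {Λ : ℝ} (hΛ : 0 < Λ) (hF : MemLp F 2) :
    ExpBounded Λ (Real.sqrt (1 / Λ) * (eLpNorm F 2 volume).toReal) F :=
  ⟨hF.1, integrable_exp_mul_norm hΛ hF, integral_exp_mul_norm_le hΛ hF⟩

theorem of_integrable {Λ : ℝ} (hΛ : 0 < Λ) (hF : Integrable F) :
    ExpBounded Λ (∫ z, ‖F z‖) F := by
  have hle : ∀ x z, Real.exp (-Λ * |x - z|) * ‖F z‖ ≤ ‖F z‖ := fun x z => by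
    refine mul_le_of_le_one_left (norm_nonneg _) (Real.exp_le_one_iff.2 ?_)
    have := abs_nonneg (x - z)
    nlinarith
  have hi : ∀ x, Integrable fun z => Real.exp (-Λ * |x - z|) * ‖F z‖ := fun x => by
    refine hF.norm.mono' ((by fun_prop : Continuous fun z =>
      Real.exp (-Λ * |x - z|)).aestronglyMeasurable.mul hF.1.norm) (ae_of_all _ fun z => ?_)
    rw [Real.norm_of_nonneg (by positivity)]
    exact hle x z
  exact ⟨hF.1, hi, fun x => integral_mono (hi x) hF.norm (hle x)⟩

/-- The integral `∫ K(x, z) F(z) dz` solves the equation in the sense of distributions. -/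
theorem integral_test (h : ExpBounded |μ| C F) {φ : ℝ → ℂ} (hφ : ContDiff ℝ ∞ φ)
    (hc : HasCompactSupport φ) :
    ∫ x, (-(deriv φ x) + μ * φ x) * ∫ z, resKer μ x z * F z = ∫ z, φ z * F z := by
  have ha : Integrable fun x => -(deriv φ x) + μ * φ x := by
    have h1 : Continuous (deriv φ) := hφ.continuous_deriv (by simp)
    exact (h1.integrable_of_hasCompactSupport hc.deriv).neg.add
      ((hφ.continuous.integrable_of_hasCompactSupport hc).const_mul _)
  have h1 := integrable_mul_prod ha h.aestronglyMeasurable_prod h.integrable_resKer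
    h.integral_norm_resKer_le
  simp only [← integral_const_mul]
  rw [integral_integral_swap h1]
  congr 1
  funext z
  rw [← integral_resKer_mul_test (μ := μ) hφ hc z, ← integral_mul_const]
  congr 1
  funext x
  ring

end ExpBounded

/-- The solution of `-φ' + μ φ = ψ - e^{μ a} ψ(· - a)` with compact support. -/
theorem exists_test {μ : ℝ} {ψ : ℝ → ℂ} (hψ : ContDiff ℝ ∞ ψ) (hc : HasCompactSupport ψ) (a : ℝ) :
    ∃ φ : ℝ → ℂ, ContDiff ℝ ∞ φ ∧ HasCompactSupport φ ∧
      ∀ x, -(deriv φ x) + μ * φ x = ψ x - (Real.exp (μ * a) : ℝ) * ψ (x - a) := by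
  set p : ℝ → ℂ := fun t => ((Real.exp (-μ * (t - 0)) : ℝ) : ℂ) * ψ t with hp
  have hps : ContDiff ℝ ∞ p := (contDiff_cexp_ofReal_mul (-μ) 0).mul hψ
  set P : ℝ → ℂ := fun x => ∫ t in (0 : ℝ)..x, p t with hP
  have hPd : ∀ x, HasDerivAt P (p x) x := fun x =>
    intervalIntegral.integral_hasDerivAt_right (hps.continuous.intervalIntegrable _ _)
      (hps.continuous.stronglyMeasurableAtFilter _ _) hps.continuous.continuousAt
  have hPs : ContDiff ℝ ∞ P := by
    refine contDiff_infty_iff_deriv.2 ⟨fun x => (hPd x).differentiableAt, ?_⟩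
    rw [show deriv P = p from funext fun x => (hPd x).deriv]
    exact hps
  have hPs' : ContDiff ℝ ∞ fun x => P (x - a) := hPs.comp (by fun_prop)
  -- Since `P` is a primitive of `exp(-μt) ψ(t)`, which has compact support, the increment `P(x) -
  -- P(x - a)` vanishes for large `|x|`. Without the subtracted translate the solution need not have
  -- compact support.
  refine ⟨fun x => -(((Real.exp (μ * (x - 0)) : ℝ) : ℂ) * (P x - P (x - a))), ?_, ?_, ?_⟩
  · exact ((contDiff_cexp_ofReal_mul μ 0).mul (hPs.sub hPs')).neg
  · obtain ⟨R, hR⟩ := hc.isCompact.isBounded.subset_closedBall 0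
    have hz : ∀ t, R < |t| → p t = 0 := fun t ht => by
      have : ψ t = 0 := by
        by_contra hne
        have h1 := hR (subset_tsupport _ (Function.mem_support.2 hne))
        rw [mem_closedBall_zero_iff, Real.norm_eq_abs] at h1
        linarith
      simp [hp, this]
    refine HasCompactSupport.intro (isCompact_Icc (a := -(|R| + |a|)) (b := |R| + |a|))
      fun x hx => ?_
    have hx' : |R| + |a| < |x| := by
      by_contra hle
      exact hx (Set.mem_Icc.2 (abs_le.1 (not_lt.1 hle)))
    have e : P x - P (x - a) = 0 := by
      rw [hP]
      simp only
      rw [intervalIntegral.integral_interval_sub_left (hps.continuous.intervalIntegrable _ _)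
        (hps.continuous.intervalIntegrable _ _)]
      refine intervalIntegral.integral_zero_ae (ae_of_all _ fun t ht => hz t ?_)
      have ht' := Set.uIoc_subset_uIcc ht
      have h1 : |t - x| ≤ |a| := by
        have := Set.abs_sub_right_of_mem_uIcc ht'
        rwa [abs_sub_comm, sub_sub_cancel] at this
      have h2 := abs_sub_abs_le_abs_sub x t
      rw [abs_sub_comm] at h2
      have h3 := le_abs_self R
      linarith
    simp [e]
  · intro x
    have h1 : HasDerivAt (fun x => P (x - a)) (p (x - a)) x := (hPd (x - a)).comp_sub_const x a
    have h2 := ((hasDerivAt_ofReal_exp μ 0 x).mul ((hPd x).sub h1)).neg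
    have h3 : deriv (fun x => -(((Real.exp (μ * (x - 0)) : ℝ) : ℂ) * (P x - P (x - a)))) x = _ :=
      h2.deriv
    simp only [Pi.sub_apply] at h3
    rw [h3]
    have e1 : ((Real.exp (μ * (x - 0)) : ℝ) : ℂ) * p x = ψ x := by
      simp only [hp]
      rw [← mul_assoc, ← Complex.ofReal_mul, ← Real.exp_add]
      simp
    have e2 : ((Real.exp (μ * (x - 0)) : ℝ) : ℂ) * p (x - a) = (Real.exp (μ * a) : ℝ) * ψ (x - a) := by
      simp only [hp]
      rw [← mul_assoc, ← Complex.ofReal_mul, ← Real.exp_add]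
      congr 4
      ring
    linear_combination e1 - e2

/-- A weak solution of `g' + μg = 0` satisfies `∫ ψ g = exp(μa) ∫ ψ(· - a) g` for every `a`. The
translated integrals stay bounded, so letting `μa` tend to `-∞` gives zero. The boundedness
hypothesis excludes the exponential solutions. -/
theorem ae_eq_zero_of_integral_test {μ : ℝ} (hμ : μ ≠ 0) {g : ℝ → ℂ}
    (hg : ∀ ψ : ℝ → ℂ, Continuous ψ → HasCompactSupport ψ → Integrable fun x => ψ x * g x)
    (hb : ∀ ψ : ℝ → ℂ, Continuous ψ → HasCompactSupport ψ →
      ∃ C, ∀ a, ‖∫ x, ψ (x - a) * g x‖ ≤ C)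
    (h0 : ∀ φ : ℝ → ℂ, ContDiff ℝ ∞ φ → HasCompactSupport φ →
      ∫ x, (-(deriv φ x) + μ * φ x) * g x = 0) : g =ᵐ[volume] 0 := by
  have key : ∀ ψ : ℝ → ℂ, ContDiff ℝ ∞ ψ → HasCompactSupport ψ → ∫ x, ψ x * g x = 0 := by
    intro ψ hψ hc
    obtain ⟨C, hC⟩ := hb ψ hψ.continuous hc
    have h1 : ∀ a, ‖∫ x, ψ x * g x‖ ≤ Real.exp (μ * a) * C := by
      intro a
      obtain ⟨φ, hφ, hφc, he⟩ := exists_test (μ := μ) hψ hc a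
      have h2 := h0 φ hφ hφc
      simp only [he, sub_mul, mul_assoc] at h2
      have hc' : HasCompactSupport fun x => ψ (x - a) :=
        hc.comp_homeomorph (Homeomorph.subRight a)
      have hψ' : Continuous fun x => ψ (x - a) := hψ.continuous.comp (by fun_prop)
      rw [integral_sub (hg ψ hψ.continuous hc) ((hg _ hψ' hc').const_mul _),
        integral_const_mul, sub_eq_zero] at h2
      rw [h2, norm_mul, Complex.norm_real, Real.norm_eq_abs, Real.abs_exp]
      exact mul_le_mul_of_nonneg_left (hC a) (Real.exp_pos _).le
    have h2 : Tendsto (fun t : ℝ => Real.exp (-t) * C) atTop (𝓝 0) := by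
      simpa using (Real.tendsto_exp_neg_atTop_nhds_zero).mul_const C
    refine norm_le_zero_iff.1 (ge_of_tendsto' h2 fun t => ?_)
    have h3 := h1 (-t / μ)
    rwa [mul_div_cancel₀ _ hμ] at h3
  have hloc : LocallyIntegrable g := by
    refine (locallyIntegrable_iff).2 fun K hK => ?_
    -- A continuous cutoff equal to `1` on `K` deduces local integrability from integrability
    -- against continuous compactly supported functions.
    obtain ⟨f, hf1, -, hfc, -⟩ := exists_continuous_one_zero_of_isCompact hK isClosed_empty
      (Set.disjoint_empty K)
    have h1 := hg (fun x => (f x : ℂ)) (by fun_prop) (hfc.comp_left (g := ((↑) : ℝ → ℂ)) (by simp))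
    refine h1.integrableOn.congr_fun (fun x hx => ?_) hK.measurableSet
    simp [hf1 hx]
  refine ae_eq_zero_of_integral_contDiff_smul_eq_zero hloc fun ψ hψ hc => ?_
  simp only [Complex.real_smul]
  exact key (fun x => (ψ x : ℂ)) (Complex.ofRealCLM.contDiff.comp hψ)
    (hc.comp_left (g := ((↑) : ℝ → ℂ)) (by simp))

namespace ExpBounded

variable {μ C : ℝ} {F : ℝ → ℂ}

/-- The difference of the two candidates is a weak solution of the homogeneous equation. Its
translated averages are bounded: the `L²` part by Cauchy-Schwarz, the convolution part because it is
a bounded function. -/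
theorem ae_eq_integral (hμ : μ ≠ 0) (h : ExpBounded |μ| C F) {f : ℝ → ℂ} (hf : MemLp f 2)
    (he : ∀ φ : ℝ → ℂ, ContDiff ℝ ∞ φ → HasCompactSupport φ →
      ∫ x, (-(deriv φ x) + μ * φ x) * f x = ∫ x, φ x * F x) :
    f =ᵐ[volume] fun x => ∫ z, resKer μ x z * F z := by
  set f' : ℝ → ℂ := fun x => ∫ z, resKer μ x z * F z
  have hi : ∀ ψ : ℝ → ℂ, Continuous ψ → HasCompactSupport ψ → Integrable fun x => ψ x * f x :=
    fun ψ hψ hc => (hψ.memLp_of_hasCompactSupport (p := 2) hc).integrable_mul hf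
  have hi' : ∀ ψ : ℝ → ℂ, Continuous ψ → HasCompactSupport ψ → Integrable fun x => ψ x * f' x :=
    fun ψ hψ hc => (hψ.integrable_of_hasCompactSupport hc).mul_bdd
      h.aestronglyMeasurable_integral (ae_of_all _ h.norm_integral_le)
  have hz := ae_eq_zero_of_integral_test hμ (g := fun x => f x - f' x) ?_ ?_ ?_
  · filter_upwards [hz] with x hx
    exact sub_eq_zero.1 hx
  · intro ψ hψ hc
    simp only [mul_sub]
    exact (hi ψ hψ hc).sub (hi' ψ hψ hc)
  · intro ψ hψ hc
    have hψ2 := hψ.memLp_of_hasCompactSupport (p := 2) (μ := volume) hc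
    refine ⟨(eLpNorm ψ 2 volume).toReal * (eLpNorm f 2 volume).toReal + (∫ x, ‖ψ x‖) * C,
      fun a => ?_⟩
    have hca : HasCompactSupport fun x => ψ (x - a) := hc.comp_homeomorph (Homeomorph.subRight a)
    have hψa : Continuous fun x => ψ (x - a) := hψ.comp (by fun_prop)
    simp only [mul_sub]
    rw [integral_sub (hi _ hψa hca) (hi' _ hψa hca)]
    refine (norm_sub_le _ _).trans (add_le_add ?_ ?_)
    · refine (norm_integral_mul_le_two (hψa.memLp_of_hasCompactSupport hca) hf).trans
        (le_of_eq ?_)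
      have hmp : MeasurePreserving fun x : ℝ => x - a := measurePreserving_sub_right volume a
      have h1 := eLpNorm_comp_measurePreserving (p := 2) hψ2.1 hmp
      rw [← h1]
      rfl
    · have h1 : ∫ x, ‖ψ (x - a)‖ = ∫ x, ‖ψ x‖ := integral_sub_right_eq_self (fun x => ‖ψ x‖) a
      rw [← h1, ← integral_mul_const]
      refine norm_integral_le_of_norm_le
        ((hψa.integrable_of_hasCompactSupport hca).norm.mul_const C) (ae_of_all _ fun x => ?_)
      rw [norm_mul]
      exact mul_le_mul_of_nonneg_left (h.norm_integral_le x) (norm_nonneg _)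
  · intro φ hφ hc
    have hd : Continuous fun x => -(deriv φ x) + μ * φ x :=
      (hφ.continuous_deriv (by simp)).neg.add (continuous_const.mul hφ.continuous)
    have hdc : HasCompactSupport fun x => -(deriv φ x) + μ * φ x :=
      (hc.deriv.comp_left (g := fun z : ℂ => -z) neg_zero).add hc.mul_left
    simp only [mul_sub]
    rw [integral_sub (hi _ hd hdc) (hi' _ hd hdc), he φ hφ hc, h.integral_test hφ hc, sub_self]

end ExpBounded

end DNLSGreen

end

noncomputable section

namespace DNLSGreen

open Filter Topology

/-! ### The inverse of the Lax operator -/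

theorem memLp_integral_exp_mul_norm {c : ℝ} (hc : 0 < c) {h : ℝ → ℂ} (hh : MemLp h 2) :
    MemLp (fun x => ∫ y, Real.exp (-c * |x - y|) * ‖h y‖) 2 := by
  have hm : AEStronglyMeasurable (fun p : ℝ × ℝ => Real.exp (-c * |p.1 - p.2|) * ‖h p.2‖)
      (volume.prod volume) :=
    (by fun_prop : Continuous fun p : ℝ × ℝ => Real.exp (-c * |p.1 - p.2|)).aestronglyMeasurable.mul
      hh.1.norm.comp_snd
  refine ⟨hm.integral_prod_right', ?_⟩
  refine (ENNReal.pow_lt_top_iff.1 ?_).resolve_right two_ne_zero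
  rw [eLpNorm_two_sq]
  set E : ℝ → ℝ≥0∞ := fun z => ‖Real.exp (-c * |z|)‖ₑ
  have hE : AEMeasurable E := (by fun_prop : Continuous fun z : ℝ =>
    Real.exp (-c * |z|)).aestronglyMeasurable.enorm
  have hle : ∀ x, ‖∫ y, Real.exp (-c * |x - y|) * ‖h y‖‖ₑ ≤ ∫⁻ y, E y * ‖h (x - y)‖ₑ := by
    intro x
    refine (enorm_integral_le_lintegral_enorm _).trans (le_of_eq ?_)
    rw [lintegral_lconv_comm (f := E) (g := fun y => ‖h y‖ₑ)]
    congr 1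
    funext y
    rw [enorm_mul, enorm_norm, mul_comm]
  refine (lintegral_mono fun x => pow_le_pow_left' (hle x) 2).trans_lt
    ((lintegral_sq_lconv_le hE hh.1.enorm).trans_lt ?_)
  rw [← eLpNorm_two_sq]
  refine ENNReal.mul_lt_top ?_ (ENNReal.pow_lt_top hh.2)
  exact ENNReal.pow_lt_top (integrable_exp_neg_abs hc).2

/-- The integral operator with the kernel `neumannSum μ V`. -/
def neumannOp (μ : Fin 2 → ℝ) (V h : Fin 2 → ℝ → ℂ) (i : Fin 2) (x : ℝ) : ℂ :=
  ∑ j, ∫ y, neumannSum μ V x y i j * h j y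

namespace NeumannData

variable {Λ β : ℝ} {μ : Fin 2 → ℝ} {V h : Fin 2 → ℝ → ℂ} {w : ℝ → ℝ}

theorem half_pos (d : NeumannData Λ β μ V w) : 0 < Λ / 2 := by
  have := d.pos
  linarith

theorem norm_neumannSum_mul_le (d : NeumannData Λ β μ V w) (hβ : β ≤ 1 / 2) (x y : ℝ)
    (i j : Fin 2) :
    ‖neumannSum μ V x y i j * h j y‖ ≤ 2 * (Real.exp (-(Λ / 2) * |x - y|) * ‖h j y‖) := by
  rw [norm_mul, ← mul_assoc]
  exact mul_le_mul_of_nonneg_right (d.norm_neumannSum_le hβ x y i j) (norm_nonneg _)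

theorem aestronglyMeasurable_neumannSum_mul (d : NeumannData Λ β μ V w) (hβ : β ≤ 1 / 2)
    (hh : ∀ j, MemLp (h j) 2) (i j : Fin 2) :
    AEStronglyMeasurable (fun p : ℝ × ℝ => neumannSum μ V p.1 p.2 i j * h j p.2)
      (volume.prod volume) :=
  (d.measurable_neumannSum hβ i j).aestronglyMeasurable.mul (hh j).1.comp_snd

theorem integrable_neumannSum_mul (d : NeumannData Λ β μ V w) (hβ : β ≤ 1 / 2)
    (hh : ∀ j, MemLp (h j) 2) (x : ℝ) (i j : Fin 2) :
    Integrable fun y => neumannSum μ V x y i j * h j y := by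
  refine ((integrable_exp_mul_norm d.half_pos (hh j) x).const_mul 2).mono' ?_
    (ae_of_all _ fun y => d.norm_neumannSum_mul_le hβ x y i j)
  exact ((d.measurable_neumannSum hβ i j).comp
    (measurable_const.prodMk measurable_id)).aestronglyMeasurable.mul (hh j).1

theorem integral_norm_neumannSum_mul_le (d : NeumannData Λ β μ V w) (hβ : β ≤ 1 / 2)
    (hh : ∀ j, MemLp (h j) 2) (x : ℝ) (i j : Fin 2) :
    ∫ y, ‖neumannSum μ V x y i j * h j y‖ ≤
      2 * ∫ y, Real.exp (-(Λ / 2) * |x - y|) * ‖h j y‖ := by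
  rw [← integral_const_mul]
  exact integral_mono_of_nonneg (ae_of_all _ fun _ => norm_nonneg _)
    ((integrable_exp_mul_norm d.half_pos (hh j) x).const_mul 2)
    (ae_of_all _ fun y => d.norm_neumannSum_mul_le hβ x y i j)

theorem memLp_neumannOp (d : NeumannData Λ β μ V w) (hβ : β ≤ 1 / 2)
    (hh : ∀ j, MemLp (h j) 2) (i : Fin 2) : MemLp (neumannOp μ V h i) 2 := by
  refine memLp_finsetSum _ fun j _ => ?_
  refine ((memLp_integral_exp_mul_norm d.half_pos (hh j)).const_mul 2).mono
    (d.aestronglyMeasurable_neumannSum_mul hβ hh i j).integral_prod_right' (ae_of_all _ fun x => ?_)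
  exact ((norm_integral_le_integral_norm _).trans
    (d.integral_norm_neumannSum_mul_le hβ hh x i j)).trans (le_abs_self _)

/-- The integral equation of the kernel is integrated against `h`. Fubini applies because `R₀V` is
integrable in `z` and the inner absolute integrals are bounded uniformly. -/
theorem neumannOp_eq (d : NeumannData Λ β μ V w) (hβ : β ≤ 1 / 2)
    (hh : ∀ j, MemLp (h j) 2) (i : Fin 2) (x : ℝ) :
    neumannOp μ V h i x = (∫ z, resKer (μ i) x z * h i z) +
      ∫ z, resKer (μ i) x z * V i z * neumannOp μ V h (i + 1) z := by
  have ha : Integrable fun z => resKer (μ i) x z * V i z :=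
    (d.integrable x).mono' (d.measurable_mul i x).aestronglyMeasurable
      (ae_of_all _ fun z => d.norm_mul_le' i x z)
  have hb : ∀ j, ∃ C, ∀ z, ∫ y, ‖neumannSum μ V z y (i + 1) j * h j y‖ ≤ C := fun j =>
    ⟨_, fun z => (d.integral_norm_neumannSum_mul_le hβ hh z (i + 1) j).trans
      (mul_le_mul_of_nonneg_left (integral_exp_mul_norm_le d.half_pos (hh j) z) two_pos.le)⟩
  have hp : ∀ j, Integrable (fun p : ℝ × ℝ => resKer (μ i) x p.1 * V i p.1 *
      (neumannSum μ V p.1 p.2 (i + 1) j * h j p.2)) (volume.prod volume) := fun j => by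
    obtain ⟨C, hC⟩ := hb j
    exact integrable_mul_prod ha (d.aestronglyMeasurable_neumannSum_mul hβ hh (i + 1) j)
      (fun z => d.integrable_neumannSum_mul hβ hh z (i + 1) j) hC
  have h0 : Integrable fun y => resKer (μ i) x y * h i y :=
    (d.abs_eq i ▸ ExpBounded.of_memLp d.pos (hh i) : ExpBounded |μ i| _ _).integrable_resKer x
  have h1 : ∀ j, ∫ y, neumannSum μ V x y i j * h j y =
      (if i = j then ∫ y, resKer (μ i) x y * h i y else 0) +
        ∫ z, resKer (μ i) x z * V i z * ∫ y, neumannSum μ V z y (i + 1) j * h j y := by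
    intro j
    have e1 : ∫ z, resKer (μ i) x z * V i z * ∫ y, neumannSum μ V z y (i + 1) j * h j y =
        ∫ y, ∫ z, resKer (μ i) x z * V i z * (neumannSum μ V z y (i + 1) j * h j y) := by
      rw [← integral_integral_swap (hp j)]
      simp only [integral_const_mul]
    have e2 : ∀ y, neumannSum μ V x y i j * h j y = (if i = j then resKer (μ i) x y * h i y else 0) +
        ∫ z, resKer (μ i) x z * V i z * (neumannSum μ V z y (i + 1) j * h j y) := by
      intro y
      rw [d.neumannSum_eq hβ x y i j, add_mul, ← integral_mul_const]
      congr 1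
      · split_ifs with hij
        · rw [hij]
        · rw [zero_mul]
      · simp only [mul_assoc]
    rw [e1]
    simp only [e2]
    rw [integral_add]
    · congr 1
      split_ifs <;> simp
    · split_ifs
      · exact h0
      · exact integrable_zero _ _ _
    · exact (hp j).integral_prod_right
  have h2 : ∀ j, Integrable fun z =>
      resKer (μ i) x z * V i z * ∫ y, neumannSum μ V z y (i + 1) j * h j y := fun j => by
    have := (hp j).integral_prod_left
    simpa only [integral_const_mul] using this
  unfold neumannOp
  simp only [h1, Finset.mul_sum]
  rw [integral_finsetSum _ fun j _ => h2 j, Finset.sum_add_distrib]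
  simp

end NeumannData

/-- The diagonal entries of the free operator, without the derivative. -/
def diagCoeff (κ : ℂ) : Fin 2 → ℝ := ![lam κ, -lam κ]

/-- The off-diagonal entries of the potential matrix. -/
def offDiag (κ : ℂ) (q : ℝ → ℂ) : Fin 2 → ℝ → ℂ :=
  ![fun z => κ * q z, fun z => κ * (-(starRingEnd ℂ) (q z))]

theorem abs_diagCoeff (κ : ℂ) (i : Fin 2) : |diagCoeff κ i| = |lam κ| := by
  fin_cases i <;> simp [diagCoeff]

theorem norm_offDiag (κ : ℂ) (q : ℝ → ℂ) (i : Fin 2) (z : ℝ) :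
    ‖offDiag κ q i z‖ = ‖κ‖ * ‖q z‖ := by
  fin_cases i <;> simp [offDiag]

theorem freeGreen_apply {κ : ℂ} (hκ : lam κ ≠ 0) (x y : ℝ) (i j : Fin 2) :
    freeGreen κ x y i j = if i = j then resKer (diagCoeff κ i) x y else 0 := by
  have e1 : ∀ h : y < x, |x - y| = x - y := fun h => abs_of_pos (sub_pos.2 h)
  have e2 : ∀ h : x < y, |x - y| = -(x - y) := fun h => abs_of_neg (sub_neg.2 h)
  rcases hκ.lt_or_gt with h | h
  · have h1 : ¬ 0 < lam κ := h.not_gt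
    have h2 : 0 < -lam κ := by linarith
    rcases lt_trichotomy x y with hxy | hxy | hxy
    · have h3 : ¬ y < x := hxy.not_gt
      fin_cases i <;> fin_cases j <;>
        simp [freeGreen, resKer, diagCoeff, h1, h2, h3, hxy, e2]
      congr 1
      ring
    · subst hxy
      fin_cases i <;> fin_cases j <;> simp [freeGreen, resKer, diagCoeff, h1, h2]
    · have h3 : ¬ x < y := hxy.not_gt
      fin_cases i <;> fin_cases j <;>
        simp [freeGreen, resKer, diagCoeff, h1, h2, h3, hxy, e1]
  · have h1 : ¬ 0 < -lam κ := by linarith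
    rcases lt_trichotomy x y with hxy | hxy | hxy
    · have h3 : ¬ y < x := hxy.not_gt
      fin_cases i <;> fin_cases j <;>
        simp [freeGreen, resKer, diagCoeff, h, h1, h3, hxy, e2]
      congr 1
      ring
    · subst hxy
      fin_cases i <;> fin_cases j <;> simp [freeGreen, resKer, diagCoeff, h, h1]
    · have h3 : ¬ x < y := hxy.not_gt
      fin_cases i <;> fin_cases j <;>
        simp [freeGreen, resKer, diagCoeff, h, h1, h3, hxy, e1]

theorem greenTerm_apply {κ : ℂ} (hκ : lam κ ≠ 0) (q : ℝ → ℂ) (n : ℕ) (x y : ℝ) (i j : Fin 2) :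
    greenTerm κ q n x y i j = neumannTerm (diagCoeff κ) (offDiag κ q) n x y i j := by
  induction n generalizing x i with
  | zero => exact freeGreen_apply hκ x y i j
  | succ n ih =>
    simp only [greenTerm, neumannTerm, Matrix.of_apply, ← ih]
    congr 1
    funext z
    simp only [Matrix.mul_apply, Fin.sum_univ_two, freeGreen_apply hκ]
    fin_cases i <;> simp [potMatrix, offDiag]

/-- By Cauchy-Schwarz the exponential of rate `k²/2` contributes `√(2/k²)`, which the factor `k` in
the potential cancels. The bound `√2 ‖q‖ ≤ 2 ‖q‖` is therefore independent of `κ`. -/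
theorem neumannData_offDiag {κ : ℂ} (h1 : 0 < ‖κ‖) (h2 : |lam κ| = ‖κ‖ ^ 2) {q : ℝ → ℂ}
    (hm : Measurable q) (hq : MemLp q 2) :
    NeumannData (‖κ‖ ^ 2) (2 * (eLpNorm q 2 volume).toReal) (diagCoeff κ) (offDiag κ q)
      fun z => ‖κ‖ * ‖q z‖ where
  pos := by positivity
  abs_eq i := by rw [abs_diagCoeff, h2]
  measurable i := by
    fin_cases i
    · exact hm.const_mul κ
    · exact ((Complex.continuous_conj.measurable.comp hm).neg).const_mul κ
  norm_le i z := (norm_offDiag κ q i z).le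
  integrable x := by
    refine ((integrable_exp_mul_norm (by positivity : 0 < ‖κ‖ ^ 2 / 2) hq x).const_mul ‖κ‖).congr
      (ae_of_all _ fun z => ?_)
    ring
  integral_le x := by
    have h3 := integral_exp_mul_norm_le (by positivity : 0 < ‖κ‖ ^ 2 / 2) hq x
    have e : ∀ z, Real.exp (-(‖κ‖ ^ 2 / 2) * |x - z|) * (‖κ‖ * ‖q z‖) =
        ‖κ‖ * (Real.exp (-(‖κ‖ ^ 2 / 2) * |x - z|) * ‖q z‖) := fun z => by ring
    simp only [e]
    rw [integral_const_mul]
    refine (mul_le_mul_of_nonneg_left h3 h1.le).trans ?_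
    rw [← mul_assoc]
    refine mul_le_mul_of_nonneg_right ?_ ENNReal.toReal_nonneg
    rw [show 1 / (‖κ‖ ^ 2 / 2) = 2 / ‖κ‖ ^ 2 by field_simp, Real.sqrt_div two_pos.le,
      Real.sqrt_sq h1.le, mul_div_cancel₀ _ h1.ne', Real.sqrt_le_left two_pos.le]
    norm_num

theorem memLp_offDiag (κ : ℂ) {q : ℝ → ℂ} (hq : MemLp q 2) (i : Fin 2) :
    MemLp (offDiag κ q i) 2 := by
  fin_cases i
  · exact hq.const_mul κ
  · exact (hq.star.neg).const_mul κ

/-- The weak system decouples into two scalar equations for `∂ + μᵢ`, with the coupling moved to the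
source. That term is a product of two `L²` functions, so it is only in `L¹`, and all integrals have
to be split with this in mind. -/
theorem laxEq_iff {κ : ℂ} (hκ : (lam κ : ℂ) = Complex.I * κ ^ 2) {q : ℝ → ℂ} (hq : MemLp q 2)
    {f h : Fin 2 → ℝ → ℂ} (hf : ∀ i, MemLp (f i) 2) (hh : ∀ i, MemLp (h i) 2) :
    LaxEq κ q f h ↔ ∀ i, ∀ φ : ℝ → ℂ, ContDiff ℝ ∞ φ → HasCompactSupport φ →
      ∫ x, (-(deriv φ x) + diagCoeff κ i * φ x) * f i x =
        ∫ x, φ x * (h i x + offDiag κ q i x * f (i + 1) x) := by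
  have key : ∀ i, ∀ φ : ℝ → ℂ, ContDiff ℝ ∞ φ → HasCompactSupport φ →
      (∫ x, (-(deriv φ x) + diagCoeff κ i * φ x) * f i x =
        ∫ x, φ x * (h i x + offDiag κ q i x * f (i + 1) x) ↔
      ∫ x, ((-(deriv φ x) + diagCoeff κ i * φ x) * f i x -
        φ x * (offDiag κ q i x * f (i + 1) x)) = ∫ x, φ x * h i x) := by
    intro i φ hφ hc
    have hφ2 := hφ.continuous.memLp_of_hasCompactSupport (p := 2) (μ := volume) hc
    have hd : Continuous fun x => -(deriv φ x) + diagCoeff κ i * φ x :=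
      (hφ.continuous_deriv (by simp)).neg.add (continuous_const.mul hφ.continuous)
    have hdc : HasCompactSupport fun x => -(deriv φ x) + diagCoeff κ i * φ x :=
      (hc.deriv.comp_left (g := fun z : ℂ => -z) neg_zero).add hc.mul_left
    have i1 : Integrable fun x => (-(deriv φ x) + diagCoeff κ i * φ x) * f i x :=
      (hd.memLp_of_hasCompactSupport (p := 2) hdc).integrable_mul (hf i)
    have i2 : Integrable fun x => offDiag κ q i x * f (i + 1) x :=
      (memLp_offDiag κ hq i).integrable_mul (hf (i + 1))
    obtain ⟨M, hM⟩ := hφ.continuous.bounded_above_of_compact_support hc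
    have i3 : Integrable fun x => φ x * (offDiag κ q i x * f (i + 1) x) :=
      i2.bdd_mul hφ.continuous.aestronglyMeasurable (ae_of_all _ hM)
    have i4 : Integrable fun x => φ x * h i x := hφ2.integrable_mul (hh i)
    simp only [mul_add]
    rw [integral_sub i1 i3, integral_add i4 i3, sub_eq_iff_eq_add]
  rw [LaxEq, Fin.forall_fin_two]
  constructor
  · intro H
    refine ⟨fun φ hφ hc => (key 0 φ hφ hc).2 ?_, fun φ hφ hc => (key 1 φ hφ hc).2 ?_⟩
    · rw [← (H φ hφ hc).1]
      congr 1
      funext x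
      simp [diagCoeff, offDiag, hκ]
      ring
    · rw [← (H φ hφ hc).2]
      congr 1
      funext x
      simp [diagCoeff, offDiag, hκ]
      ring
  · intro H φ hφ hc
    constructor
    · rw [← (key 0 φ hφ hc).1 (H.1 φ hφ hc)]
      congr 1
      funext x
      simp [diagCoeff, offDiag, hκ]
      ring
    · rw [← (key 1 φ hφ hc).1 (H.2 φ hφ hc)]
      congr 1
      funext x
      simp [diagCoeff, offDiag, hκ]
      ring

end DNLSGreen

end

noncomputable section

namespace DNLSGreen

open Filter Topology

/-! ### Existence and uniqueness of the Green's function -/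

/-- The difference of two such kernels is continuous, and applied to the indicator of an interval it
gives zero for almost every `x`, hence for every `x`. Differentiating with respect to the endpoint
of the interval gives the pointwise identity. -/
theorem IsGreen.eq {κ : ℂ} {q : ℝ → ℂ} {G G' : ℝ → ℝ → Matrix (Fin 2) (Fin 2) ℂ}
    (hG : IsGreen κ q G) (hG' : IsGreen κ q G') : G = G' := by
  set D : ℝ × ℝ → Matrix (Fin 2) (Fin 2) ℂ := fun p => G p.1 p.2 - G' p.1 p.2 with hD
  have hDc : Continuous D := by
    have := hG.continuous_sub.sub hG'.continuous_sub
    refine this.congr fun p => ?_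
    simp [hD]
  have hDij : ∀ i j, Continuous fun p => D p i j := fun i j =>
    (continuous_apply_apply i j).comp hDc
  have h0 : ∀ i j a b x, ∫ y in a..b, D (x, y) i j = 0 := by
    intro i j a b
    have hcont : Continuous fun x => ∫ y in a..b, D (x, y) i j :=
      intervalIntegral.continuous_parametric_intervalIntegral_of_continuous' (hDij i j) a b
    have hab : ∀ a b : ℝ, a ≤ b → ∀ᵐ x : ℝ, ∫ y in a..b, D (x, y) i j = 0 := by
      intro a b hle
      set h : Fin 2 → ℝ → ℂ := fun j' =>
        if j' = j then (Set.Ioc a b).indicator fun _ => (1 : ℂ) else 0 with hh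
      have hm : ∀ j', MemLp (h j') 2 volume := by
        intro j'
        simp only [hh]
        split_ifs
        · exact memLp_indicator_const 2 measurableSet_Ioc 1 (Or.inr (by simp))
        · exact MemLp.zero
      have e1 := (hG'.inverse _ h (hG.memLp h hm) hm).1
        ((hG.inverse _ h (hG.memLp h hm) hm).2 fun i => Filter.EventuallyEq.rfl) i
      filter_upwards [e1, hG.integrable h hm, hG'.integrable h hm] with x hx hi hi'
      have e2 : ∑ j', ∫ y, D (x, y) i j' * h j' y = 0 := by
        rw [← sub_eq_zero.2 hx, kernelOp, kernelOp, ← Finset.sum_sub_distrib]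
        refine Finset.sum_congr rfl fun j' _ => ?_
        rw [← integral_sub (hi i j') (hi' i j')]
        simp only [hD, Matrix.sub_apply, sub_mul]
      rw [Finset.sum_eq_single j (fun j' _ hne => by simp [hh, hne]) (by simp)] at e2
      rw [intervalIntegral.integral_of_le hle, ← integral_indicator measurableSet_Ioc, ← e2]
      congr 1
      funext y
      by_cases hy : y ∈ Set.Ioc a b <;> simp [hh, hy]
    have hae : (fun x => ∫ y in a..b, D (x, y) i j) =ᵐ[volume] fun _ => 0 := by
      rcases le_total a b with hle | hle
      · exact hab a b hle
      · filter_upwards [hab b a hle] with x hx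
        rw [intervalIntegral.integral_symm, hx, neg_zero]
    exact fun x => congrFun ((hcont.ae_eq_iff_eq volume continuous_const).1 hae) x
  funext x y
  ext i j
  have hc : Continuous fun y => D (x, y) i j := (hDij i j).comp (by fun_prop)
  have h1 := intervalIntegral.integral_hasDerivAt_right (hc.intervalIntegrable 0 y)
    (hc.stronglyMeasurableAtFilter _ _) hc.continuousAt
  have h2 : HasDerivAt (fun u => ∫ y in (0 : ℝ)..u, D (x, y) i j) 0 y := by
    rw [show (fun u => ∫ y in (0 : ℝ)..u, D (x, y) i j) = fun _ => 0 from
      funext fun u => h0 i j 0 u x]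
    exact hasDerivAt_const y 0
  exact sub_eq_zero.1 (h1.unique h2)

/-- The Neumann series as a matrix kernel. -/
def neumannGreen (κ : ℂ) (q : ℝ → ℂ) (x y : ℝ) : Matrix (Fin 2) (Fin 2) ℂ :=
  Matrix.of fun i j => neumannSum (diagCoeff κ) (offDiag κ q) x y i j

theorem expBounded_source {κ : ℂ} (h1 : 0 < |lam κ|) {q : ℝ → ℂ} (hq : MemLp q 2)
    {f h : Fin 2 → ℝ → ℂ} (hf : ∀ i, MemLp (f i) 2) (hh : ∀ i, MemLp (h i) 2) (i : Fin 2) :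
    ∃ C, ExpBounded |diagCoeff κ i| C fun x => h i x + offDiag κ q i x * f (i + 1) x := by
  rw [abs_diagCoeff]
  exact ⟨_, (ExpBounded.of_memLp h1 (hh i)).add
    (ExpBounded.of_integrable h1 ((memLp_offDiag κ hq i).integrable_mul (hf (i + 1))))⟩

/-- The potential is small enough for the Neumann series. -/
structure SmallPot (κ : ℂ) (q : ℝ → ℂ) : Prop where
  lam_eq : (lam κ : ℂ) = Complex.I * κ ^ 2
  pos : 0 < ‖κ‖
  abs_lam : |lam κ| = ‖κ‖ ^ 2
  measurable : Measurable q
  memLp : MemLp q 2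
  small : 2 * (eLpNorm q 2 volume).toReal ≤ 1 / 2

namespace SmallPot

variable {κ : ℂ} {q : ℝ → ℂ}

theorem abs_lam_pos (h : SmallPot κ q) : 0 < |lam κ| := by
  rw [h.abs_lam]
  have := h.pos
  positivity

theorem lam_ne (h : SmallPot κ q) : lam κ ≠ 0 := abs_pos.1 h.abs_lam_pos

theorem data (h : SmallPot κ q) :
    NeumannData (‖κ‖ ^ 2) (2 * (eLpNorm q 2 volume).toReal) (diagCoeff κ) (offDiag κ q)
      fun z => ‖κ‖ * ‖q z‖ := neumannData_offDiag h.pos h.abs_lam h.measurable h.memLp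

theorem diagCoeff_ne (h : SmallPot κ q) (i : Fin 2) : diagCoeff κ i ≠ 0 := by
  rw [← abs_pos, abs_diagCoeff]
  exact h.abs_lam_pos

/-- The uniqueness statement concerns bounded functions, while `d` is only in `L²`. One application
of the equation repairs this: the product of the potential and `d` is in `L¹`, so the right side is
bounded and measurable and still solves the equation. -/
theorem ae_eq_zero (h : SmallPot κ q) {d : Fin 2 → ℝ → ℂ} (hd : ∀ i, MemLp (d i) 2)
    (he : ∀ i, d i =ᵐ[volume] fun x =>
      ∫ z, resKer (diagCoeff κ i) x z * (offDiag κ q i z * d (i + 1) z)) (i : Fin 2) :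
    d i =ᵐ[volume] 0 := by
  set d' : Fin 2 → ℝ → ℂ := fun i x =>
    ∫ z, resKer (diagCoeff κ i) x z * (offDiag κ q i z * d (i + 1) z) with hd'
  have hE : ∀ i, ExpBounded |diagCoeff κ i| (∫ z, ‖offDiag κ q i z * d (i + 1) z‖)
      fun z => offDiag κ q i z * d (i + 1) z := fun i => by
    rw [abs_diagCoeff]
    exact ExpBounded.of_integrable h.abs_lam_pos
      ((memLp_offDiag κ h.memLp i).integrable_mul (hd (i + 1)))
  have hfix : ∀ i x, d' i x =
      0 + ∫ z, resKer (diagCoeff κ i) x z * offDiag κ q i z * d' (i + 1) z := by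
    intro i x
    rw [zero_add]
    refine integral_congr_ae ?_
    filter_upwards [he (i + 1)] with z hz
    rw [hz, mul_assoc]
  have hmeas : ∀ i, Measurable (d' i) := by
    intro i
    have hm : StronglyMeasurable (d' i) := by
      have e : d' i = fun x =>
          ∫ z, resKer (diagCoeff κ i) x z * (offDiag κ q i z * ((hd (i + 1)).1.mk _ z)) := by
        funext x
        refine integral_congr_ae ?_
        filter_upwards [(hd (i + 1)).1.ae_eq_mk] with z hz
        rw [← hz]
      rw [e]
      refine StronglyMeasurable.integral_prod_right' (f := fun p : ℝ × ℝ =>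
        resKer (diagCoeff κ i) p.1 p.2 * (offDiag κ q i p.2 * ((hd (i + 1)).1.mk _ p.2))) ?_
      exact (measurable_resKer _).stronglyMeasurable.mul
        (((h.data.measurable i).comp measurable_snd).stronglyMeasurable.mul
          ((hd (i + 1)).1.stronglyMeasurable_mk.comp_measurable measurable_snd))
    exact hm.measurable
  have hb : ∀ i x, ‖d' i x‖ ≤ ∑ i, ∫ z, ‖offDiag κ q i z * d (i + 1) z‖ := fun i x =>
    ((hE i).norm_integral_le x).trans (Finset.single_le_sum
      (f := fun i => ∫ z, ‖offDiag κ q i z * d (i + 1) z‖)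
      (fun _ _ => integral_nonneg fun _ => norm_nonneg _) (Finset.mem_univ i))
  have hz := h.data.eq_of_integral_eq h.small (d := fun _ _ => 0) (f := d') (f' := fun _ _ => 0)
    hmeas (fun _ => measurable_const) hb (fun i x => by
      rw [norm_zero]
      exact (norm_nonneg _).trans (hb i x)) hfix
    (fun i x => by simp)
  filter_upwards [he i] with x hx
  rw [hx]
  exact congrFun (congrFun hz i) x

/-- The equation `L f = h` is equivalent to `f = R₀(h + V f)`. The Neumann operator satisfies this
identity, and two `L²` solutions differ by a solution of the homogeneous integral equation. -/
theorem isGreen (h : SmallPot κ q) : IsGreen κ q (neumannGreen κ q) where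
  continuous_sub := by
    refine continuous_matrix fun i j => ?_
    refine (h.data.continuous_neumannSum_sub h.small i j).congr fun p => ?_
    rw [Matrix.sub_apply, freeGreen_apply h.lam_ne]
    rfl
  integrable hh hm := ae_of_all _ fun x i j => h.data.integrable_neumannSum_mul h.small hm x i j
  memLp hh hm i := h.data.memLp_neumannOp h.small hm i
  inverse f hh hf hm := by
    have hop : ∀ i, MemLp (kernelOp (neumannGreen κ q) hh i) 2 :=
      fun i => h.data.memLp_neumannOp h.small hm i
    have hopeq : ∀ i x, kernelOp (neumannGreen κ q) hh i x =
        ∫ z, resKer (diagCoeff κ i) x z *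
          (hh i z + offDiag κ q i z * kernelOp (neumannGreen κ q) hh (i + 1) z) := by
      intro i x
      have e1 : Integrable fun z => resKer (diagCoeff κ i) x z * hh i z := by
        have := ExpBounded.of_memLp h.abs_lam_pos (hm i)
        rw [← abs_diagCoeff κ i] at this
        exact this.integrable_resKer x
      have e2 : Integrable fun z => resKer (diagCoeff κ i) x z *
          (offDiag κ q i z * kernelOp (neumannGreen κ q) hh (i + 1) z) := by
        have := ExpBounded.of_integrable h.abs_lam_pos
          ((memLp_offDiag κ h.memLp i).integrable_mul (hop (i + 1)))
        rw [← abs_diagCoeff κ i] at this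
        exact this.integrable_resKer x
      simp only [mul_add]
      rw [integral_add e1 e2]
      refine (h.data.neumannOp_eq h.small hm i x).trans ?_
      simp only [mul_assoc]
      rfl
    rw [laxEq_iff h.lam_eq h.memLp hf hm]
    constructor
    · intro H
      have hfe : ∀ i, f i =ᵐ[volume] fun x => ∫ z, resKer (diagCoeff κ i) x z *
          (hh i z + offDiag κ q i z * f (i + 1) z) := by
        intro i
        obtain ⟨C, hC⟩ := expBounded_source h.abs_lam_pos h.memLp hf hm i
        exact hC.ae_eq_integral (h.diagCoeff_ne i) (hf i) (H i)
      have hz := h.ae_eq_zero (d := fun i x => f i x - kernelOp (neumannGreen κ q) hh i x)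
        (fun i => (hf i).sub (hop i)) fun i => by
          obtain ⟨C, hC⟩ := expBounded_source h.abs_lam_pos h.memLp hf hm i
          obtain ⟨C', hC'⟩ := expBounded_source h.abs_lam_pos h.memLp hop hm i
          filter_upwards [hfe i] with x hx
          rw [hx, hopeq i x, ← integral_sub (hC.integrable_resKer x) (hC'.integrable_resKer x)]
          congr 1
          funext z
          ring
      intro i
      filter_upwards [hz i] with x hx
      exact sub_eq_zero.1 hx
    · intro H i φ hφ hc
      obtain ⟨C, hC⟩ := expBounded_source h.abs_lam_pos h.memLp hf hm i
      rw [← hC.integral_test hφ hc]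
      refine integral_congr_ae ?_
      filter_upwards [H i] with x hx
      rw [hx, hopeq i x]
      congr 1
      refine integral_congr_ae ?_
      filter_upwards [H (i + 1)] with z hz
      rw [hz]

theorem existsUnique_isGreen (h : SmallPot κ q) : ∃! G, IsGreen κ q G :=
  ⟨_, h.isGreen, fun _ hG => hG.eq h.isGreen⟩

theorem green_eq (h : SmallPot κ q) : green κ q = neumannGreen κ q := by
  have hex : ∃ G, IsGreen κ q G := ⟨_, h.isGreen⟩
  rw [green, dif_pos hex]
  exact hex.choose_spec.eq h.isGreen

theorem g12_eq (h : SmallPot κ q) (x : ℝ) :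
    g12 κ q x = sgn κ * neumannSum (diagCoeff κ) (offDiag κ q) x x 0 1 := by
  rw [g12, h.green_eq]
  rfl

theorem g21_eq (h : SmallPot κ q) (x : ℝ) :
    g21 κ q x = sgn κ * neumannSum (diagCoeff κ) (offDiag κ q) x x 1 0 := by
  rw [g21, h.green_eq]
  rfl

theorem g12Term_eq (h : SmallPot κ q) (n : ℕ) (x : ℝ) :
    g12Term κ q n x = sgn κ * neumannTerm (diagCoeff κ) (offDiag κ q) n x x 0 1 := by
  rw [g12Term, greenTerm_apply h.lam_ne]

theorem g21Term_eq (h : SmallPot κ q) (n : ℕ) (x : ℝ) :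
    g21Term κ q n x = sgn κ * neumannTerm (diagCoeff κ) (offDiag κ q) n x x 1 0 := by
  rw [g21Term, greenTerm_apply h.lam_ne]

theorem g12Term_even (h : SmallPot κ q) {n : ℕ} (hn : Even n) (x : ℝ) : g12Term κ q n x = 0 := by
  rw [h.g12Term_eq, neumannTerm_eq_zero n x x (fun _ => by decide) fun h => absurd hn h, mul_zero]

theorem g21Term_even (h : SmallPot κ q) {n : ℕ} (hn : Even n) (x : ℝ) : g21Term κ q n x = 0 := by
  rw [h.g21Term_eq, neumannTerm_eq_zero n x x (fun _ => by decide) fun h => absurd hn h, mul_zero]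

theorem hasSum_g12Term (h : SmallPot κ q) (x : ℝ) :
    HasSum (fun n => g12Term κ q (n + 1) x) (g12 κ q x) := by
  have h1 := (h.data.hasSum_neumannTerm_succ h.small x x 0 1).mul_left (sgn κ)
  rw [neumannTerm_zero, if_neg (by decide), sub_zero, ← h.g12_eq] at h1
  simpa only [h.g12Term_eq] using h1

theorem hasSum_g21Term (h : SmallPot κ q) (x : ℝ) :
    HasSum (fun n => g21Term κ q (n + 1) x) (g21 κ q x) := by
  have h1 := (h.data.hasSum_neumannTerm_succ h.small x x 1 0).mul_left (sgn κ)
  rw [neumannTerm_zero, if_neg (by decide), sub_zero, ← h.g21_eq] at h1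
  simpa only [h.g21Term_eq] using h1

theorem g12Tail_three (h : SmallPot κ q) (x : ℝ) :
    g12Tail κ q 3 x = g12 κ q x - g12Term κ q 1 x := by
  -- The series is indexed from degree one, so degrees one and two are removed; the latter vanishes
  -- by parity.
  have h1 := (hasSum_nat_add_iff' 2).2 (h.hasSum_g12Term x)
  rw [Finset.sum_range_succ, Finset.sum_range_one, zero_add, h.g12Term_even (n := 1 + 1) (by decide), add_zero] at h1
  rw [g12Tail, ← h1.tsum_eq]
  congr 1
  funext n
  congr 1
  ring

theorem g21Tail_three (h : SmallPot κ q) (x : ℝ) :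
    g21Tail κ q 3 x = g21 κ q x - g21Term κ q 1 x := by
  have h1 := (hasSum_nat_add_iff' 2).2 (h.hasSum_g21Term x)
  rw [Finset.sum_range_succ, Finset.sum_range_one, zero_add, h.g21Term_even (n := 1 + 1) (by decide), add_zero] at h1
  rw [g21Tail, ← h1.tsum_eq]
  congr 1
  funext n
  congr 1
  ring

end SmallPot

end DNLSGreen

end

noncomputable section

namespace DNLSGreen

open Filter Topology

/-! ### Piecewise solutions of the scalar equation -/

theorem resKer_neg {Λ : ℝ} (hΛ : 0 < Λ) (x z : ℝ) : resKer (-Λ) x z = -resKer Λ (-x) (-z) := by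
  have h : ¬ 0 < -Λ := by linarith
  simp only [resKer, hΛ, h, if_true, if_false, neg_lt_neg_iff]
  split_ifs
  · push_cast
    congr 2
    ring
  · simp

/-- Variation of constants for a function that solves `u' = -Λ u + F` on both sides of `y`. -/
theorem eq_integral_of_piecewise {Λ : ℝ} (hΛ : 0 < Λ) {y C : ℝ} {u₁ u₂ F₁ F₂ F : ℝ → ℂ}
    (h₁ : ∀ x, HasDerivAt u₁ (-Λ * u₁ x + F₁ x) x) (h₂ : ∀ x, HasDerivAt u₂ (-Λ * u₂ x + F₂ x) x)
    (hF₁ : Continuous F₁) (hb : ∀ x ≤ y, ‖u₂ x‖ ≤ C) (hi : IntegrableOn F₂ (Set.Iic y))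
    (e₁ : ∀ z, y < z → F z = F₁ z) (e₂ : ∀ z < y, F z = F₂ z) (x : ℝ) :
    (if y < x then u₁ x else u₂ x) =
      (u₁ y - u₂ y) * resKer Λ x y + ∫ z, resKer Λ x z * F z := by
  -- The integrating factor is normalized to `1` at `x`. It tends to zero at `-∞`, where `u₂` is
  -- bounded, so no boundary term appears there.
  set E : ℝ → ℂ := fun z => ((Real.exp (Λ * (z - x)) : ℝ) : ℂ) with hE
  have hEc : Continuous E := (contDiff_cexp_ofReal_mul Λ x).continuous
  have hEx : E x = 1 := by simp [hE]
  have hEd : ∀ (u : ℝ → ℂ) (f : ℂ) z, HasDerivAt u (-Λ * u z + f) z →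
      HasDerivAt (fun z => E z * u z) (E z * f) z := fun u f z hu => by
    refine ((hasDerivAt_ofReal_exp Λ x z).mul hu).congr_deriv ?_
    ring
  have hker : (fun z => resKer Λ x z * F z) = Set.indicator (Set.Iio x) fun z => E z * F z := by
    funext z
    simp only [resKer, hΛ, if_true, Set.indicator, Set.mem_Iio]
    split_ifs
    · simp only [hE]
      congr 3
      ring
    · simp
  rw [hker, integral_indicator measurableSet_Iio, ← integral_Iic_eq_integral_Iio]
  have hEle : ∀ t, ∀ z ∈ Set.Iic t, ‖E z‖ ≤ Real.exp (Λ * (t - x)) := fun t z hz => by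
    simp only [hE]
    rw [Complex.norm_real, Real.norm_eq_abs, Real.abs_exp]
    refine Real.exp_le_exp.2 (mul_le_mul_of_nonneg_left ?_ hΛ.le)
    have := Set.mem_Iic.1 hz
    linarith
  have hint : ∀ t ≤ y, IntegrableOn (fun z => E z * F₂ z) (Set.Iic t) := fun t ht => by
    refine Integrable.bdd_mul (hi.mono_set (Set.Iic_subset_Iic.2 ht))
      hEc.aestronglyMeasurable.restrict (c := Real.exp (Λ * (t - x))) ?_
    exact (ae_restrict_iff' measurableSet_Iic).2 (ae_of_all _ (hEle t))
  have hlim : Tendsto (fun z => E z * u₂ z) atBot (𝓝 0) := by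
    have h1 : Tendsto (fun z : ℝ => Real.exp (Λ * (z - x)) * C) atBot (𝓝 0) := by
      have h2 : Tendsto (fun z : ℝ => Λ * (z - x)) atBot atBot :=
        (tendsto_atBot_add_const_right atBot (-x) tendsto_id).const_mul_atBot hΛ
      simpa using (Real.tendsto_exp_atBot.comp h2).mul_const C
    refine squeeze_zero_norm' ?_ h1
    filter_upwards [eventually_le_atBot y] with z hz
    rw [norm_mul, hE, Complex.norm_real, Real.norm_eq_abs, Real.abs_exp]
    exact mul_le_mul_of_nonneg_left (hb z hz) (Real.exp_pos _).le
  have hleft : ∀ t ≤ y, ∫ z in Set.Iic t, E z * F z = E t * u₂ t := by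
    intro t ht
    have h3 : ∫ z in Set.Iic t, E z * F z = ∫ z in Set.Iic t, E z * F₂ z := by
      rw [integral_Iic_eq_integral_Iio, integral_Iic_eq_integral_Iio]
      refine setIntegral_congr_fun measurableSet_Iio fun z hz => ?_
      simp only [e₂ z ((Set.mem_Iio.1 hz).trans_le ht)]
    rw [h3, integral_Iic_of_hasDerivAt_of_tendsto
      (hEd u₂ _ t (h₂ t)).continuousAt.continuousWithinAt (fun z _ => hEd u₂ _ z (h₂ z))
      (hint t ht) hlim, sub_zero]
  split_ifs with hxy
  · have hsplit : ∫ z in Set.Iic x, E z * F z =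
        (∫ z in Set.Iic y, E z * F z) + ∫ z in Set.Ioc y x, E z * F z := by
      rw [← Set.Iic_union_Ioc_eq_Iic hxy.le]
      refine setIntegral_union (Set.Iic_disjoint_Ioc le_rfl) measurableSet_Ioc ?_ ?_
      · rw [integrableOn_Iic_iff_integrableOn_Iio]
        refine ((hint y le_rfl).mono_set Set.Iio_subset_Iic_self).congr_fun (fun z hz => ?_)
          measurableSet_Iio
        simp only [e₂ z hz]
      · refine (((hEc.mul hF₁).integrableOn_Icc (a := y) (b := x)).mono_set
          Set.Ioc_subset_Icc_self).congr_fun (fun z hz => ?_) measurableSet_Ioc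
        simp only [e₁ z hz.1, Pi.mul_apply]
    have hright : ∫ z in Set.Ioc y x, E z * F z = E x * u₁ x - E y * u₁ y := by
      rw [← intervalIntegral.integral_eq_sub_of_hasDerivAt (fun z _ => hEd u₁ _ z (h₁ z))
        ((hEc.mul hF₁).intervalIntegrable _ _), intervalIntegral.integral_of_le hxy.le]
      refine setIntegral_congr_fun measurableSet_Ioc fun z hz => ?_
      simp only [e₁ z hz.1]
    have hk : resKer Λ x y = E y := by
      simp only [resKer, hΛ, hxy, if_true, hE]
      congr 2
      ring
    rw [hsplit, hleft y le_rfl, hright, hEx, hk]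
    ring
  · have hk : resKer Λ x y = 0 := by simp [resKer, hΛ, hxy]
    rw [hleft x (not_lt.1 hxy), hEx, hk]
    ring

/-- The reflection `x ↦ -x` reverses the sign of the rate and exchanges the two sides of `y`. -/
theorem eq_integral_of_piecewise_neg {Λ : ℝ} (hΛ : 0 < Λ) {y C : ℝ} {u₁ u₂ F₁ F₂ F : ℝ → ℂ}
    (h₁ : ∀ x, HasDerivAt u₁ (Λ * u₁ x + F₁ x) x) (h₂ : ∀ x, HasDerivAt u₂ (Λ * u₂ x + F₂ x) x)
    (hF₂ : Continuous F₂) (hb : ∀ x, y ≤ x → ‖u₁ x‖ ≤ C) (hi : IntegrableOn F₁ (Set.Ici y))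
    (e₁ : ∀ z, y < z → F z = F₁ z) (e₂ : ∀ z < y, F z = F₂ z) (x : ℝ) :
    (if x < y then u₂ x else u₁ x) =
      (u₁ y - u₂ y) * resKer (-Λ) x y + ∫ z, resKer (-Λ) x z * F z := by
  have hd : ∀ (u f : ℝ → ℂ), (∀ x, HasDerivAt u (Λ * u x + f x) x) →
      ∀ x, HasDerivAt (fun x => u (-x)) (-Λ * u (-x) + -f (-x)) x := fun u f hu x => by
    refine (HasDerivAt.scomp x (hu (-x)) (hasDerivAt_neg x)).congr_deriv ?_
    simp
  have hi' : IntegrableOn (fun z => -F₁ (-z)) (Set.Iic (-y)) := by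
    refine Integrable.neg ?_
    have h3 : MeasurePreserving (fun z : ℝ => -z) := Measure.measurePreserving_neg volume
    have h4 := (h3.integrableOn_comp_preimage (Homeomorph.neg ℝ).measurableEmbedding
      (f := F₁) (s := Set.Ici y)).2 hi
    have h5 : (fun z : ℝ => -z) ⁻¹' Set.Ici y = Set.Iic (-y) := by
      ext z
      simp
    rwa [h5] at h4
  have h := eq_integral_of_piecewise hΛ (y := -y) (C := C) (F := fun z => -F (-z))
    (hd u₂ F₂ h₂) (hd u₁ F₁ h₁) (hF₂.comp continuous_neg).neg
    (fun x hx => hb (-x) (by linarith)) hi' (fun z hz => by rw [e₂ (-z) (by linarith)])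
    (fun z hz => by rw [e₁ (-z) (by linarith)]) (-x)
  simp only [neg_lt_neg_iff, neg_neg] at h
  rw [h, ← integral_neg_eq_self]
  simp only [resKer_neg hΛ, neg_neg, neg_mul, mul_neg]
  ring

/-- A single bounded solution is a piecewise solution without a jump. -/
theorem eq_integral_resKer {μ : ℝ} (hμ : μ ≠ 0) {C : ℝ} {u F : ℝ → ℂ}
    (h : ∀ x, HasDerivAt u (-μ * u x + F x) x) (hF : Continuous F) (hi : Integrable F)
    (hb : ∀ x, ‖u x‖ ≤ C) (x : ℝ) : u x = ∫ z, resKer μ x z * F z := by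
  rcases hμ.lt_or_gt with hneg | hpos
  · have h1 := eq_integral_of_piecewise_neg (Λ := -μ) (by linarith) (y := 0) (C := C) (u₁ := u)
      (u₂ := u) (F₁ := F) (F₂ := F) (F := F) (by simpa using h) (by simpa using h) hF
      (fun x _ => hb x) hi.integrableOn (fun _ _ => rfl) (fun _ _ => rfl) x
    simpa using h1
  · have h1 := eq_integral_of_piecewise hpos (y := 0) (C := C) (u₁ := u)
      (u₂ := u) (F₁ := F) (F₂ := F) (F := F) h h hF
      (fun x _ => hb x) hi.integrableOn (fun _ _ => rfl) (fun _ _ => rfl) x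
    simpa using h1

/-! ### The diagonal of the Green's function -/

/-- The difference quotient of `f` is that of `f²` divided by `f(z) + f(x)`, so a continuous square
root is differentiable where it does not vanish, and no branch has to be chosen. -/
theorem hasDerivAt_of_sq {f g : ℝ → ℂ} {g' : ℂ} {x : ℝ} (hf : ContinuousAt f x) (h0 : f x ≠ 0)
    (hg : HasDerivAt g g' x) (he : ∀ z, f z ^ 2 = g z) : HasDerivAt f (g' / (2 * f x)) x := by
  rw [hasDerivAt_iff_tendsto_slope] at hg ⊢
  have h1 : Tendsto (fun z => f z + f x) (𝓝[≠] x) (𝓝 (2 * f x)) := by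
    rw [two_mul]
    exact (hf.tendsto.mono_left nhdsWithin_le_nhds).add_const _
  have h2 : 2 * f x ≠ 0 := mul_ne_zero two_ne_zero h0
  refine (hg.div h1 h2).congr' ?_
  filter_upwards [h1.eventually_ne h2] with z hz
  simp only [slope, vsub_eq_sub, Complex.real_smul, Pi.div_apply]
  rw [← he z, ← he x, div_eq_iff hz]
  ring

/-- Functions `A`, `B`, `γ` with the equations that hold for the diagonal Green's function. -/
structure DiagData (Λ : ℝ) (a b A B γ : ℝ → ℂ) : Prop where
  pos : 0 < Λ
  continuous_a : Continuous a
  continuous_b : Continuous b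
  integrable_a : Integrable a
  integrable_b : Integrable b
  hasDerivAt_A : ∀ x, HasDerivAt A (-2 * Λ * A x - a x * (1 + γ x)) x
  hasDerivAt_B : ∀ x, HasDerivAt B (2 * Λ * B x + b x * (1 + γ x)) x
  quadratic : ∀ x, γ x ^ 2 + 2 * γ x + 4 * (A x * B x) = 0
  continuous_γ : Continuous γ
  norm_le : ∀ x, ‖γ x‖ ≤ 2 / 3
  bounded : ∃ C, ∀ x, ‖A x‖ ≤ C ∧ ‖B x‖ ≤ C

namespace DiagData

variable {Λ : ℝ} {a b A B γ : ℝ → ℂ}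

theorem one_add_ne (d : DiagData Λ a b A B γ) (x : ℝ) : 1 + γ x ≠ 0 := by
  intro h
  have h1 : γ x = -1 := by linear_combination h
  have h2 := d.norm_le x
  rw [h1, norm_neg, norm_one] at h2
  norm_num at h2

theorem norm_den_ge (d : DiagData Λ a b A B γ) (x : ℝ) : 1 / 2 ≤ ‖1 + γ x / 2‖ := by
  have h1 := norm_sub_le (1 + γ x / 2) (γ x / 2)
  rw [add_sub_cancel_right, norm_one, norm_div, Complex.norm_two] at h1
  have h2 := d.norm_le x
  linarith

theorem den_ne (d : DiagData Λ a b A B γ) (x : ℝ) : 1 + γ x / 2 ≠ 0 :=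
  norm_pos_iff.1 (by linarith [d.norm_den_ge x])

theorem one_add_half (z : ℂ) : 1 + z / 2 = (2 + z) / 2 := by ring

theorem two_add_ne (d : DiagData Λ a b A B γ) (x : ℝ) : 2 + γ x ≠ 0 := fun h =>
  d.den_ne x (by rw [one_add_half, h, zero_div])

/-- The quadratic relation says `(1 + γ)² = 1 - 4AB`. In the derivative of `AB` the damping terms
cancel and a factor `1 + γ` can be divided out. -/
theorem hasDerivAt_γ (d : DiagData Λ a b A B γ) (x : ℝ) :
    HasDerivAt γ (2 * (a x * B x - b x * A x)) x := by
  have h1 : HasDerivAt (fun z => 1 - 4 * (A z * B z))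
      (4 * (1 + γ x) * (a x * B x - b x * A x)) x := by
    refine ((((d.hasDerivAt_A x).mul (d.hasDerivAt_B x)).const_mul 4).const_sub 1).congr_deriv ?_
    ring
  have h2 := hasDerivAt_of_sq (f := fun z => 1 + γ z)
    (continuous_const.add d.continuous_γ).continuousAt (d.one_add_ne x) h1
    fun z => by linear_combination d.quadratic z
  have h3 := h2.const_add (-1)
  have e : (fun z => -1 + (1 + γ z)) = γ := funext fun z => by ring
  rw [e] at h3
  refine h3.congr_deriv ?_
  have := d.one_add_ne x
  field_simp
  ring

theorem hasDerivAt_den (d : DiagData Λ a b A B γ) (x : ℝ) :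
    HasDerivAt (fun x => 1 + γ x / 2) (a x * B x - b x * A x) x := by
  refine (((d.hasDerivAt_γ x).div_const 2).const_add 1).congr_deriv ?_
  ring

/-- The ratio of the components of the solution that decays at `+∞`. -/
def ratioR (B γ : ℝ → ℂ) (x : ℝ) : ℂ := B x / (1 + γ x / 2)

/-- The ratio of the components of the solution that decays at `-∞`. -/
def ratioL (A γ : ℝ → ℂ) (x : ℝ) : ℂ := -A x / (1 + γ x / 2)

theorem mul_eq (d : DiagData Λ a b A B γ) (x : ℝ) :
    2 * (A x * B x) = -(γ x * (1 + γ x / 2)) := by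
  linear_combination (1 / 2 : ℂ) * d.quadratic x

/-- This Riccati equation is the one satisfied by `v/u` when `u' = -Λu + av` and `v' = Λv + bu`. The
quadratic relation supplies the cancellation. -/
theorem hasDerivAt_ratioR (d : DiagData Λ a b A B γ) (x : ℝ) :
    HasDerivAt (ratioR B γ) (2 * Λ * ratioR B γ x + b x - a x * ratioR B γ x ^ 2) x := by
  refine ((d.hasDerivAt_B x).div (d.hasDerivAt_den x) (d.den_ne x)).congr_deriv ?_
  have h := d.two_add_ne x
  simp only [ratioR, one_add_half]
  field_simp
  linear_combination 2 * b x * d.mul_eq x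

/-- This is the Riccati equation of the reciprocal ratio `u/v` for the same system. -/
theorem hasDerivAt_ratioL (d : DiagData Λ a b A B γ) (x : ℝ) :
    HasDerivAt (ratioL A γ) (-2 * Λ * ratioL A γ x + a x - b x * ratioL A γ x ^ 2) x := by
  refine ((d.hasDerivAt_A x).neg.div (d.hasDerivAt_den x) (d.den_ne x)).congr_deriv ?_
  have h := d.two_add_ne x
  simp only [ratioL, one_add_half, Pi.neg_apply]
  field_simp
  linear_combination 2 * a x * d.mul_eq x

theorem continuous_ratioR (d : DiagData Λ a b A B γ) : Continuous (ratioR B γ) :=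
  continuous_iff_continuousAt.2 fun x => (d.hasDerivAt_ratioR x).continuousAt

theorem continuous_ratioL (d : DiagData Λ a b A B γ) : Continuous (ratioL A γ) :=
  continuous_iff_continuousAt.2 fun x => (d.hasDerivAt_ratioL x).continuousAt

theorem exists_ratio_le (d : DiagData Λ a b A B γ) :
    ∃ C, ∀ x, ‖ratioR B γ x‖ ≤ C ∧ ‖ratioL A γ x‖ ≤ C := by
  obtain ⟨C, hC⟩ := d.bounded
  refine ⟨C / (1 / 2), fun x => ?_⟩
  have h0 : 0 ≤ C := (norm_nonneg _).trans (hC x).1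
  constructor
  · rw [ratioR, norm_div]
    exact div_le_div₀ h0 (hC x).2 (by norm_num) (d.norm_den_ge x)
  · rw [ratioL, norm_div, norm_neg]
    exact div_le_div₀ h0 (hC x).1 (by norm_num) (d.norm_den_ge x)

end DiagData

/-- The exponential `exp (c (x - y) + ∫ p)`. -/
def expInt (c : ℝ) (p : ℝ → ℂ) (y x : ℝ) : ℂ := Complex.exp (c * (x - y) + ∫ t in y..x, p t)

theorem expInt_self (c : ℝ) (p : ℝ → ℂ) (y : ℝ) : expInt c p y y = 1 := by simp [expInt]

theorem hasDerivAt_expInt (c : ℝ) {p : ℝ → ℂ} (hp : Continuous p) (y x : ℝ) :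
    HasDerivAt (expInt c p y) ((c + p x) * expInt c p y x) x := by
  have h1 := intervalIntegral.integral_hasDerivAt_right (hp.intervalIntegrable y x)
    (hp.stronglyMeasurableAtFilter _ _) hp.continuousAt
  have h2 : HasDerivAt (fun x : ℝ => (c : ℂ) * ((x : ℂ) - y)) c x := by
    simpa using (((hasDerivAt_id x).ofReal_comp).sub_const (y : ℂ)).const_mul (c : ℂ)
  refine ((h2.add h1).cexp).congr_deriv ?_
  rw [mul_comm]
  rfl

theorem norm_expInt_le {c : ℝ} {p : ℝ → ℂ} (hp : Integrable p) {y x : ℝ} (h : c * (x - y) ≤ 0) :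
    ‖expInt c p y x‖ ≤ Real.exp (∫ t, ‖p t‖) := by
  rw [expInt, Complex.norm_exp]
  refine Real.exp_le_exp.2 ?_
  have h1 : ‖∫ t in y..x, p t‖ ≤ ∫ t, ‖p t‖ :=
    (intervalIntegral.norm_integral_le_integral_norm_uIoc).trans
      (setIntegral_le_integral hp.norm (ae_of_all _ fun _ => norm_nonneg _))
  have h2 := (Complex.re_le_norm (∫ t in y..x, p t)).trans h1
  have e : ((c : ℂ) * ((x : ℂ) - y)).re = c * (x - y) := by
    rw [← Complex.ofReal_sub, ← Complex.ofReal_mul, Complex.ofReal_re]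
  rw [Complex.add_re, e]
  linarith

/-! ### Columns of the Green's function and their values on the diagonal. -/

namespace DiagData

variable {Λ : ℝ} {a b A B γ : ℝ → ℂ}

/-- A column of the Green's function, built from the solutions that decay on either side, solves
the integral equations. -/
theorem column (d : DiagData Λ a b A B γ) (y : ℝ) (c₁ c₂ : ℂ) :
    ∃ f f' : ℝ → ℂ, Measurable f ∧ Measurable f' ∧ (∃ M, ∀ x, ‖f x‖ ≤ M ∧ ‖f' x‖ ≤ M) ∧
      (∀ x, f x = (c₁ - c₂ * ratioL A γ y) * resKer Λ x y + ∫ z, resKer Λ x z * (a z * f' z)) ∧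
      (∀ x, f' x = (c₁ * ratioR B γ y - c₂) * resKer (-Λ) x y +
        ∫ z, resKer (-Λ) x z * (b z * f z)) ∧
      f y = c₂ * ratioL A γ y ∧ f' y = c₁ * ratioR B γ y := by
  set m := ratioR B γ
  set n := ratioL A γ
  have hm := d.continuous_ratioR
  have hn := d.continuous_ratioL
  obtain ⟨K, hK⟩ := d.exists_ratio_le
  have ham : Integrable fun z => a z * m z :=
    d.integrable_a.mul_bdd hm.aestronglyMeasurable (ae_of_all _ fun x => (hK x).1)
  have hbn : Integrable fun z => b z * n z :=
    d.integrable_b.mul_bdd hn.aestronglyMeasurable (ae_of_all _ fun x => (hK x).2)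
  have hamc : Continuous fun z => a z * m z := d.continuous_a.mul hm
  have hbnc : Continuous fun z => b z * n z := d.continuous_b.mul hn
  -- Given the ratio, one component solves a scalar linear equation. Thus `(e₁, m e₁)` solves the
  -- homogeneous system and is bounded to the right of `y`, while `(n e₂, e₂)` solves it and is
  -- bounded to the left.
  set e₁ := expInt (-Λ) (fun z => a z * m z) y
  set e₂ := expInt Λ (fun z => b z * n z) y
  have hd₁ : ∀ x, HasDerivAt e₁ ((-Λ + a x * m x) * e₁ x) x := fun x => by
    simpa using hasDerivAt_expInt (-Λ) hamc y x
  have hd₂ : ∀ x, HasDerivAt e₂ ((Λ + b x * n x) * e₂ x) x := fun x => hasDerivAt_expInt Λ hbnc y x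
  have he₁ : Continuous e₁ := continuous_iff_continuousAt.2 fun x => (hd₁ x).continuousAt
  have he₂ : Continuous e₂ := continuous_iff_continuousAt.2 fun x => (hd₂ x).continuousAt
  set M₁ := Real.exp (∫ t, ‖a t * m t‖)
  set M₂ := Real.exp (∫ t, ‖b t * n t‖)
  have hΛ := d.pos
  have hb₁ : ∀ x, y ≤ x → ‖e₁ x‖ ≤ M₁ := fun x hx => norm_expInt_le ham (by nlinarith)
  have hb₂ : ∀ x ≤ y, ‖e₂ x‖ ≤ M₂ := fun x hx => norm_expInt_le hbn (by nlinarith)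
  have hK0 : 0 ≤ K := (norm_nonneg _).trans (hK 0).1
  have hb₁' : ∀ x, y ≤ x → ‖m x * e₁ x‖ ≤ K * M₁ := fun x hx => by
    rw [norm_mul]
    exact mul_le_mul (hK x).1 (hb₁ x hx) (norm_nonneg _) hK0
  have hb₂' : ∀ x ≤ y, ‖n x * e₂ x‖ ≤ K * M₂ := fun x hx => by
    rw [norm_mul]
    exact mul_le_mul (hK x).2 (hb₂ x hx) (norm_nonneg _) hK0
  have hmul : ∀ (c : ℂ) {z : ℂ} {M : ℝ}, ‖z‖ ≤ M → ‖c * z‖ ≤ ‖c‖ * M := fun c z M h => by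
    rw [norm_mul]
    exact mul_le_mul_of_nonneg_left h (norm_nonneg c)
  set u₁ : ℝ → ℂ := fun x => c₁ * e₁ x
  set u₂ : ℝ → ℂ := fun x => c₂ * (n x * e₂ x)
  set u₁' : ℝ → ℂ := fun x => c₁ * (m x * e₁ x)
  set u₂' : ℝ → ℂ := fun x => c₂ * e₂ x
  have k₁ : ∀ x, HasDerivAt u₁ (-Λ * u₁ x + a x * u₁' x) x := fun x => by
    refine ((hd₁ x).const_mul c₁).congr_deriv ?_
    simp only [u₁, u₁']
    ring
  have k₂ : ∀ x, HasDerivAt u₂ (-Λ * u₂ x + a x * u₂' x) x := fun x => by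
    refine (((d.hasDerivAt_ratioL x).mul (hd₂ x)).const_mul c₂).congr_deriv ?_
    simp only [u₂, u₂']
    ring
  have k₁' : ∀ x, HasDerivAt u₁' (Λ * u₁' x + b x * u₁ x) x := fun x => by
    refine (((d.hasDerivAt_ratioR x).mul (hd₁ x)).const_mul c₁).congr_deriv ?_
    simp only [u₁, u₁']
    ring
  have k₂' : ∀ x, HasDerivAt u₂' (Λ * u₂' x + b x * u₂ x) x := fun x => by
    refine ((hd₂ x).const_mul c₂).congr_deriv ?_
    simp only [u₂, u₂']
    ring
  have cont : ∀ {u f : ℝ → ℂ}, (∀ x, HasDerivAt u (f x) x) → Continuous u := fun h =>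
    continuous_iff_continuousAt.2 fun x => (h x).continuousAt
  -- At `x = y` the first component takes its left value and the second its right value, in
  -- accordance with `resKer`, which vanishes on the diagonal.
  set f : ℝ → ℂ := fun x => if y < x then u₁ x else u₂ x with hf
  set f' : ℝ → ℂ := fun x => if x < y then u₂' x else u₁' x with hf'
  refine ⟨f, f', ?_, ?_, ?_, ?_, ?_, ?_, ?_⟩
  · exact Measurable.ite measurableSet_Ioi (cont k₁).measurable (cont k₂).measurable
  · exact Measurable.ite measurableSet_Iio (cont k₂').measurable (cont k₁').measurable
  · refine ⟨max (max (‖c₁‖ * M₁) (‖c₂‖ * (K * M₂))) (max (‖c₂‖ * M₂) (‖c₁‖ * (K * M₁))),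
      fun x => ⟨?_, ?_⟩⟩
    · simp only [hf]
      split_ifs with h
      · exact (hmul c₁ (hb₁ x h.le)).trans ((le_max_left _ _).trans (le_max_left _ _))
      · exact (hmul c₂ (hb₂' x (not_lt.1 h))).trans ((le_max_right _ _).trans (le_max_left _ _))
    · simp only [hf']
      split_ifs with h
      · exact (hmul c₂ (hb₂ x h.le)).trans ((le_max_left _ _).trans (le_max_right _ _))
      · exact (hmul c₁ (hb₁' x (not_lt.1 h))).trans ((le_max_right _ _).trans (le_max_right _ _))
  · intro x
    have h := eq_integral_of_piecewise hΛ (y := y) (F := fun z => a z * f' z) k₁ k₂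
      (d.continuous_a.mul (cont k₁')) (fun x hx => hmul c₂ (hb₂' x hx)) ?_ (fun z hz => ?_)
      (fun z hz => ?_) x
    · have e : u₁ y - u₂ y = c₁ - c₂ * n y := by
        simp only [u₁, u₂, e₁, e₂, expInt_self, mul_one]
      rw [← e]
      exact h
    · refine d.integrable_a.integrableOn.mul_bdd (cont k₂').aestronglyMeasurable.restrict
        (c := ‖c₂‖ * M₂) ((ae_restrict_iff' measurableSet_Iic).2 (ae_of_all _ fun x hx => ?_))
      exact hmul c₂ (hb₂ x hx)
    · simp only [hf', if_neg hz.not_gt]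
    · simp only [hf', if_pos hz]
  · intro x
    have h := eq_integral_of_piecewise_neg hΛ (y := y) (F := fun z => b z * f z) k₁' k₂'
      (d.continuous_b.mul (cont k₂)) (fun x hx => hmul c₁ (hb₁' x hx)) ?_ (fun z hz => ?_)
      (fun z hz => ?_) x
    · have e : u₁' y - u₂' y = c₁ * m y - c₂ := by
        simp only [u₁', u₂', e₁, e₂, expInt_self, mul_one]
      rw [← e]
      exact h
    · refine d.integrable_b.integrableOn.mul_bdd (cont k₁).aestronglyMeasurable.restrict
        (c := ‖c₁‖ * M₁) ((ae_restrict_iff' measurableSet_Ici).2 (ae_of_all _ fun x hx => ?_))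
      exact hmul c₁ (hb₁ x hx)
    · simp only [hf, if_pos hz]
    · simp only [hf, if_neg hz.not_gt]
  · simp only [hf, if_neg (lt_irrefl y), u₂, e₂, expInt_self, mul_one]
  · simp only [hf', if_neg (lt_irrefl y), u₁', e₁, expInt_self, mul_one]

/-- The constants are chosen so that the glued function jumps by `1` in component `j` and not at all
in the other. It then satisfies the same integral equation as the column of the Neumann sum, and
bounded solutions are unique. -/
theorem neumannSum_column {β : ℝ} {μ : Fin 2 → ℝ} {V : Fin 2 → ℝ → ℂ} {w : ℝ → ℝ}
    (D : NeumannData Λ β μ V w) (hβ : β ≤ 1 / 2) {p j : Fin 2} (hp : μ p = Λ)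
    (hp' : μ (p + 1) = -Λ) (d : DiagData Λ (V p) (V (p + 1)) A B γ) (y : ℝ) {c₁ c₂ : ℂ}
    (h₁ : c₁ - c₂ * ratioL A γ y = if p = j then 1 else 0)
    (h₂ : c₁ * ratioR B γ y - c₂ = if p + 1 = j then 1 else 0) :
    neumannSum μ V y y p j = c₂ * ratioL A γ y ∧
      neumannSum μ V y y (p + 1) j = c₁ * ratioR B γ y := by
  obtain ⟨f, f', hfm, hfm', ⟨M, hM⟩, hf, hf', e, e'⟩ := d.column y c₁ c₂
  have hcases : ∀ p i : Fin 2, i = p ∨ i = p + 1 := by decide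
  have hne : ∀ p : Fin 2, p + 1 ≠ p := by decide
  have htwo : ∀ p : Fin 2, p + 1 + 1 = p := by decide
  set g : Fin 2 → ℝ → ℂ := fun i => if i = p then f else f' with hg
  have g1 : g p = f := if_pos rfl
  have g2 : g (p + 1) = f' := if_neg (hne p)
  have hu := D.eq_of_integral_eq hβ (d := fun i x => if i = j then resKer (μ i) x y else 0)
    (f := g) (f' := fun i x => neumannSum μ V x y i j) (M := max M 2)
    (fun i => by rcases hcases p i with rfl | rfl <;> simp only [g1, g2, hfm, hfm'])
    (fun i => (D.measurable_neumannSum hβ i j).comp (measurable_id.prodMk measurable_const))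
    (fun i x => by
      rcases hcases p i with rfl | rfl
      · rw [g1]
        exact (hM x).1.trans (le_max_left _ _)
      · rw [g2]
        exact (hM x).2.trans (le_max_left _ _))
    (fun i x => (D.norm_neumannSum_le_two hβ x y i j).trans (le_max_right _ _))
    (fun i x => by
      rcases hcases p i with rfl | rfl
      · rw [g1, g2, hf x, h₁, hp]
        simp only [ite_mul, one_mul, zero_mul, mul_assoc]
      · rw [htwo, g1, g2, hf' x, h₂, hp']
        simp only [ite_mul, one_mul, zero_mul, mul_assoc])
    (fun i x => D.neumannSum_eq hβ x y i j)
  rw [← e, ← e']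
  constructor
  · rw [← congrFun (congrFun hu p) y, g1]
  · rw [← congrFun (congrFun hu (p + 1)) y, g2]

theorem neumannSum_diag {β : ℝ} {μ : Fin 2 → ℝ} {V : Fin 2 → ℝ → ℂ} {w : ℝ → ℝ}
    (D : NeumannData Λ β μ V w) (hβ : β ≤ 1 / 2) {p : Fin 2} (hp : μ p = Λ)
    (hp' : μ (p + 1) = -Λ) (d : DiagData Λ (V p) (V (p + 1)) A B γ) (y : ℝ) :
    neumannSum μ V y y p (p + 1) = A y ∧ neumannSum μ V y y (p + 1) p = B y := by
  have hne : ∀ p : Fin 2, p + 1 ≠ p := by decide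
  have hD := d.two_add_ne y
  have hq := d.mul_eq y
  constructor
  · rw [(neumannSum_column D hβ (j := p + 1) hp hp' d y (c₁ := A y) (c₂ := -((2 + γ y) / 2)) ?_
      ?_).1]
    · rw [ratioL, one_add_half]
      field_simp
    · rw [if_neg (hne p).symm, ratioL, one_add_half]
      field_simp
      ring
    · rw [if_pos rfl, ratioR, one_add_half]
      field_simp
      linear_combination 2 * hq
  · rw [(neumannSum_column D hβ (j := p) hp hp' d y (c₁ := (2 + γ y) / 2) (c₂ := B y) ?_ ?_).2]
    · rw [ratioR, one_add_half]
      field_simp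
    · rw [if_pos rfl, ratioL, one_add_half]
      field_simp
      linear_combination 2 * hq
    · rw [if_neg (hne p), ratioR, one_add_half]
      field_simp
      ring

end DiagData

end DNLSGreen

end

noncomputable section

namespace DNLSGreen

open Filter Topology FourierTransform

/-! ### The Green's function as a function of `q` in the weighted space -/

theorem continuous_ofReal_tauW {s k : ℝ} (hk : 0 < k) :
    Continuous fun η => (tauW s k η : ℂ) :=
  Complex.continuous_ofReal.comp (continuous_tauW hk)

theorem norm_ofReal_tauW_le {s k : ℝ} (hs' : s < 1 / 2) (hk : 0 < k) (η : ℝ) :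
    ‖(tauW s k η : ℂ)‖ ≤ 1 := by
  rw [Complex.norm_real, Real.norm_of_nonneg (tauW_pos hk η).le]
  exact tauW_le_one hs' hk η

/-- The weighted Fourier transform `τ 𝓕 q`. -/
def weighted {s k : ℝ} (hs' : s < 1 / 2) (hk : 0 < k) :
    Lp ℂ 2 (volume : Measure ℝ) →L[ℝ] Lp ℂ 2 (volume : Measure ℝ) :=
  (mulOp (fun η => (tauW s k η : ℂ)) 1 (continuous_ofReal_tauW hk)
    (norm_ofReal_tauW_le hs' hk)).comp
    (fourierReal : Lp ℂ 2 (volume : Measure ℝ) →L[ℝ] Lp ℂ 2 (volume : Measure ℝ))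

theorem weighted_apply {s k : ℝ} (hs' : s < 1 / 2) (hk : 0 < k)
    (q : Lp ℂ 2 (volume : Measure ℝ)) :
    weighted hs' hk q =ᵐ[volume] fun η => (tauW s k η : ℂ) *
      (𝓕 q : Lp ℂ 2 (volume : Measure ℝ)) η :=
  mulOp_apply _ 1 (continuous_ofReal_tauW hk) (norm_ofReal_tauW_le hs' hk) (𝓕 q)

theorem norm_weighted_le {s k : ℝ} (hs' : s < 1 / 2) (hk : 0 < k)
    (q : Lp ℂ 2 (volume : Measure ℝ)) : ‖weighted hs' hk q‖ ≤ ‖q‖ := by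
  have h : ‖weighted hs' hk q‖ ≤ ‖(𝓕 q : Lp ℂ 2 (volume : Measure ℝ))‖ := by
    refine Lp.norm_le_norm_of_ae_le ?_
    filter_upwards [weighted_apply hs' hk q] with η hη
    rw [hη, norm_mul, Complex.norm_real, Real.norm_of_nonneg (tauW_pos hk η).le]
    exact mul_le_of_le_one_left (norm_nonneg _) (tauW_le_one hs' hk η)
  exact h.trans (fourierReal.norm_map q).le

theorem smallPot_of_norm_le {κ : ℂ} (h1 : (lam κ : ℂ) = Complex.I * κ ^ 2) (h2 : 0 < ‖κ‖)
    (h3 : |lam κ| = ‖κ‖ ^ 2) {q : Lp ℂ 2 (volume : Measure ℝ)} (hq : ‖q‖ ≤ 1 / 4) :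
    SmallPot κ q where
  lam_eq := h1
  pos := h2
  abs_lam := h3
  measurable := (Lp.stronglyMeasurable q).measurable
  memLp := Lp.memLp q
  small := by
    rw [← Lp.norm_def]
    linarith

theorem SmallPot.congr {κ : ℂ} {q q' : ℝ → ℂ} (h : SmallPot κ q) (hm : Measurable q')
    (he : q =ᵐ[volume] q') : SmallPot κ q' where
  lam_eq := h.lam_eq
  pos := h.pos
  abs_lam := h.abs_lam
  measurable := hm
  memLp := (memLp_congr_ae he).1 h.memLp
  small := by
    rw [← eLpNorm_congr_ae he]
    exact h.small

theorem offDiag_congr (κ : ℂ) {q q' : ℝ → ℂ} (he : q =ᵐ[volume] q') (i : Fin 2) :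
    offDiag κ q i =ᵐ[volume] offDiag κ q' i := by
  filter_upwards [he] with z hz
  fin_cases i <;> simp [offDiag, hz]

theorem neumannSum_congr {κ : ℂ} {q q' : ℝ → ℂ} (he : q =ᵐ[volume] q') :
    neumannSum (diagCoeff κ) (offDiag κ q) = neumannSum (diagCoeff κ) (offDiag κ q') := by
  funext x y i j
  simp only [neumannSum, neumannTerm_congr (offDiag_congr κ he)]

theorem data_sub {κ : ℂ} (h2 : 0 < ‖κ‖) (h3 : |lam κ| = ‖κ‖ ^ 2)
    (q q' : Lp ℂ 2 (volume : Measure ℝ)) :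
    NeumannData (‖κ‖ ^ 2) (2 * ‖q - q'‖) (diagCoeff κ)
      (fun i z => offDiag κ q i z - offDiag κ q' i z) fun z => ‖κ‖ * ‖q z - q' z‖ := by
  have h := neumannData_offDiag h2 h3 (q := fun z => q z - q' z)
    ((Lp.stronglyMeasurable q).measurable.sub (Lp.stronglyMeasurable q').measurable)
    ((Lp.memLp q).sub (Lp.memLp q'))
  have e1 : (eLpNorm (fun z => q z - q' z) 2 volume).toReal = ‖q - q'‖ := by
    rw [Lp.norm_def]
    congr 1
    exact eLpNorm_congr_ae (Lp.coeFn_sub q q').symm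
  have e2 : offDiag κ (fun z => q z - q' z) = fun i z => offDiag κ q i z - offDiag κ q' i z := by
    funext i z
    fin_cases i <;> simp [offDiag] <;> ring_nf
  rwa [e1, e2] at h

theorem norm_sgn_le (κ : ℂ) : ‖sgn κ‖ ≤ 1 := by
  rw [sgn, Complex.norm_real]
  rcases Real.sign_apply_eq (lam κ) with h | h | h <;> simp [h]

theorem continuousOn_of_lipschitz {f : Lp ℂ 2 (volume : Measure ℝ) → ℂ} {S : Set _} {C : ℝ}
    (h : ∀ q ∈ S, ∀ q' ∈ S, ‖f q - f q'‖ ≤ C * ‖q - q'‖) : ContinuousOn f S := by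
  refine LipschitzOnWith.continuousOn (K := C.toNNReal) (LipschitzOnWith.of_dist_le_mul ?_)
  intro q hq q' hq'
  rw [dist_eq_norm, dist_eq_norm]
  exact (h q hq q' hq').trans
    (mul_le_mul_of_nonneg_right (Real.le_coe_toNNReal C) (norm_nonneg _))

/-- Pointwise Lipschitz dependence on `q` in `L²`, needed for the passage from Schwartz potentials
to general ones. The constant `8` is `4` from the resolvent difference times `2` from `data_sub`. -/
theorem continuousOn_neumannSum {κ : ℂ} (h1 : (lam κ : ℂ) = Complex.I * κ ^ 2)
    (h2 : 0 < ‖κ‖) (h3 : |lam κ| = ‖κ‖ ^ 2) (x : ℝ) (i j : Fin 2) :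
    ContinuousOn (fun q : Lp ℂ 2 (volume : Measure ℝ) =>
      sgn κ * neumannSum (diagCoeff κ) (offDiag κ q) x x i j) (Metric.closedBall 0 (1 / 4)) := by
  refine continuousOn_of_lipschitz (C := 8) fun q hq q' hq' => ?_
  rw [mem_closedBall_zero_iff] at hq hq'
  have d := smallPot_of_norm_le h1 h2 h3 hq
  have d' := smallPot_of_norm_le h1 h2 h3 hq'
  rw [← mul_sub, norm_mul]
  refine (mul_le_of_le_one_left (norm_nonneg _) (norm_sgn_le κ)).trans ?_
  have h' : NeumannData (‖κ‖ ^ 2) (1 / 2) (diagCoeff κ) (offDiag κ q) fun z => ‖κ‖ * ‖q z‖ :=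
    { d.data with integral_le := fun x => (d.data.integral_le x).trans d.small }
  have h'' : NeumannData (‖κ‖ ^ 2) (1 / 2) (diagCoeff κ) (offDiag κ q') fun z => ‖κ‖ * ‖q' z‖ :=
    { d'.data with integral_le := fun x => (d'.data.integral_le x).trans d'.small }
  refine (h'.norm_neumannSum_sub_le le_rfl h'' (data_sub h2 h3 q q') x x i j).trans
    (le_of_eq ?_)
  ring

theorem continuousOn_neumannTerm_one {κ : ℂ} (h1 : (lam κ : ℂ) = Complex.I * κ ^ 2)
    (h2 : 0 < ‖κ‖) (h3 : |lam κ| = ‖κ‖ ^ 2) (x : ℝ) (i j : Fin 2) :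
    ContinuousOn (fun q : Lp ℂ 2 (volume : Measure ℝ) =>
      sgn κ * neumannTerm (diagCoeff κ) (offDiag κ q) 1 x x i j)
      (Metric.closedBall 0 (1 / 4)) := by
  refine continuousOn_of_lipschitz (C := 2) fun q hq q' hq' => ?_
  rw [mem_closedBall_zero_iff] at hq hq'
  have d := smallPot_of_norm_le h1 h2 h3 hq
  have d' := smallPot_of_norm_le h1 h2 h3 hq'
  rw [← mul_sub, norm_mul]
  refine (mul_le_of_le_one_left (norm_nonneg _) (norm_sgn_le κ)).trans ?_
  have h' : NeumannData (‖κ‖ ^ 2) (1 / 2) (diagCoeff κ) (offDiag κ q) fun z => ‖κ‖ * ‖q z‖ :=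
    { d.data with integral_le := fun x => (d.data.integral_le x).trans d.small }
  have h'' : NeumannData (‖κ‖ ^ 2) (1 / 2) (diagCoeff κ) (offDiag κ q') fun z => ‖κ‖ * ‖q' z‖ :=
    { d'.data with integral_le := fun x => (d'.data.integral_le x).trans d'.small }
  exact h'.norm_neumannTerm_one_sub_le h'' (data_sub h2 h3 q q') x x i j

/-- For `λ > 0` the system is that of `DiagData` with `A = g` and `B = h`. For `λ < 0` the two
components exchange roles, with `A = -h` and `B = -g`, and the factor `sgn κ` absorbs the sign. -/
theorem IsDiagSolution.eq_green {κ : ℂ} {q g h γ : ℝ → ℂ} (d : SmallPot κ q)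
    (hc : Continuous q) (hi : Integrable q) (H : IsDiagSolution (lam κ) κ q g h γ) (x : ℝ) :
    sgn κ * neumannSum (diagCoeff κ) (offDiag κ q) x x 0 1 = g x ∧
      sgn κ * neumannSum (diagCoeff κ) (offDiag κ q) x x 1 0 = h x := by
  obtain ⟨C, hC⟩ := H.bounded
  have hpos : 0 < ‖κ‖ ^ 2 := by
    have := d.pos
    positivity
  have hcr : Continuous fun z => κ * (-(starRingEnd ℂ) (q z)) :=
    continuous_const.mul (Complex.continuous_conj.comp hc).neg
  have hir : Integrable fun z => κ * (-(starRingEnd ℂ) (q z)) := by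
    have : Integrable fun z => star (q z) :=
      (Complex.conjLIE.toContinuousLinearEquiv : ℂ →L[ℝ] ℂ).integrable_comp hi
    exact this.neg.const_mul κ
  have hcq : Continuous fun z => κ * q z := continuous_const.mul hc
  have hiq : Integrable fun z => κ * q z := hi.const_mul κ
  rcases d.lam_ne.lt_or_gt with hneg | hpos'
  · have hΛ : ‖κ‖ ^ 2 = -lam κ := by rw [← d.abs_lam, abs_of_neg hneg]
    have hD : DiagData (‖κ‖ ^ 2) (offDiag κ q 1) (offDiag κ q (1 + 1)) (fun x => -h x)
        (fun x => -g x) γ :=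
      { pos := hpos
        continuous_a := hcr
        continuous_b := hcq
        integrable_a := hir
        integrable_b := hiq
        hasDerivAt_A := fun x => (H.hasDerivAt_snd x).neg.congr_deriv (by
          rw [hΛ]
          simp only [offDiag, Matrix.cons_val_one, Matrix.cons_val_fin_one]
          push_cast
          ring)
        hasDerivAt_B := fun x => (H.hasDerivAt_fst x).neg.congr_deriv (by
          rw [hΛ, show (1 + 1 : Fin 2) = 0 from rfl]
          simp only [offDiag, Matrix.cons_val_zero]
          push_cast
          ring)
        quadratic := fun x => by linear_combination H.quadratic x
        continuous_γ := H.continuous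
        norm_le := H.norm_le
        bounded := ⟨C, fun x => by simpa using ⟨(hC x).2, (hC x).1⟩⟩ }
    have hs := DiagData.neumannSum_diag d.data d.small (p := 1) (by simp [diagCoeff, hΛ])
      (by
        rw [show (1 + 1 : Fin 2) = 0 from rfl]
        simp [diagCoeff, hΛ]) hD x
    rw [show (1 + 1 : Fin 2) = 0 from rfl] at hs
    rw [hs.1, hs.2, sgn, Real.sign_of_neg hneg]
    simp
  · have hΛ : ‖κ‖ ^ 2 = lam κ := by rw [← d.abs_lam, abs_of_pos hpos']
    have hD : DiagData (‖κ‖ ^ 2) (offDiag κ q 0) (offDiag κ q (0 + 1)) g h γ :=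
      { pos := hpos
        continuous_a := hcq
        continuous_b := hcr
        integrable_a := hiq
        integrable_b := hir
        hasDerivAt_A := fun x => (H.hasDerivAt_fst x).congr_deriv (by
          rw [hΛ]
          simp only [offDiag, Matrix.cons_val_zero])
        hasDerivAt_B := fun x => (H.hasDerivAt_snd x).congr_deriv (by
          rw [hΛ, zero_add]
          simp only [offDiag, Matrix.cons_val_one, Matrix.cons_val_fin_one])
        quadratic := H.quadratic
        continuous_γ := H.continuous
        norm_le := H.norm_le
        bounded := ⟨C, hC⟩ }
    have hs := DiagData.neumannSum_diag d.data d.small (p := 0) (by simp [diagCoeff, hΛ])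
      (by simp [diagCoeff, hΛ]) hD x
    rw [zero_add] at hs
    rw [hs.1, hs.2, sgn, Real.sign_of_pos hpos']
    simp

/-- The two kernels are supported on the same side of `x`, and their exponents add up. The linear
term is thereby a single resolvent at `2λ`, the one that appears in the system for `g` and `h`. -/
theorem sgn_mul_resKer_mul {l : ℝ} (hl : l ≠ 0) (x z : ℝ) :
    (Real.sign l : ℂ) * (resKer l x z * resKer (-l) z x) = -resKer (2 * l) x z := by
  rcases hl.lt_or_gt with h | h
  · have h1 : ¬ 0 < l := h.not_gt
    have h2 : 0 < -l := by linarith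
    have h3 : ¬ 0 < 2 * l := by linarith
    simp only [resKer, h1, h2, h3, if_true, if_false, Real.sign_of_neg h]
    split_ifs
    · rw [← Complex.ofReal_mul, ← Complex.ofReal_mul, ← Complex.ofReal_neg, neg_mul (Real.exp _),
        ← Real.exp_add, neg_one_mul, neg_neg, neg_neg]
      congr 2
      ring_nf
    · simp
  · have h2 : ¬ 0 < -l := by linarith
    have h3 : 0 < 2 * l := by linarith
    simp only [resKer, h, h2, h3, if_true, if_false, Real.sign_of_pos h]
    split_ifs
    · rw [← Complex.ofReal_mul, ← Complex.ofReal_mul, ← Complex.ofReal_neg, mul_neg, ← Real.exp_add,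
        one_mul]
      congr 3
      ring
    · simp

theorem sgn_mul_neumannTerm_one {κ : ℂ} (hκ : lam κ ≠ 0) (q : ℝ → ℂ) (x : ℝ) :
    sgn κ * neumannTerm (diagCoeff κ) (offDiag κ q) 1 x x 0 1 =
        ∫ z, resKer (2 * lam κ) x z * -(κ * q z) ∧
      sgn κ * neumannTerm (diagCoeff κ) (offDiag κ q) 1 x x 1 0 =
        ∫ z, resKer (-(2 * lam κ)) x z * (κ * (-(starRingEnd ℂ) (q z))) := by
  constructor
  · simp only [neumannTerm, zero_add, if_true]
    rw [← integral_const_mul]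
    congr 1
    funext z
    have h := sgn_mul_resKer_mul hκ x z
    simp only [sgn, diagCoeff, offDiag, Matrix.cons_val_zero, Matrix.cons_val_one,
      Matrix.cons_val_fin_one]
    linear_combination (κ * q z) * h
  · simp only [neumannTerm, show (1 + 1 : Fin 2) = 0 from rfl, if_true]
    rw [← integral_const_mul]
    congr 1
    funext z
    have h := sgn_mul_resKer_mul (neg_ne_zero.2 hκ) x z
    rw [Real.sign_neg, neg_neg, mul_neg] at h
    push_cast at h
    simp only [sgn, diagCoeff, offDiag, Matrix.cons_val_zero, Matrix.cons_val_one,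
      Matrix.cons_val_fin_one]
    linear_combination -(κ * (-(starRingEnd ℂ) (q z))) * h

/-! ### Identification for Schwartz potentials, and extension by density. -/

section Identify

variable {s : ℝ} (hs : 0 < s) (hs' : s < 1 / 2) {κ : ℂ} {k : ℝ} (hk : 0 < k)
  (hκ : ‖κ‖ = k) (hl : |lam κ| = k ^ 2)

/-- The radius of the ball in `L²` on which the Green's function is identified. -/
def potRadius (s : ℝ) : ℝ := min (1 / 4) (solRadius s)

theorem potRadius_pos (s : ℝ) : 0 < potRadius s := lt_min (by norm_num) (solRadius_pos s)

theorem smallPot_of_mem {κ : ℂ} {k : ℝ} (hk : 0 < k) (hκ : ‖κ‖ = k) (hl : |lam κ| = k ^ 2)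
    (h1 : (lam κ : ℂ) = Complex.I * κ ^ 2) {q : Lp ℂ 2 (volume : Measure ℝ)}
    (hq : q ∈ Metric.ball (0 : Lp ℂ 2 (volume : Measure ℝ)) (potRadius s)) : SmallPot κ q :=
  smallPot_of_norm_le h1 (by rw [hκ]; exact hk) (by rw [hκ, hl])
    ((mem_ball_zero_iff.1 hq).le.trans (min_le_left _ _))

theorem weighted_mem {q : Lp ℂ 2 (volume : Measure ℝ)}
    (hq : q ∈ Metric.ball (0 : Lp ℂ 2 (volume : Measure ℝ)) (potRadius s)) :
    weighted hs' hk q ∈ Metric.ball (0 : Lp ℂ 2 (volume : Measure ℝ)) (solRadius s) := by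
  rw [mem_ball_zero_iff] at hq ⊢
  exact (norm_weighted_le hs' hk q).trans_lt (hq.trans_le (min_le_right _ _))

theorem weighted_schwartz (ψ : 𝓢(ℝ, ℂ)) :
    weighted hs' hk (ψ.toLp 2) =ᵐ[volume] fun η => (tauW s k η : ℂ) * (𝓕 ψ : 𝓢(ℝ, ℂ)) η := by
  filter_upwards [weighted_apply hs' hk (ψ.toLp 2), (𝓕 ψ : 𝓢(ℝ, ℂ)).coeFn_toLp 2] with η hη h'
  rw [hη, SchwartzMap.toLp_fourier_eq, h']

theorem fourierInv_fourier_schwartz (ψ : 𝓢(ℝ, ℂ)) (x : ℝ) :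
    𝓕⁻ ((𝓕 ψ : 𝓢(ℝ, ℂ)) : ℝ → ℂ) x = ψ x := by
  rw [← SchwartzMap.fourierInv_coe, fourierInv_fourier_eq]

theorem isDiagSolution_schwartz {u γ : Lp ℂ 2 (volume : Measure ℝ)} {ψ : 𝓢(ℝ, ℂ)}
    (hu : u =ᵐ[volume] fun η => (tauW s k η : ℂ) * (𝓕 ψ : 𝓢(ℝ, ℂ)) η)
    (hγ : ∀ x, ‖evalFn s k γ x‖ ≤ 2 / 3)
    (hq : ∀ x, evalFn s k γ x ^ 2 + 2 * evalFn s k γ x +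
          4 * (evalFn s k (fstOp hk hκ hl u +
              fstBilin hs hs' hk hκ hl u γ :
              Lp ℂ 2 (volume : Measure ℝ)) x *
            evalFn s k (sndOp hk hκ hl (negConjReflect u) +
              sndBilin hs hs' hk hκ hl u γ :
              Lp ℂ 2 (volume : Measure ℝ)) x) = 0) :
    IsDiagSolution (lam κ) κ ψ
      (evalFn s k (fstOp hk hκ hl u +
        fstBilin hs hs' hk hκ hl u γ : Lp ℂ 2 (volume : Measure ℝ)))
      (evalFn s k (sndOp hk hκ hl (negConjReflect u) +
        sndBilin hs hs' hk hκ hl u γ : Lp ℂ 2 (volume : Measure ℝ)))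
      (evalFn s k γ) := by
  have e : 𝓕⁻ ((𝓕 ψ : 𝓢(ℝ, ℂ)) : ℝ → ℂ) = ψ := funext fun x => fourierInv_fourier_schwartz ψ x
  have h := isDiagSolution_evalFn hs hs' hk hκ hl (𝓕 ψ : 𝓢(ℝ, ℂ)).integrable
    hu hγ hq
  rw [e] at h
  exact h

theorem neumannSum_schwartz {u γ : Lp ℂ 2 (volume : Measure ℝ)} {ψ : 𝓢(ℝ, ℂ)}
    {q : Lp ℂ 2 (volume : Measure ℝ)} (hqψ : q =ᵐ[volume] ψ) (hq : SmallPot κ q)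
    (hu : u =ᵐ[volume] fun η => (tauW s k η : ℂ) * (𝓕 ψ : 𝓢(ℝ, ℂ)) η)
    (hγ : ∀ x, ‖evalFn s k γ x‖ ≤ 2 / 3)
    (hquad : ∀ x, evalFn s k γ x ^ 2 + 2 * evalFn s k γ x +
          4 * (evalFn s k (fstOp hk hκ hl u + fstBilin hs hs' hk hκ hl u γ :
              Lp ℂ 2 (volume : Measure ℝ)) x *
            evalFn s k (sndOp hk hκ hl (negConjReflect u) + sndBilin hs hs' hk hκ hl u γ :
              Lp ℂ 2 (volume : Measure ℝ)) x) = 0) (x : ℝ) :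
    sgn κ * neumannSum (diagCoeff κ) (offDiag κ q) x x 0 1 =
        evalFn s k (fstOp hk hκ hl u + fstBilin hs hs' hk hκ hl u γ :
          Lp ℂ 2 (volume : Measure ℝ)) x ∧
      sgn κ * neumannSum (diagCoeff κ) (offDiag κ q) x x 1 0 =
        evalFn s k (sndOp hk hκ hl (negConjReflect u) + sndBilin hs hs' hk hκ hl u γ :
          Lp ℂ 2 (volume : Measure ℝ)) x := by
  rw [neumannSum_congr hqψ]
  exact (isDiagSolution_schwartz hs hs' hk hκ hl hu hγ hquad).eq_green
    (hq.congr ψ.continuous.measurable hqψ) ψ.continuous ψ.integrable x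

/-- Both sides are the bounded solution of the same first-order equation, whose source is integrable
and continuous. -/
theorem neumannTerm_one_schwartz (hs : 0 < s) {u : Lp ℂ 2 (volume : Measure ℝ)} {ψ : 𝓢(ℝ, ℂ)}
    {q : Lp ℂ 2 (volume : Measure ℝ)} (hqψ : q =ᵐ[volume] ψ) (h0 : lam κ ≠ 0)
    (hu : u =ᵐ[volume] fun η => (tauW s k η : ℂ) * (𝓕 ψ : 𝓢(ℝ, ℂ)) η) (x : ℝ) :
    sgn κ * neumannTerm (diagCoeff κ) (offDiag κ q) 1 x x 0 1 =
        evalFn s k (fstOp hk hκ hl u) x ∧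
      sgn κ * neumannTerm (diagCoeff κ) (offDiag κ q) 1 x x 1 0 =
        evalFn s k (sndOp hk hκ hl (negConjReflect u)) x := by
  rw [neumannTerm_congr (offDiag_congr κ hqψ)]
  constructor
  · rw [(sgn_mul_neumannTerm_one h0 ψ x).1]
    refine (eq_integral_resKer (F := fun z => -(κ * ψ z))
      (u := evalFn s k (fstOp hk hκ hl u)) (mul_ne_zero two_ne_zero h0) (fun x => ?_)
      (continuous_const.mul ψ.continuous).neg (ψ.integrable.const_mul κ).neg
      (norm_evalFn_le hs hk (fstOp hk hκ hl u)) x).symm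
    refine (hasDerivAt_evalFn_fstOp hk hκ hl (𝓕 ψ : 𝓢(ℝ, ℂ)).integrable hu x).congr_deriv ?_
    rw [fourierInv_fourier_schwartz]
    push_cast
    ring
  · rw [(sgn_mul_neumannTerm_one h0 ψ x).2]
    have hir : Integrable fun z => κ * (-(starRingEnd ℂ) (ψ z)) := by
      have : Integrable fun z => star (ψ z) :=
        (Complex.conjLIE.toContinuousLinearEquiv : ℂ →L[ℝ] ℂ).integrable_comp ψ.integrable
      exact this.neg.const_mul κ
    refine (eq_integral_resKer (F := fun z => κ * (-(starRingEnd ℂ) (ψ z)))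
      (u := evalFn s k (sndOp hk hκ hl (negConjReflect u)))
      (neg_ne_zero.2 (mul_ne_zero two_ne_zero h0)) (fun x => ?_)
      (continuous_const.mul (Complex.continuous_conj.comp ψ.continuous).neg) hir
      (norm_evalFn_le hs hk (sndOp hk hκ hl (negConjReflect u))) x).symm
    refine (hasDerivAt_evalFn_sndOp hk hκ hl (𝓕 ψ : 𝓢(ℝ, ℂ)).integrable hu x).congr_deriv ?_
    rw [fourierInv_fourier_schwartz]
    push_cast
    ring

/-- Schwartz functions are dense in `L²`, hence dense in the open ball. -/
theorem eq_of_eq_schwartz {f g : Lp ℂ 2 (volume : Measure ℝ) → ℂ} {ρ : ℝ}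
    (hf : ContinuousOn f (Metric.ball 0 ρ)) (hg : ContinuousOn g (Metric.ball 0 ρ))
    (h : ∀ ψ : 𝓢(ℝ, ℂ), (ψ.toLp 2 : Lp ℂ 2 (volume : Measure ℝ)) ∈ Metric.ball 0 ρ →
        f (ψ.toLp 2) = g (ψ.toLp 2))
    {q : Lp ℂ 2 (volume : Measure ℝ)} (hq : q ∈ Metric.ball 0 ρ) : f q = g q := by
  have hdense := Dense.open_subset_closure_inter (SchwartzMap.denseRange_toLpCLM (E := ℝ) (F := ℂ)
    (p := 2) (μ := volume) ENNReal.ofNat_ne_top) (Metric.isOpen_ball (x := 0) (ε := ρ))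
  refine Set.EqOn.of_subset_closure ?_ hf hg Set.inter_subset_left hdense hq
  rintro _ ⟨hS, ψ, rfl⟩
  exact h ψ hS

set_option maxHeartbeats 1600000 in
theorem green_eq_evalFn (h1 : (lam κ : ℂ) = Complex.I * κ ^ 2)
    {γ : Lp ℂ 2 (volume : Measure ℝ) → Lp ℂ 2 (volume : Measure ℝ)}
    (hγc : ContinuousOn γ (Metric.ball 0 (solRadius s)))
    (hγ : ∀ u ∈ Metric.ball (0 : Lp ℂ 2 (volume : Measure ℝ)) (solRadius s),
        ‖γ u‖ ≤ 8 * bilinBound s * ‖u‖ ^ 2 ∧ (∀ x, ‖evalFn s k (γ u) x‖ ≤ 2 / 3) ∧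
        ∀ x, evalFn s k (γ u) x ^ 2 + 2 * evalFn s k (γ u) x +
          4 * (evalFn s k (fstOp hk hκ hl u + fstBilin hs hs' hk hκ hl u (γ u) :
              Lp ℂ 2 (volume : Measure ℝ)) x *
            evalFn s k (sndOp hk hκ hl (negConjReflect u) + sndBilin hs hs' hk hκ hl u (γ u) :
              Lp ℂ 2 (volume : Measure ℝ)) x) = 0)
    {q : Lp ℂ 2 (volume : Measure ℝ)}
    (hq : q ∈ Metric.ball (0 : Lp ℂ 2 (volume : Measure ℝ)) (potRadius s)) (x : ℝ) :
    (g12 κ q x = evalFn s k (fstOp hk hκ hl (weighted hs' hk q) +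
        fstBilin hs hs' hk hκ hl (weighted hs' hk q) (γ (weighted hs' hk q)) :
          Lp ℂ 2 (volume : Measure ℝ)) x ∧
      g21 κ q x = evalFn s k (sndOp hk hκ hl (negConjReflect (weighted hs' hk q)) +
        sndBilin hs hs' hk hκ hl (weighted hs' hk q) (γ (weighted hs' hk q)) :
          Lp ℂ 2 (volume : Measure ℝ)) x) ∧
    (g12Term κ q 1 x = evalFn s k (fstOp hk hκ hl (weighted hs' hk q)) x ∧
      g21Term κ q 1 x = evalFn s k (sndOp hk hκ hl (negConjReflect (weighted hs' hk q))) x) := by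
  set S := Metric.ball (0 : Lp ℂ 2 (volume : Measure ℝ)) (potRadius s)
  have hsmall : ∀ q ∈ S, SmallPot κ q := fun q hq => smallPot_of_mem hk hκ hl h1 hq
  have hsub : S ⊆ Metric.closedBall 0 (1 / 4) := fun q hq => by
    rw [mem_closedBall_zero_iff]
    exact (mem_ball_zero_iff.1 hq).le.trans (min_le_left _ _)
  have hW : ContinuousOn (fun q => weighted hs' hk q) S := (weighted hs' hk).continuous.continuousOn
  have hγW : ContinuousOn (fun q => γ (weighted hs' hk q)) S :=
    hγc.comp hW fun q hq => weighted_mem hs' hk hq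
  have hκ0 : 0 < ‖κ‖ := by rw [hκ]; exact hk
  have hl' : |lam κ| = ‖κ‖ ^ 2 := by rw [hκ, hl]
  have hev : ∀ {f : Lp ℂ 2 (volume : Measure ℝ) → Lp ℂ 2 (volume : Measure ℝ)},
      ContinuousOn f S → ContinuousOn (fun q => evalFn s k (f q) x) S := fun hf =>
    (evalCLM hs hk x).continuous.comp_continuousOn hf
  have hJ : ContinuousOn (fun q => negConjReflect (weighted hs' hk q)) S :=
    negConjReflect.continuous.comp_continuousOn hW
  have c1 : ContinuousOn (fun q => fstOp hk hκ hl (weighted hs' hk q)) S :=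
    (fstOp hk hκ hl).continuous.comp_continuousOn hW
  have c2 : ContinuousOn (fun q => sndOp hk hκ hl (negConjReflect (weighted hs' hk q))) S :=
    (sndOp hk hκ hl).continuous.comp_continuousOn hJ
  have c3 : ContinuousOn (fun q => fstBilin hs hs' hk hκ hl (weighted hs' hk q)
      (γ (weighted hs' hk q))) S :=
    ((fstBilin hs hs' hk hκ hl).continuous.comp_continuousOn hW).clm_apply hγW
  have c4 : ContinuousOn (fun q => sndBilin hs hs' hk hκ hl (weighted hs' hk q)
      (γ (weighted hs' hk q))) S :=
    ((sndBilin hs hs' hk hκ hl).continuous.comp_continuousOn hW).clm_apply hγW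
  -- For Schwartz potentials the differential equations are classical, so the column construction
  -- applies; continuity in `q` at the fixed point `x` carries the four identities to the whole
  -- ball.
  have key : ∀ ψ : 𝓢(ℝ, ℂ), (ψ.toLp 2 : Lp ℂ 2 (volume : Measure ℝ)) ∈ S → _ := fun ψ hψ =>
    neumannSum_schwartz hs hs' hk hκ hl (ψ.coeFn_toLp 2) (hsmall _ hψ)
      (weighted_schwartz hs' hk ψ) (hγ _ (weighted_mem hs' hk hψ)).2.1
      (hγ _ (weighted_mem hs' hk hψ)).2.2 x
  have d := hsmall q hq
  have key' : ∀ ψ : 𝓢(ℝ, ℂ), _ := fun ψ =>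
    neumannTerm_one_schwartz hk hκ hl hs (ψ.coeFn_toLp 2) d.lam_ne (weighted_schwartz hs' hk ψ) x
  rw [d.g12_eq, d.g21_eq, d.g12Term_eq, d.g21Term_eq]
  refine ⟨⟨?_, ?_⟩, ?_, ?_⟩
  · exact eq_of_eq_schwartz ((continuousOn_neumannSum h1 hκ0 hl' x 0 1).mono hsub)
      (hev (c1.add c3)) (fun ψ hψ => (key ψ hψ).1) hq
  · exact eq_of_eq_schwartz ((continuousOn_neumannSum h1 hκ0 hl' x 1 0).mono hsub)
      (hev (c2.add c4)) (fun ψ hψ => (key ψ hψ).2) hq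
  · exact eq_of_eq_schwartz ((continuousOn_neumannTerm_one h1 hκ0 hl' x 0 1).mono hsub)
      (hev c1) (fun ψ _ => (key' ψ).1) hq
  · exact eq_of_eq_schwartz ((continuousOn_neumannTerm_one h1 hκ0 hl' x 1 0).mono hsub)
      (hev c2) (fun ψ _ => (key' ψ).2) hq

end Identify

end DNLSGreen

end

noncomputable section

namespace DNLSGreen

open Filter Topology

/-! ### Rapid decay -/

/-- Functions that decay faster than every power. -/
def Rapid (f : ℝ → ℂ) : Prop := ∀ n : ℕ, ∃ C, ∀ x, |x| ^ n * ‖f x‖ ≤ C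

/-- Functions that decay faster than every power together with their first `k` derivatives. -/
def RapidDiff : ℕ → (ℝ → ℂ) → Prop
  | 0, f => Rapid f
  | k + 1, f => Rapid f ∧ ∃ f', (∀ x, HasDerivAt f (f' x) x) ∧ RapidDiff k f'

theorem RapidDiff.rapid {k : ℕ} {f : ℝ → ℂ} (h : RapidDiff k f) : Rapid f := by
  cases k with
  | zero => exact h
  | succ k => exact h.1

theorem RapidDiff.of_succ {k : ℕ} {f : ℝ → ℂ} (h : RapidDiff (k + 1) f) : RapidDiff k f := by
  induction k generalizing f with
  | zero => exact h.1
  | succ k ih =>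
    obtain ⟨h1, f', h2, h3⟩ := h
    exact ⟨h1, f', h2, ih h3⟩

theorem Rapid.add {f g : ℝ → ℂ} (hf : Rapid f) (hg : Rapid g) : Rapid fun x => f x + g x := by
  intro n
  obtain ⟨C, hC⟩ := hf n
  obtain ⟨D, hD⟩ := hg n
  refine ⟨C + D, fun x => ?_⟩
  calc |x| ^ n * ‖f x + g x‖ ≤ |x| ^ n * (‖f x‖ + ‖g x‖) := by
        gcongr
        exact norm_add_le _ _
    _ ≤ C + D := by
        rw [mul_add]
        exact add_le_add (hC x) (hD x)

theorem Rapid.of_norm_le {f g : ℝ → ℂ} (hf : Rapid f) {M : ℝ} (hM : 0 ≤ M)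
    (h : ∀ x, ‖g x‖ ≤ M * ‖f x‖) : Rapid g := by
  intro n
  obtain ⟨C, hC⟩ := hf n
  refine ⟨M * C, fun x => ?_⟩
  calc |x| ^ n * ‖g x‖ ≤ |x| ^ n * (M * ‖f x‖) := by
        gcongr
        exact h x
    _ = M * (|x| ^ n * ‖f x‖) := by ring
    _ ≤ M * C := mul_le_mul_of_nonneg_left (hC x) hM

theorem Rapid.mul {f g : ℝ → ℂ} (hf : Rapid f) (hg : Rapid g) : Rapid fun x => f x * g x := by
  obtain ⟨C, hC⟩ := hg 0
  have h0 : 0 ≤ C := (mul_nonneg (pow_nonneg (abs_nonneg 0) 0) (norm_nonneg (g 0))).trans (hC 0)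
  refine hf.of_norm_le h0 fun x => ?_
  have := hC x
  rw [pow_zero, one_mul] at this
  rw [norm_mul, mul_comm]
  exact mul_le_mul_of_nonneg_right this (norm_nonneg _)

theorem Rapid.const_mul {f : ℝ → ℂ} (hf : Rapid f) (c : ℂ) : Rapid fun x => c * f x :=
  hf.of_norm_le (norm_nonneg c) fun x => (norm_mul c (f x)).le

theorem RapidDiff.add {k : ℕ} {f g : ℝ → ℂ} (hf : RapidDiff k f) (hg : RapidDiff k g) :
    RapidDiff k fun x => f x + g x := by
  induction k generalizing f g with
  | zero => exact Rapid.add hf hg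
  | succ k ih =>
    obtain ⟨h1, f', h2, h3⟩ := hf
    obtain ⟨k1, g', k2, k3⟩ := hg
    exact ⟨h1.add k1, _, fun x => (h2 x).add (k2 x), ih h3 k3⟩

theorem RapidDiff.const_mul {k : ℕ} {f : ℝ → ℂ} (hf : RapidDiff k f) (c : ℂ) :
    RapidDiff k fun x => c * f x := by
  induction k generalizing f with
  | zero => exact Rapid.const_mul hf c
  | succ k ih =>
    obtain ⟨h1, f', h2, h3⟩ := hf
    exact ⟨h1.const_mul c, _, fun x => (h2 x).const_mul c, ih h3⟩

theorem RapidDiff.mul {k : ℕ} {f g : ℝ → ℂ} (hf : RapidDiff k f) (hg : RapidDiff k g) :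
    RapidDiff k fun x => f x * g x := by
  induction k generalizing f g with
  | zero => exact Rapid.mul hf hg
  | succ k ih =>
    have hf0 := hf.of_succ
    have hg0 := hg.of_succ
    obtain ⟨h1, f', h2, h3⟩ := hf
    obtain ⟨k1, g', k2, k3⟩ := hg
    exact ⟨h1.mul k1, _, fun x => (h2 x).mul (k2 x), (ih h3 hg0).add (ih hf0 k3)⟩

theorem RapidDiff.conj {k : ℕ} {f : ℝ → ℂ} (hf : RapidDiff k f) :
    RapidDiff k fun x => (starRingEnd ℂ) (f x) := by
  induction k generalizing f with
  | zero => exact Rapid.of_norm_le hf zero_le_one fun x => by simp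
  | succ k ih =>
    obtain ⟨h1, f', h2, h3⟩ := hf
    exact ⟨h1.of_norm_le zero_le_one fun x => by simp, _, fun x => (h2 x).star, ih h3⟩

theorem rapidDiff_schwartz (k : ℕ) (ψ : 𝓢(ℝ, ℂ)) : RapidDiff k ψ := by
  have h0 : ∀ ψ : 𝓢(ℝ, ℂ), Rapid ψ := fun ψ n => by
    obtain ⟨C, -, hC⟩ := ψ.decay n 0
    exact ⟨C, fun x => by simpa using hC x⟩
  induction k generalizing ψ with
  | zero => exact h0 ψ
  | succ k ih =>
    refine ⟨h0 ψ, _, fun x => ?_, ih (SchwartzMap.derivCLM ℝ ℂ ψ)⟩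
    rw [SchwartzMap.derivCLM_apply]
    exact ψ.differentiableAt.hasDerivAt

theorem RapidDiff.contDiff {k : ℕ} {f : ℝ → ℂ} (h : RapidDiff (k + 1) f) : ContDiff ℝ k f := by
  induction k generalizing f with
  | zero =>
    obtain ⟨-, f', h2, -⟩ := h
    exact contDiff_zero.2 (continuous_iff_continuousAt.2 fun x => (h2 x).continuousAt)
  | succ k ih =>
    obtain ⟨-, f', h2, h3⟩ := h
    have e : deriv f = f' := funext fun x => (h2 x).deriv
    rw [Nat.cast_succ, contDiff_succ_iff_deriv]
    exact ⟨fun x => (h2 x).differentiableAt, by simp, e ▸ ih h3⟩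

theorem RapidDiff.iteratedDeriv {k : ℕ} {f : ℝ → ℂ} (h : RapidDiff k f) :
    Rapid (iteratedDeriv k f) := by
  induction k generalizing f with
  | zero => simpa using h.rapid
  | succ k ih =>
    obtain ⟨-, f', h2, h3⟩ := h
    have e : deriv f = f' := funext fun x => (h2 x).deriv
    rw [iteratedDeriv_succ', e]
    exact ih h3

theorem exists_schwartz {f : ℝ → ℂ} (h : ∀ k, RapidDiff k f) : ∃ φ : 𝓢(ℝ, ℂ), ∀ x, φ x = f x := by
  refine ⟨⟨f, contDiff_infty.2 fun n => (h (n + 1)).contDiff, fun k n => ?_⟩, fun x => rfl⟩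
  obtain ⟨C, hC⟩ := (h n).iteratedDeriv k
  refine ⟨C, fun x => ?_⟩
  rw [norm_iteratedFDeriv_eq_norm_iteratedDeriv, Real.norm_eq_abs]
  exact hC x

/-- The bounded solution of `u' + μ u = F` decays rapidly if `F` is dominated by a Schwartz
function. -/
theorem rapid_of_hasDerivAt {μ : ℝ} (hμ : μ ≠ 0) {C M : ℝ} {u F : ℝ → ℂ} {ψ : 𝓢(ℝ, ℂ)}
    (h : ∀ x, HasDerivAt u (-μ * u x + F x) x) (hF : Continuous F)
    (hψ : ∀ x, ‖F x‖ ≤ M * ‖ψ x‖) (hb : ∀ x, ‖u x‖ ≤ C) : Rapid u := by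
  have hi : Integrable F := (ψ.integrable.norm.const_mul M).mono' hF.aestronglyMeasurable
    (ae_of_all _ hψ)
  intro n
  have hc : 0 < |μ| := abs_pos.2 hμ
  -- The exponential dominates the term of order `n` of its Taylor series at `|μ|(1 + t)`.
  obtain ⟨K, hK⟩ : ∃ K, ∀ t : ℝ, 0 ≤ t → Real.exp (-|μ| * t) * (1 + t) ^ n ≤ K := by
    refine ⟨Real.exp |μ| * (n.factorial / |μ| ^ n), fun t ht => ?_⟩
    have h1 := Real.pow_div_factorial_le_exp (x := |μ| * (1 + t)) (by positivity) n
    rw [div_le_iff₀ (by positivity), mul_pow] at h1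
    have h2 : (1 + t) ^ n ≤ Real.exp (|μ| * (1 + t)) * (n.factorial / |μ| ^ n) := by
      rw [← mul_div_assoc, le_div_iff₀ (by positivity)]
      linarith
    calc Real.exp (-|μ| * t) * (1 + t) ^ n
        ≤ Real.exp (-|μ| * t) * (Real.exp (|μ| * (1 + t)) * (n.factorial / |μ| ^ n)) := by gcongr
      _ = _ := by
        rw [← mul_assoc, ← Real.exp_add]
        congr 2
        ring
  have hint : Integrable fun z => (1 + |z|) ^ n * ‖F z‖ := by
    have h1 : Integrable fun z => M * ((2 : ℝ) ^ n * (‖ψ z‖ + ‖z‖ ^ n * ‖ψ z‖)) :=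
      ((ψ.integrable.norm.add (ψ.integrable_pow_mul volume n)).const_mul _).const_mul _
    refine h1.mono' (by fun_prop) (ae_of_all _ fun z => ?_)
    rw [Real.norm_of_nonneg (by positivity)]
    have h2 : (1 + |z|) ^ n ≤ 2 ^ n * (1 + |z| ^ n) := by
      calc (1 + |z|) ^ n ≤ (2 * max 1 |z|) ^ n := by
            refine pow_le_pow_left₀ (by positivity) ?_ n
            have := le_max_left 1 |z|
            have := le_max_right 1 |z|
            linarith
        _ = 2 ^ n * (max 1 |z|) ^ n := mul_pow _ _ _
        _ ≤ 2 ^ n * (1 + |z| ^ n) := by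
            gcongr
            rcases max_cases 1 |z| with h | h <;> rw [h.1]
            · simp
            · linarith
    calc (1 + |z|) ^ n * ‖F z‖ ≤ (2 ^ n * (1 + |z| ^ n)) * (M * ‖ψ z‖) :=
          mul_le_mul h2 (hψ z) (norm_nonneg _) (by positivity)
      _ = _ := by
          rw [Real.norm_eq_abs]
          ring
  refine ⟨∫ z, K * ((1 + |z|) ^ n * ‖F z‖), fun x => ?_⟩
  rw [eq_integral_resKer hμ h hF hi hb x]
  have e : |x| ^ n * ‖∫ z, resKer μ x z * F z‖ = ‖∫ z, ((|x| ^ n : ℝ) : ℂ) * (resKer μ x z * F z)‖ := by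
    rw [integral_const_mul, norm_mul, Complex.norm_real, Real.norm_of_nonneg (by positivity)]
  rw [e]
  refine norm_integral_le_of_norm_le (hint.const_mul K) (ae_of_all _ fun z => ?_)
  rw [norm_mul, norm_mul, Complex.norm_real, Real.norm_of_nonneg (by positivity), ← mul_assoc,
    ← mul_assoc]
  refine mul_le_mul_of_nonneg_right ?_ (norm_nonneg _)
  -- The weight in `x` is distributed between the kernel, which decays exponentially in `|x - z|`,
  -- and the source, which decays rapidly in `z`.
  have h3 : |x| ≤ (1 + |x - z|) * (1 + |z|) := by
    have h4 : |x| ≤ |x - z| + |z| := by simpa using abs_add_le (x - z) z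
    nlinarith [abs_nonneg (x - z), abs_nonneg z]
  calc |x| ^ n * ‖resKer μ x z‖
      ≤ ((1 + |x - z|) * (1 + |z|)) ^ n * Real.exp (-|μ| * |x - z|) :=
        mul_le_mul (pow_le_pow_left₀ (abs_nonneg _) h3 n) (norm_resKer_le μ x z) (norm_nonneg _)
          (by positivity)
    _ = (Real.exp (-|μ| * |x - z|) * (1 + |x - z|) ^ n) * (1 + |z|) ^ n := by
        rw [mul_pow]
        ring
    _ ≤ K * (1 + |z|) ^ n := by
        gcongr
        exact hK _ (abs_nonneg _)

/-! ### Schwartz regularity of the solutions of the system. -/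

namespace IsDiagSolution

variable {l : ℝ} {κ : ℂ} {ψ : 𝓢(ℝ, ℂ)} {g h γ : ℝ → ℂ}

theorem one_add_ne {q : ℝ → ℂ} (H : IsDiagSolution l κ q g h γ) (x : ℝ) : 1 + γ x ≠ 0 := by
  intro h
  have h1 : γ x = -1 := by linear_combination h
  have h2 := H.norm_le x
  rw [h1, norm_neg, norm_one] at h2
  norm_num at h2

theorem hasDerivAt_γ {q : ℝ → ℂ} (H : IsDiagSolution l κ q g h γ) (x : ℝ) :
    HasDerivAt γ (2 * κ * (q x * h x + (starRingEnd ℂ) (q x) * g x)) x := by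
  have h1 : HasDerivAt (fun z => 1 - 4 * (g z * h z))
      (4 * (1 + γ x) * (κ * (q x * h x + (starRingEnd ℂ) (q x) * g x))) x := by
    refine ((((H.hasDerivAt_fst x).mul (H.hasDerivAt_snd x)).const_mul 4).const_sub 1).congr_deriv ?_
    ring
  have h2 := hasDerivAt_of_sq (f := fun z => 1 + γ z)
    (continuous_const.add H.continuous).continuousAt (H.one_add_ne x) h1
    fun z => by linear_combination H.quadratic z
  have h3 := h2.const_add (-1)
  have e : (fun z => -1 + (1 + γ z)) = γ := funext fun z => by ring
  rw [e] at h3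
  refine h3.congr_deriv ?_
  have := H.one_add_ne x
  field_simp
  ring

/-- Boundedness of `γ` makes the sources of the equations for `g` and `h` dominated by `ψ`, which
gives the decay of both. Then `γ(1 + γ/2) = -2gh` with `|1 + γ/2| ≥ 1/2` gives that of `γ`.
Derivatives are polynomials in `g`, `h`, `γ`, `ψ` and its conjugate, so one derivative is gained at
each step. -/
theorem rapidDiff (H : IsDiagSolution l κ ψ g h γ) (hl : l ≠ 0) (k : ℕ) :
    RapidDiff k g ∧ RapidDiff k h ∧ RapidDiff k γ := by
  obtain ⟨C, hC⟩ := H.bounded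
  have hb : ∀ x, ‖1 + γ x‖ ≤ 2 := fun x => by
    have h1 := norm_add_le 1 (γ x)
    have h2 := H.norm_le x
    rw [norm_one] at h1
    linarith
  have hbound : ∀ x (z : ℂ), ‖z‖ = ‖ψ x‖ → ‖κ * z * (1 + γ x)‖ ≤ (2 * ‖κ‖) * ‖ψ x‖ := by
    intro x z hz
    rw [norm_mul, norm_mul, hz]
    have := mul_le_mul_of_nonneg_left (hb x) (by positivity : 0 ≤ ‖κ‖ * ‖ψ x‖)
    linarith
  have hγ := H.continuous
  have hψ := ψ.continuous
  have hg : Rapid g := rapid_of_hasDerivAt (μ := 2 * l) (mul_ne_zero two_ne_zero hl)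
    (F := fun x => -(κ * ψ x * (1 + γ x))) (ψ := ψ) (M := 2 * ‖κ‖) (C := C)
    (fun x => (H.hasDerivAt_fst x).congr_deriv (by push_cast; ring)) (by fun_prop)
    (fun x => by rw [norm_neg]; exact hbound x _ rfl) fun x => (hC x).1
  have hconj : Continuous fun x => (starRingEnd ℂ) (ψ x) := Complex.continuous_conj.comp hψ
  have hh : Rapid h := rapid_of_hasDerivAt (μ := -(2 * l))
    (neg_ne_zero.2 (mul_ne_zero two_ne_zero hl))
    (F := fun x => κ * (-(starRingEnd ℂ) (ψ x)) * (1 + γ x)) (ψ := ψ) (M := 2 * ‖κ‖) (C := C)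
    (fun x => (H.hasDerivAt_snd x).congr_deriv (by push_cast; ring)) (by fun_prop)
    (fun x => hbound x _ (by simp)) fun x => (hC x).2
  have hγr : Rapid γ := by
    refine (hg.mul hh).of_norm_le (M := 4) (by norm_num) fun x => ?_
    have h1 : γ x * (1 + γ x / 2) = -2 * (g x * h x) := by
      linear_combination (1 / 2 : ℂ) * H.quadratic x
    have h2 : 1 / 2 ≤ ‖1 + γ x / 2‖ := by
      have h3 := norm_sub_le (1 + γ x / 2) (γ x / 2)
      rw [add_sub_cancel_right, norm_one, norm_div, Complex.norm_two] at h3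
      have h4 := H.norm_le x
      linarith
    have h5 := congrArg norm h1
    rw [norm_mul, norm_mul, norm_neg, Complex.norm_two] at h5
    have := mul_le_mul_of_nonneg_left h2 (norm_nonneg (γ x))
    linarith
  induction k with
  | zero => exact ⟨hg, hh, hγr⟩
  | succ k ih =>
    obtain ⟨ig, ih, iγ⟩ := ih
    have iψ := rapidDiff_schwartz k ψ
    refine ⟨⟨hg, fun x => (-2 * l) * g x + (-κ) * (ψ x + ψ x * γ x), fun x => ?_, ?_⟩,
      ⟨hh, fun x => (2 * l) * h x + (-κ) * ((starRingEnd ℂ) (ψ x) + (starRingEnd ℂ) (ψ x) * γ x),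
        fun x => ?_, ?_⟩,
      ⟨hγr, fun x => (2 * κ) * (ψ x * h x + (starRingEnd ℂ) (ψ x) * g x), fun x => ?_, ?_⟩⟩
    · exact (H.hasDerivAt_fst x).congr_deriv (by ring)
    · exact (ig.const_mul _).add ((iψ.add (iψ.mul iγ)).const_mul _)
    · exact (H.hasDerivAt_snd x).congr_deriv (by ring)
    · exact (ih.const_mul _).add ((iψ.conj.add (iψ.conj.mul iγ)).const_mul _)
    · exact H.hasDerivAt_γ x
    · exact ((iψ.mul ih).add (iψ.conj.mul ig)).const_mul _

end IsDiagSolution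

end DNLSGreen

end

noncomputable section

namespace DNLSGreen

open FourierTransform

/-! ### Norms and charts -/

theorem enorm_ofReal_mul {f w : Lp ℂ 2 (volume : Measure ℝ)} {c : ℝ} (hc : 0 ≤ c)
    (h : w = (c : ℂ) • f) : ‖w‖ₑ = ENNReal.ofReal (c * ‖f‖) := by
  rw [h, ← ofReal_norm, norm_smul, Complex.norm_real, Real.norm_of_nonneg hc]

theorem fnNorm_evalFn {s k : ℝ} (hs : 0 < s) (hk : 0 < k) (v : Lp ℂ 2 (volume : Measure ℝ)) :
    fnNorm (s + 1 / 2) k (evalFn s k v) = ENNReal.ofReal (k ^ (2 * s) * ‖v‖) := by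
  have hm := memLp_evalFn hs hk v
  rw [fnNorm, dif_pos hm, sobNorm_eq (s + 1 / 2) hk.ne' (w := ((k ^ (2 * s) : ℝ) : ℂ) • v),
    enorm_ofReal_mul (by positivity) rfl]
  filter_upwards [Lp.coeFn_smul ((k ^ (2 * s) : ℝ) : ℂ) v, fourier_toLp_evalFn hs hk v hm]
    with η h1 h2
  rw [h1, h2, Pi.smul_apply, smul_eq_mul, ← mul_assoc, ← Complex.ofReal_mul]
  congr 2
  rw [thetaW, symbol_neg _ hk]
  have := symbol_pos (s + 1 / 2) hk η
  generalize symbol (s + 1 / 2) k η = y at this ⊢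
  field_simp

/-- Together with `fnNorm_evalFn` this shows the powers of `k` hidden in the weights: `k^(2s-1)` on
the side of `q` and `k^(2s)` on the side of `g`. Their quotient is the factor `|κ|` in both
estimates. -/
theorem fnNorm_eq_weighted {s k : ℝ} (hs' : s < 1 / 2) (hk : 0 < k)
    (q : Lp ℂ 2 (volume : Measure ℝ)) :
    fnNorm (s - 1 / 2) k q = ENNReal.ofReal (k ^ (2 * s - 1) * ‖weighted hs' hk q‖) := by
  rw [fnNorm, dif_pos (Lp.memLp q), Lp.toLp_coeFn,
    sobNorm_eq (s - 1 / 2) hk.ne' (w := ((k ^ (2 * s - 1) : ℝ) : ℂ) • weighted hs' hk q),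
    enorm_ofReal_mul (by positivity) rfl]
  filter_upwards [Lp.coeFn_smul ((k ^ (2 * s - 1) : ℝ) : ℂ) (weighted hs' hk q),
    weighted_apply hs' hk q] with η h1 h2
  rw [h1, Pi.smul_apply, smul_eq_mul, h2, ← mul_assoc, ← Complex.ofReal_mul]
  congr 2
  rw [tauW, ← mul_assoc, ← Real.rpow_add hk]
  simp

/-- A chart on the Fourier side gives a diffeomorphism of Sobolev spaces. -/
theorem isAnalyticDiffeoInto_of_chart {s k : ℝ} (hs : 0 < s) (hs' : s < 1 / 2) (hk1 : 1 ≤ k)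
    (hk : 0 < k) {B : Set (Lp ℂ 2 (volume : Measure ℝ))}
    {F : Lp ℂ 2 (volume : Measure ℝ) → ℝ → ℂ}
    {Φ : OpenPartialHomeomorph (Lp ℂ 2 (volume : Measure ℝ)) (Lp ℂ 2 (volume : Measure ℝ))}
    (h1 : AnalyticOnNhd ℝ Φ Φ.source) (h2 : AnalyticOnNhd ℝ Φ.symm Φ.target)
    (h3 : ∀ q ∈ B, weighted hs' hk q ∈ Φ.source ∧ F q = evalFn s k (Φ (weighted hs' hk q))) :
    IsAnalyticDiffeoInto (s - 1 / 2) (s + 1 / 2) B F := by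
  have hd1 : 0 < k ^ (1 - 2 * s) := by positivity
  have hd2 : 0 < k ^ (-(2 * s)) := by positivity
  set E₁ := sobolevEquiv (s - 1 / 2) hk1 hd1
  set E₂ := sobolevEquiv (s + 1 / 2) hk1 hd2
  refine ⟨(E₁.toHomeomorph.transOpenPartialHomeomorph Φ).transHomeomorph E₂.symm.toHomeomorph,
    ?_, ?_, fun q hq => ?_⟩
  · intro p hp
    exact (E₂.symm : _ →L[ℝ] Sobolev (s + 1 / 2)).analyticAt _ |>.comp
      ((h1 (E₁ p) hp).comp (E₁.analyticAt p))
  · intro p hp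
    exact (E₁.symm : _ →L[ℝ] Sobolev (s - 1 / 2)).analyticAt _ |>.comp
      ((h2 (E₂ p) hp).comp (E₂.analyticAt p))
  · obtain ⟨hsrc, hF⟩ := h3 q hq
    have hm : MemLp (F q) 2 volume := hF ▸ memLp_evalFn hs hk _
    have e1 : E₁ (E₁.symm (weighted hs' hk q)) = weighted hs' hk q := E₁.apply_symm_apply _
    refine ⟨E₁.symm (weighted hs' hk q), ?_, ?_, hm, ?_⟩
    · change E₁ (E₁.symm (weighted hs' hk q)) ∈ Φ.source
      rwa [e1]
    · refine toDist_eq_of_sobolevEquiv hk1 hd1 ?_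
      change E₁ (E₁.symm (weighted hs' hk q)) =ᵐ[volume] _
      rw [e1]
      exact weighted_apply hs' hk q
    · refine toDist_eq_of_sobolevEquiv hk1 hd2 ?_
      have e2 : sobolevEquiv (s + 1 / 2) hk1 hd2
          (((E₁.toHomeomorph.transOpenPartialHomeomorph Φ).transHomeomorph
            E₂.symm.toHomeomorph) (E₁.symm (weighted hs' hk q))) = Φ (weighted hs' hk q) := by
        change E₂ (E₂.symm (Φ (E₁ (E₁.symm (weighted hs' hk q))))) = _
        rw [e1, E₂.apply_symm_apply]
      rw [e2]
      have e3 : hm.toLp (F q) = (memLp_evalFn hs hk (Φ (weighted hs' hk q))).toLp _ :=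
        MemLp.toLp_congr _ _ (by rw [hF])
      rw [e3]
      filter_upwards [fourier_toLp_evalFn hs hk (Φ (weighted hs' hk q)) (memLp_evalFn hs hk _)]
        with η hη
      rw [hη, ← mul_assoc, ← Complex.ofReal_mul, thetaW, symbol_neg _ hk]
      have h4 := symbol_pos (s + 1 / 2) hk η
      have h5 : k ^ (-(2 * s)) * symbol (s + 1 / 2) k η *
          (k ^ (2 * s) * (symbol (s + 1 / 2) k η)⁻¹) = 1 := by
        rw [Real.rpow_neg hk.le]
        have : 0 < k ^ (2 * s) := by positivity
        generalize symbol (s + 1 / 2) k η = y at h4 ⊢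
        generalize k ^ (2 * s) = z at this ⊢
        field_simp
      rw [h5]
      simp

theorem lam_eq_of_im_eq_zero {κ : ℂ} (h : (Complex.I * κ ^ 2).im = 0) :
    (lam κ : ℂ) = Complex.I * κ ^ 2 := by
  apply Complex.ext
  · simp only [lam, Complex.ofReal_re]
  · rw [h, Complex.ofReal_im]

theorem abs_lam_of_im_eq_zero {κ : ℂ} (h : (Complex.I * κ ^ 2).im = 0) : |lam κ| = ‖κ‖ ^ 2 := by
  have h1 := congrArg norm (lam_eq_of_im_eq_zero h)
  rwa [Complex.norm_real, Real.norm_eq_abs, norm_mul, Complex.norm_I, one_mul, norm_pow] at h1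

end DNLSGreen

end

/-! ### The uniform estimates and the main theorem. -/

/-- The quadratic size of `γ` makes the remainder cubic; on the small ball the cubic bound is also
at most a multiple of `‖u‖`. -/
theorem DNLSGreen.norm_bilin_solution_le {b ρ : ℝ} (hb : 0 ≤ b) {H : Type*} [NormedAddCommGroup H]
    [NormedSpace ℝ H] {T : H →L[ℝ] H →L[ℝ] H} (hT : ‖T‖ ≤ b) {u γ : H}
    (hγ : ‖γ‖ ≤ 8 * b * ‖u‖ ^ 2) (hu : ‖u‖ ≤ ρ) (hρ : b * ρ ≤ 1) :
    ‖T u γ‖ ≤ 8 * b ^ 2 * ‖u‖ * ‖u‖ ^ 2 ∧ ‖T u γ‖ ≤ 8 * ‖u‖ := by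
  have h1 : ‖T u γ‖ ≤ 8 * b ^ 2 * ‖u‖ * ‖u‖ ^ 2 := by
    calc ‖T u γ‖ ≤ ‖T‖ * ‖u‖ * ‖γ‖ := T.le_opNorm₂ u γ
      _ ≤ b * ‖u‖ * (8 * b * ‖u‖ ^ 2) := by gcongr
      _ = _ := by ring
  refine ⟨h1, h1.trans ?_⟩
  have h2 : b * ‖u‖ ≤ 1 := (mul_le_mul_of_nonneg_left hu hb).trans hρ
  have h3 : 0 ≤ b * ‖u‖ := by positivity
  calc 8 * b ^ 2 * ‖u‖ * ‖u‖ ^ 2 = 8 * ‖u‖ * (b * ‖u‖) ^ 2 := by ring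
    _ ≤ 8 * ‖u‖ * 1 := by
        gcongr
        exact pow_le_one₀ h3 h2
    _ = _ := mul_one _

theorem mainTheorem5 (s : ℝ) (hs : 0 < s) (hs' : s < 1 / 2) :
    ∃ δ : ℝ, 0 < δ ∧ ∃ C : ℝ≥0, ∀ κ : ℂ, (Complex.I * κ ^ 2).im = 0 → 1 ≤ ‖κ‖ →
      (∀ q ∈ DNLSGreen.sobolevBall s δ, ∃! G, DNLSGreen.IsGreen κ q G) ∧
      DNLSGreen.IsAnalyticDiffeoInto (s - 1 / 2) (s + 1 / 2) (DNLSGreen.sobolevBall s δ)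
        (fun q => DNLSGreen.g12 κ q) ∧
      DNLSGreen.IsAnalyticDiffeoInto (s - 1 / 2) (s + 1 / 2) (DNLSGreen.sobolevBall s δ)
        (fun q => DNLSGreen.g21 κ q) ∧
      ∀ q ∈ DNLSGreen.sobolevBall s δ,
        DNLSGreen.fnNorm (s + 1 / 2) ‖κ‖ (DNLSGreen.g12 κ q) +
            DNLSGreen.fnNorm (s + 1 / 2) ‖κ‖ (DNLSGreen.g21 κ q) ≤
          C * ‖κ‖ₑ * DNLSGreen.fnNorm (s - 1 / 2) ‖κ‖ q ∧
        (∀ x, HasSum (fun ℓ => DNLSGreen.g12Term κ q (ℓ + 1) x) (DNLSGreen.g12 κ q x) ∧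
          HasSum (fun ℓ => DNLSGreen.g21Term κ q (ℓ + 1) x) (DNLSGreen.g21 κ q x)) ∧
        DNLSGreen.fnNorm (s + 1 / 2) ‖κ‖ (DNLSGreen.g12Tail κ q 3) +
            DNLSGreen.fnNorm (s + 1 / 2) ‖κ‖ (DNLSGreen.g21Tail κ q 3) ≤
          C * ‖κ‖ₑ * DNLSGreen.fnNorm (s - 1 / 2) ‖κ‖ q * ‖q‖ₑ ^ 2 ∧
        ((∃ ψ : 𝓢(ℝ, ℂ), q =ᵐ[volume] ψ) →
          (∃ φ : 𝓢(ℝ, ℂ), ∀ x, φ x = DNLSGreen.g12 κ q x) ∧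
          (∃ φ : 𝓢(ℝ, ℂ), ∀ x, φ x = DNLSGreen.g21 κ q x)) := by
  open DNLSGreen in
  set b := bilinBound s
  have hb : 0 ≤ b := bilinBound_nonneg s
  have hρ := potRadius_pos s
  -- Halving the radius puts the closed ball inside the open one. In the constant, `18 = 2 · (1 +
  -- 8)` bounds the isometric part plus the remainder for both entries, and `16 b² = 2 · 8 b²`
  -- bounds the two cubic remainders.
  refine ⟨potRadius s / 2, by positivity, (18 + 16 * b ^ 2).toNNReal, fun κ him hκ1 => ?_⟩
  have hball : ∀ q ∈ sobolevBall s (potRadius s / 2),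
      q ∈ Metric.ball (0 : Lp ℂ 2 (volume : Measure ℝ)) (potRadius s) := fun q hq => by
    rw [mem_ball_zero_iff]
    have := norm_le_of_mem_sobolevBall hs.le (by positivity) hq
    linarith
  have hlam := lam_eq_of_im_eq_zero him
  set k := ‖κ‖ with hκ
  have hk : 0 < k := by linarith
  have hl : |lam κ| = k ^ 2 := abs_lam_of_im_eq_zero him
  obtain ⟨γ, hγc, ⟨Φ, hΦ, hΦs, hΦa, hΦa'⟩, ⟨Ψ, hΨ, hΨs, hΨa, hΨa'⟩, hγ⟩ :=
    exists_green_maps hs hs' hk hκ.symm hl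
  have hid := fun q hq x => green_eq_evalFn hs hs' hk hκ.symm hl hlam hγc hγ (q := q) hq x
  have hsmall := fun q hq => smallPot_of_mem (s := s) (q := q) hk hκ.symm hl hlam hq
  have h12 : ∀ q ∈ sobolevBall s (potRadius s / 2),
      g12 κ q = evalFn s k (Φ (weighted hs' hk q)) := fun q hq => funext fun x => by
    rw [(hid q (hball q hq) x).1.1, hΦ]
  have h21 : ∀ q ∈ sobolevBall s (potRadius s / 2),
      g21 κ q = evalFn s k (Ψ (weighted hs' hk q)) := fun q hq => funext fun x => by
    rw [(hid q (hball q hq) x).1.2, hΨ]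
  refine ⟨fun q hq => (hsmall q (hball q hq)).existsUnique_isGreen, ?_, ?_, fun q hq => ?_⟩
  · exact isAnalyticDiffeoInto_of_chart hs hs' hκ1 hk hΦa hΦa' fun q hq =>
      ⟨hΦs ▸ weighted_mem hs' hk (hball q hq), h12 q hq⟩
  · exact isAnalyticDiffeoInto_of_chart hs hs' hκ1 hk hΨa hΨa' fun q hq =>
      ⟨hΨs ▸ weighted_mem hs' hk (hball q hq), h21 q hq⟩
  have hqb := hball q hq
  have d := hsmall q hqb
  set u := weighted hs' hk q
  have hu : u ∈ Metric.ball (0 : Lp ℂ 2 (volume : Measure ℝ)) (solRadius s) :=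
    weighted_mem hs' hk hqb
  have huq : ‖u‖ ≤ ‖q‖ := norm_weighted_le hs' hk q
  have hur : ‖u‖ ≤ solRadius s := (mem_ball_zero_iff.1 hu).le
  have hbρ : b * solRadius s ≤ 1 := by
    rw [solRadius, mul_one_div, div_le_one (by positivity)]
    linarith
  obtain ⟨t1, t2⟩ := norm_bilin_solution_le hb (norm_fstBilin_le hs hs' hk hκ.symm hl)
    (hγ u hu).1 hur hbρ
  obtain ⟨r1, r2⟩ := norm_bilin_solution_le hb (norm_sndBilin_le hs hs' hk hκ.symm hl)
    (hγ u hu).1 hur hbρ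
  have hΦn : ‖Φ u‖ ≤ 9 * ‖u‖ := by
    rw [hΦ]
    refine (norm_add_le _ _).trans ?_
    rw [LinearIsometryEquiv.norm_map]
    linarith
  have hΨn : ‖Ψ u‖ ≤ 9 * ‖u‖ := by
    rw [hΨ]
    refine (norm_add_le _ _).trans ?_
    rw [LinearIsometryEquiv.norm_map, LinearIsometryEquiv.norm_map]
    linarith
  have hkk : k * k ^ (2 * s - 1) = k ^ (2 * s) := by
    rw [← Real.rpow_one_add' hk.le (by linarith)]
    congr 1
    ring
  have hC : ((18 + 16 * b ^ 2).toNNReal : ℝ≥0∞) = ENNReal.ofReal (18 + 16 * b ^ 2) := rfl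
  have hkn : ‖κ‖ₑ = ENNReal.ofReal k := (ofReal_norm κ).symm
  refine ⟨?_, fun x => ⟨d.hasSum_g12Term x, d.hasSum_g21Term x⟩, ?_, ?_⟩
  · rw [h12 q hq, h21 q hq, fnNorm_evalFn hs hk, fnNorm_evalFn hs hk, fnNorm_eq_weighted hs' hk,
      hC, hkn, ← ENNReal.ofReal_add (by positivity) (by positivity),
      ← ENNReal.ofReal_mul (by positivity), ← ENNReal.ofReal_mul (by positivity)]
    refine ENNReal.ofReal_le_ofReal ?_
    calc k ^ (2 * s) * ‖Φ u‖ + k ^ (2 * s) * ‖Ψ u‖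
        ≤ k ^ (2 * s) * (9 * ‖u‖) + k ^ (2 * s) * (9 * ‖u‖) := by gcongr
      _ = 18 * (k ^ (2 * s) * ‖u‖) := by ring
      _ ≤ (18 + 16 * b ^ 2) * (k ^ (2 * s) * ‖u‖) := by
          gcongr
          linarith [sq_nonneg b]
      _ = (18 + 16 * b ^ 2) * k * (k ^ (2 * s - 1) * ‖u‖) := by
          rw [← hkk]
          ring
  -- Removing the term of degree one from `g` leaves exactly the bilinear remainder. In its cubic
  -- bound two of the three factors `‖u‖` are replaced by `‖q‖`, while the third supplies the norm
  -- of `H^(s-1/2)`.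
  · have tail12 : g12Tail κ q 3 = evalFn s k (fstBilin hs hs' hk hκ.symm hl u (γ u)) :=
      funext fun x => by
        obtain ⟨⟨i1, -⟩, i2, -⟩ := hid q hqb x
        have := map_add (evalCLM hs hk x) (fstOp hk hκ.symm hl u)
          (fstBilin hs hs' hk hκ.symm hl u (γ u))
        simp only [evalCLM_apply] at this
        rw [d.g12Tail_three, i1, i2, this, add_sub_cancel_left]
    have tail21 : g21Tail κ q 3 = evalFn s k (sndBilin hs hs' hk hκ.symm hl u (γ u)) :=
      funext fun x => by
        obtain ⟨⟨-, i1⟩, -, i2⟩ := hid q hqb x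
        have := map_add (evalCLM hs hk x) (sndOp hk hκ.symm hl (negConjReflect u))
          (sndBilin hs hs' hk hκ.symm hl u (γ u))
        simp only [evalCLM_apply] at this
        rw [d.g21Tail_three, i1, i2, this, add_sub_cancel_left]
    rw [tail12, tail21, fnNorm_evalFn hs hk, fnNorm_evalFn hs hk, fnNorm_eq_weighted hs' hk,
      hC, hkn, ← ofReal_norm (E := Lp ℂ 2 (volume : Measure ℝ)), ← ENNReal.ofReal_pow (norm_nonneg q),
      ← ENNReal.ofReal_add (by positivity) (by positivity), ← ENNReal.ofReal_mul (by positivity),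
      ← ENNReal.ofReal_mul (by positivity), ← ENNReal.ofReal_mul (by positivity)]
    refine ENNReal.ofReal_le_ofReal ?_
    calc k ^ (2 * s) * ‖fstBilin hs hs' hk hκ.symm hl u (γ u)‖ +
          k ^ (2 * s) * ‖sndBilin hs hs' hk hκ.symm hl u (γ u)‖
        ≤ k ^ (2 * s) * (8 * b ^ 2 * ‖u‖ * ‖u‖ ^ 2) +
          k ^ (2 * s) * (8 * b ^ 2 * ‖u‖ * ‖u‖ ^ 2) := by gcongr
      _ = 16 * b ^ 2 * (k ^ (2 * s) * ‖u‖ * ‖u‖ ^ 2) := by ring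
      _ ≤ (18 + 16 * b ^ 2) * (k ^ (2 * s) * ‖u‖ * ‖q‖ ^ 2) := by
          gcongr
          linarith
      _ = (18 + 16 * b ^ 2) * k * (k ^ (2 * s - 1) * ‖u‖) * ‖q‖ ^ 2 := by
          rw [← hkk]
          ring
  · rintro ⟨ψ, hψ⟩
    have e : q = ψ.toLp 2 := Lp.ext (hψ.trans (ψ.coeFn_toLp 2).symm)
    have huψ := weighted_schwartz hs' hk ψ
    rw [← e] at huψ
    have H := isDiagSolution_schwartz hs hs' hk hκ.symm hl huψ (hγ u hu).2.1 (hγ u hu).2.2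
    obtain ⟨φ₁, hφ₁⟩ := exists_schwartz fun n => (H.rapidDiff d.lam_ne n).1
    obtain ⟨φ₂, hφ₂⟩ := exists_schwartz fun n => (H.rapidDiff d.lam_ne n).2.1
    exact ⟨⟨φ₁, fun x => by rw [hφ₁, (hid q hqb x).1.1]⟩,
      ⟨φ₂, fun x => by rw [hφ₂, (hid q hqb x).1.2]⟩⟩
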